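/- **Notation.** Let $d>1$ be an integer. Fix a real-valued radial $\psi\in C_c^\infty(\mathbb R^d)$ supported in $\overline B(0,1)$ with $\int\psi=1$, put $\psi_{1/4}(\xi)=4^d\psi(4\xi)$ and $h=1-\psi_{1/4}*\mathbf 1_{B(0,3/4)}$ (so $h$ is smooth, $h=0$ on $B(0,1/2)$ and $h=1$ outside $B(0,1)$). Write $\langle\xi\rangle=(1+|\xi|^2)^{1/2}$, $D=-i\nabla$, and $(\mathcal F^{-1}g)(x)=\int_{\mathbb R^d}e^{ix\cdot\xi}g(\xi)\,d\xi$ in the sense of tempered distributions. For $\sigma\ge 1$ and $\lambda\in(0,d)$ let $F_\lambda=\mathcal F^{-1}[g_\lambda]$ with $g_\lambda(\xi)=\langle\xi\rangle^{-\sigma+1}h(\xi)|\xi|^{-\lambda}$. For $s,a\in\mathbb R$ let $s_+^a=s^a$ if $s>0$ and $0$ otherwise, and $s_-^a=(-s)^a$ if $s<0$ and $0$ otherwise. Let $J(\alpha)=\Gamma(\alpha+1)$. **Theorem.** There are nonzero constants $c_+,c_-\in\mathbb C$ depending only on $d$ such that the following holds for every $\lambda\in(\frac{d-1}2,d)$ with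 $\frac{d-1}2-\lambda\notin-\mathbb N$, every $\sigma\ge1$ and every $t\in\mathbb R\setminus\{0\}$. The tempered distribution $\langle D\rangle^{\sigma-1}e^{it|D|}F_\lambda$ is a locally integrable function, and, choosing a suitable representative: * For a.e. $x\in\mathbb R^d$, $$\begin{aligned}\langle D\rangle^{\sigma-1}e^{it|D|}F_\lambda(x)=\;&J\!\left(\tfrac{d-1}2-\lambda\right)|x|^{-\frac{d-1}2}\Big\{c_+\big[e^{i\frac\pi2(\frac{d+1}2-\lambda)}(|x|+t)_+^{\lambda-\frac{d+1}2}+e^{-i\frac\pi2(\frac{d+1}2-\lambda)}(|x|+t)_-^{\lambda-\frac{d+1}2}\big]\\&+c_-\big[e^{i\frac\pi2(\frac{d+1}2-\lambda)}(-|x|+t)_+^{\lambda-\frac{d+1}2}+e^{-i\frac\pi2(\frac{d+1}2-\lambda)}(-|x|+t)_-^{\lambda-\frac{d+1}2}\big]\Big\}+c_\lambda(x)+D_\lambda(x),\end{aligned}$$ where $D_\lambda\in C^\infty(\mathbb R^d)$ and, for all $x\ne0$, $|c_\lambda(x)|\le C|x|^{-\frac{d+1}2}$; if moreover $\lambda\in(\frac{d+1}2,d)$,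 then also $|c_\lambda(x)|\le C\min\{|x|^{-\frac{d+1}2},|x|^{-\frac{d-1}2}\}$ for all $x\neq 0$. (Here $c_\lambda$, $D_\lambda$ and $C$ may depend on the fixed data $d,\psi,\lambda,t$.) * For every $A>1$ and every real $N>d-\lambda$ there is a constant $C$, depending only on $d,\psi,\lambda,A,N$ and not on $t$ or $\sigma$, such that $|\langle D\rangle^{\sigma-1}e^{it|D|}F_\lambda(x)|\le C|x|^{-N}$ for all $x$ with $|x|\ge A|t|$. -/

import Mathlib

open MeasureTheory Metric
open scoped SchwartzMap FourierTransform ContDiff Convolution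

noncomputable section

namespace WaveData

variable {d : ℕ}

/-- The tempered distribution `T` on `ℝ^d` is (given by integration against) the function `f`. -/
def IsGivenBy (T : 𝓢'(EuclideanSpace ℝ (Fin d), ℂ)) (f : EuclideanSpace ℝ (Fin d) → ℂ) : Prop :=
  ∀ φ : 𝓢(EuclideanSpace ℝ (Fin d), ℂ),
    Integrable (fun x ↦ φ x * f x) ∧ T φ = ∫ x, φ x * f x

open Classical in
/-- The tempered distribution given by the function `f` (the junk value `0` if there is none). -/
def ofFun (f : EuclideanSpace ℝ (Fin d) → ℂ) : 𝓢'(EuclideanSpace ℝ (Fin d), ℂ) :=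
  if h : ∃ T, IsGivenBy T f then h.choose else 0

/-- The inverse Fourier transform `x ↦ ∫ e^{i x·ξ} g(ξ) dξ` of a function `g`, as a tempered
distribution. Mathlib's inverse transform `𝓕⁻` has the kernel `e^{2π i x·η}`, whence the
substitution `ξ = 2π η`. -/
def invFourier (g : EuclideanSpace ℝ (Fin d) → ℂ) : 𝓢'(EuclideanSpace ℝ (Fin d), ℂ) :=
  ((2 * Real.pi : ℝ) ^ d : ℂ) • 𝓕⁻ (ofFun fun η ↦ g ((2 * Real.pi) • η))

open Classical in
/-- The Fourier multiplier `m(D)`, `D = -i∇`, acting on a tempered distribution `T` whose Fourier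
transform is a function: the Fourier transform gets multiplied by `m` (junk value `0` if the
Fourier transform of `T` is not a function). In Mathlib's normalisation of `𝓕` the operator `D`
is multiplication by `2π η`. -/
def multiplier (m : EuclideanSpace ℝ (Fin d) → ℂ) (T : 𝓢'(EuclideanSpace ℝ (Fin d), ℂ)) :
    𝓢'(EuclideanSpace ℝ (Fin d), ℂ) :=
  if h : ∃ g, IsGivenBy (𝓕 T) g then
    𝓕⁻ (ofFun fun η ↦ m ((2 * Real.pi) • η) * h.choose η)
  else 0

theorem IsGivenBy.unique {T S : 𝓢'(EuclideanSpace ℝ (Fin d), ℂ)}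
    {f : EuclideanSpace ℝ (Fin d) → ℂ} (hT : IsGivenBy T f) (hS : IsGivenBy S f) : T = S := by
  ext φ
  rw [(hT φ).2, (hS φ).2]

theorem ofFun_eq {T : 𝓢'(EuclideanSpace ℝ (Fin d), ℂ)}
    {f : EuclideanSpace ℝ (Fin d) → ℂ} (hT : IsGivenBy T f) : ofFun f = T := by
  have h : ∃ T, IsGivenBy T f := ⟨T, hT⟩
  rw [ofFun, dif_pos h]
  exact h.choose_spec.unique hT

theorem IsGivenBy.ae_eq {T : 𝓢'(EuclideanSpace ℝ (Fin d), ℂ)}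
    {f g : EuclideanSpace ℝ (Fin d) → ℂ} (hf : IsGivenBy T f) (hg : IsGivenBy T g) :
    f =ᵐ[volume] g := by
  have key : ∀ f : EuclideanSpace ℝ (Fin d) → ℂ, IsGivenBy T f → LocallyIntegrable f := by
    intro f hf x
    let b : ContDiffBump x := ⟨1, 2, one_pos, one_lt_two⟩
    have hb₁ : HasCompactSupport (Complex.ofRealCLM ∘ b) := b.hasCompactSupport.comp_left rfl
    have hb₂ : ContDiff ℝ ∞ (Complex.ofRealCLM ∘ b) :=
      Complex.ofRealCLM.contDiff.comp b.contDiff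
    refine ⟨closedBall x 1, closedBall_mem_nhds x one_pos, ?_⟩
    refine ((hf (hb₁.toSchwartzMap hb₂)).1.integrableOn (s := closedBall x 1)).congr_fun ?_
      measurableSet_closedBall
    intro y hy
    have : b y = 1 := b.one_of_mem_closedBall hy
    simp [this]
  have h0 := ae_eq_zero_of_integral_contDiff_smul_eq_zero (μ := volume) (f := f - g)
    ((key f hf).sub (key g hg)) (fun φ hφ hc ↦ by
      have hc' : HasCompactSupport (Complex.ofRealCLM ∘ φ) := hc.comp_left rfl
      have hφ' : ContDiff ℝ ∞ (Complex.ofRealCLM ∘ φ) := by fun_prop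
      have h1 := hf (hc'.toSchwartzMap hφ')
      have h2 := hg (hc'.toSchwartzMap hφ')
      have h3 := h1.2.symm.trans h2.2
      rw [← sub_eq_zero, ← integral_sub h1.1 h2.1] at h3
      rw [← h3]
      congr 1
      ext x
      simp [mul_sub])
  filter_upwards [h0] with x hx
  simpa [sub_eq_zero] using hx

/-- `multiplier` does not depend on the choice of the function representing the transform. -/
theorem multiplier_eq {m g : EuclideanSpace ℝ (Fin d) → ℂ}
    {T S : 𝓢'(EuclideanSpace ℝ (Fin d), ℂ)} (hT : IsGivenBy (𝓕 T) g)
    (hS : IsGivenBy (𝓕 S) fun η ↦ m ((2 * Real.pi) • η) * g η) : multiplier m T = S := by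
  have h : ∃ g, IsGivenBy (𝓕 T) g := ⟨g, hT⟩
  have hae := h.choose_spec.ae_eq hT
  have : IsGivenBy (𝓕 S) fun η ↦ m ((2 * Real.pi) • η) * h.choose η := by
    intro φ
    have e : (fun x ↦ φ x * (m ((2 * Real.pi) • x) * g x)) =ᵐ[volume]
        fun x ↦ φ x * (m ((2 * Real.pi) • x) * h.choose x) := by
      filter_upwards [hae] with x hx
      rw [hx]
    exact ⟨(hS φ).1.congr e, (hS φ).2.trans (integral_congr_ae e)⟩
  rw [multiplier, dif_pos h, ofFun_eq this, FourierTransform.fourierInv_fourier_eq]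

/-- The radial mollifiers `ψ` from which the low frequency cutoff is made. -/
structure IsRadialMollifier (ψ : EuclideanSpace ℝ (Fin d) → ℝ) : Prop where
  smooth : ContDiff ℝ ∞ ψ
  support : Function.support ψ ⊆ closedBall 0 1
  integral_eq_one : ∫ x, ψ x = 1
  radial : ∃ ψ₁ : ℝ → ℝ, ∀ x, ψ x = ψ₁ ‖x‖

/-- `h = 1 - ψ_{1/4} ∗ 1_{B(0,3/4)}` with `ψ_{1/4}(ξ) = 4^d ψ(4ξ)`. -/
def cutoff (ψ : EuclideanSpace ℝ (Fin d) → ℝ) (ξ : EuclideanSpace ℝ (Fin d)) : ℝ :=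
  1 - ((fun η ↦ (4 : ℝ) ^ d * ψ ((4 : ℝ) • η)) ⋆[ContinuousLinearMap.mul ℝ ℝ, volume]
    (ball (0 : EuclideanSpace ℝ (Fin d)) (3 / 4)).indicator (fun _ ↦ (1 : ℝ))) ξ

/-- `⟨ξ⟩ = (1 + |ξ|²)^{1/2}`. -/
def bracket (ξ : EuclideanSpace ℝ (Fin d)) : ℝ := √(1 + ‖ξ‖ ^ 2)

/-- `g_λ(ξ) = ⟨ξ⟩^{1-σ} h(ξ) |ξ|^{-λ}`. -/
def gLam (ψ : EuclideanSpace ℝ (Fin d) → ℝ) (σ lam : ℝ) (ξ : EuclideanSpace ℝ (Fin d)) : ℝ :=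
  bracket ξ ^ (-σ + 1) * cutoff ψ ξ * ‖ξ‖ ^ (-lam)

/-- `F_λ`, the inverse Fourier transform of `g_λ`. -/
def FLam (ψ : EuclideanSpace ℝ (Fin d) → ℝ) (σ lam : ℝ) : 𝓢'(EuclideanSpace ℝ (Fin d), ℂ) :=
  invFourier fun ξ ↦ (gLam ψ σ lam ξ : ℂ)

/-- `⟨D⟩^s`. -/
def bracketD (s : ℝ) :
    𝓢'(EuclideanSpace ℝ (Fin d), ℂ) → 𝓢'(EuclideanSpace ℝ (Fin d), ℂ) :=
  multiplier fun ξ ↦ ((bracket ξ ^ s : ℝ) : ℂ)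

/-- `e^{it|D|}`. -/
def halfWave (t : ℝ) :
    𝓢'(EuclideanSpace ℝ (Fin d), ℂ) → 𝓢'(EuclideanSpace ℝ (Fin d), ℂ) :=
  multiplier fun ξ ↦ Complex.exp (Complex.I * t * ‖ξ‖)

/-- `s_+^a`: equal to `s^a` for `s > 0` and to `0` for `s ≤ 0`. -/
def posPow (s a : ℝ) : ℝ := if 0 < s then s ^ a else 0

/-- `s_-^a`: equal to `(-s)^a` for `s < 0` and to `0` for `s ≥ 0`. -/
def negPow (s a : ℝ) : ℝ := if s < 0 then (-s) ^ a else 0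

/-- `e^{i(π/2) b} s_+^{-b} + e^{-i(π/2) b} s_-^{-b}`. -/
def conePow (b s : ℝ) : ℂ :=
  Complex.exp (Complex.I * (Real.pi / 2) * b) * (posPow s (-b) : ℂ) +
    Complex.exp (-(Complex.I * (Real.pi / 2) * b)) * (negPow s (-b) : ℂ)

/-- The explicit singular part, as a function of `r = |x|`; the first factor is
`J((d-1)/2 - λ)` with `J(α) = Γ(α + 1)`. -/
def mainTerm (d : ℕ) (cp cm : ℂ) (lam t r : ℝ) : ℂ :=
  (Real.Gamma (((d : ℝ) - 1) / 2 - lam + 1) : ℂ) * ((r ^ (-(((d : ℝ) - 1) / 2)) : ℝ) : ℂ) *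
    (cp * conePow (((d : ℝ) + 1) / 2 - lam) (r + t) +
      cm * conePow (((d : ℝ) + 1) / 2 - lam) (-r + t))

end WaveData

end

/-!
The factors `⟨ξ⟩ ^ (±(σ - 1))` cancel, so that the distribution is the inverse Fourier transform of
`e^{it|ξ|} h(|ξ|) |ξ|^{-λ}`, and `σ` plays no further role. The proof replaces `-it` by a complex
number `y` with `Re y > 0`. The integral then converges absolutely and is computed by slicing:
rotate `x` to the first axis, integrate radially in the other coordinates, and use polar coordinates
in the remaining half-plane. With `p = d - λ` and `κ = (d - 3) / 2` this gives

  `const · ∫_{-1}^1 (1 - τ²) ^ κ H(y + i|x|τ) dτ`,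

where `H` (`coneProfile`) is the Laplace transform of `r ^ (p - 1) h(r)`. It equals `Γ(p) ζ ^ (-p)`
minus an entire function that is bounded on the right half-plane; as `h` vanishes near the origin,
integration by parts shows that it also decays to every order `N > p`
(`exists_decay_coneProfile`).

On the boundary `Re y = 0` the argument `y + i|x|τ` runs through the singularity at `0` when
`|x| > |Im y|`. By Cauchy's theorem the segment from `-i` to `i` may be replaced by the polygon
`-i → 1 - i → 1 + i → i` (`integral_eq_archIntegral`). There `y + |x|v` stays in the closed right
half-plane and vanishes only at the end points `±i`, and only on the light cone. The resulting
formula (`waveKernel`) makes sense up to `Re y = 0`, and everything is read off from it.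

* The decay of `H` gives the decay of the kernel for `|x| ≥ A|t|`, uniformly in `t`
  (`exists_decay_waveKernel`).
* The kernel is holomorphic in the parameter `|x|`, hence smooth off the cone
  (`contDiffAt_waveKernel`).
* On the two horizontal legs the weight is `(±2iw) ^ κ` to leading order, and the Beta integral
  `∫_0^∞ w ^ κ Γ(p) (ζ + ρw) ^ (-p) dw = Γ(κ + 1) Γ(b) ρ ^ (-(κ + 1)) ζ ^ (-b)`, where
  `b = (d + 1) / 2 - λ`, produces the main term for `b > 0`; the errors are absolutely convergent
  integrals of size `|x| ^ (-p) + 1` (`exists_norm_waveKernel_sub_waveMain_le`). For `b < 0` both the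
  kernel and the main term are bounded across the cone (`exists_bound_waveKernel_of_lt`).
* Uniformly in `Re y ≥ 0` the kernel is dominated by a function that is integrable across the cone,
  so the damping can be removed by dominated convergence on both sides of the duality with a
  Schwartz function (`isGivenBy_waveFun`).

Finally the remainder, which is smooth for `|x| > |t|`, is cut off by a bump function `χ` that is
`1` for `|x| ≤ 2|t|` and `0` for `|x| ≥ 3|t|`: the part with `χ` obeys the pointwise bounds, the part
with `1 - χ` is smooth (`exists_decomposition`).
-/

namespace WaveData

open Set Filter Topology Complex

/-! ### Laplace integrals on a half-plane -/

/-- `∫₀^∞ f(r) e^{-ζ r} dr` is complex differentiable in `ζ` inside its half-plane of absolute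
convergence. -/
theorem differentiableAt_laplace {f : ℝ → ℂ} {c : ℝ}
    (hf : AEStronglyMeasurable f (volume.restrict (Ioi 0)))
    (hint : ∀ s > c, IntegrableOn (fun r ↦ ‖f r‖ * Real.exp (-(s * r))) (Ioi 0))
    {ζ : ℂ} (hζ : c < ζ.re) :
    DifferentiableAt ℂ (fun ζ : ℂ ↦ ∫ r in Ioi (0 : ℝ), f r * cexp (-(ζ * r))) ζ := by
  obtain ⟨δ, hδ, hδc⟩ : ∃ δ : ℝ, 0 < δ ∧ c < ζ.re - 2 * δ :=
    ⟨(ζ.re - c) / 4, by linarith, by linarith⟩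
  have hmeas : ∀ z : ℂ, AEStronglyMeasurable (fun r : ℝ ↦ f r * cexp (-(z * r)))
      (volume.restrict (Ioi 0)) := fun z ↦ hf.mul (by fun_prop)
  have hnorm : ∀ (z : ℂ) (r : ℝ), ‖f r * cexp (-(z * r))‖ = ‖f r‖ * Real.exp (-(z.re * r)) := by
    intro z r
    rw [norm_mul, Complex.norm_exp]
    simp
  refine (hasDerivAt_integral_of_dominated_loc_of_deriv_le (𝕜 := ℂ) (ball_mem_nhds ζ hδ)
    (F' := fun z r ↦ f r * (cexp (-(z * r)) * (-r)))
    (bound := fun r ↦ δ⁻¹ * (‖f r‖ * Real.exp (-((ζ.re - 2 * δ) * r))))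
    (Eventually.of_forall hmeas) ?_ ?_ ?_ ?_ ?_).2.differentiableAt
  · refine (hint ζ.re hζ).mono' (hmeas ζ) (Eventually.of_forall fun r ↦ (hnorm ζ r).le)
  · exact hf.mul (by fun_prop)
  · filter_upwards [ae_restrict_mem measurableSet_Ioi] with r hr z hz
    have hr : 0 < r := hr
    have h1 : ζ.re - δ < z.re := by
      have h2 := (Complex.abs_re_le_norm (z - ζ)).trans_lt (mem_ball_iff_norm.1 hz)
      rw [Complex.sub_re, abs_lt] at h2
      linarith
    rw [← mul_assoc, norm_mul, hnorm, norm_neg, Complex.norm_real, Real.norm_of_nonneg hr.le]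
    have h3 : r ≤ δ⁻¹ * Real.exp (δ * r) := by
      have := Real.add_one_le_exp (δ * r)
      rw [inv_mul_eq_div, le_div_iff₀ hδ]
      linarith
    have h4 : Real.exp (-(z.re * r)) ≤ Real.exp (-((ζ.re - δ) * r)) := by
      apply Real.exp_le_exp.2
      nlinarith
    calc ‖f r‖ * Real.exp (-(z.re * r)) * r
        ≤ ‖f r‖ * Real.exp (-((ζ.re - δ) * r)) * (δ⁻¹ * Real.exp (δ * r)) := by gcongr
      _ = δ⁻¹ * (‖f r‖ * (Real.exp (-((ζ.re - δ) * r)) * Real.exp (δ * r))) := by ring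
      _ = δ⁻¹ * (‖f r‖ * Real.exp (-((ζ.re - 2 * δ) * r))) := by
          rw [← Real.exp_add]; congr 3; ring
  · exact (hint _ hδc).const_mul _
  · refine Eventually.of_forall fun r z _ ↦ ?_
    have h1 : HasDerivAt (fun z : ℂ ↦ -(z * r)) (-(r : ℂ)) z := by
      simpa using ((hasDerivAt_id z).mul_const (r : ℂ)).fun_neg
    exact h1.cexp.const_mul _

theorem integrableOn_rpow_mul_exp {a s : ℝ} (ha : 0 < a) (hs : 0 < s) :
    IntegrableOn (fun r : ℝ ↦ r ^ (a - 1) * Real.exp (-(s * r))) (Ioi 0) := by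
  have := integrableOn_rpow_mul_exp_neg_mul_rpow (p := 1) (s := a - 1) (b := s) (by linarith)
    one_pos hs
  simpa using this

theorem aestronglyMeasurable_ofReal_rpow (a : ℝ) (μ : Measure ℝ) :
    AEStronglyMeasurable (fun r : ℝ ↦ ((r ^ a : ℝ) : ℂ)) μ := by
  apply Measurable.aestronglyMeasurable
  fun_prop

/-- Euler's integral for `ζ ^ (-a)` in the right half-plane. -/
theorem integral_rpow_mul_cexp {a : ℝ} (ha : 0 < a) {ζ : ℂ} (hζ : 0 < ζ.re) :
    ∫ r in Ioi (0 : ℝ), ((r ^ (a - 1) : ℝ) : ℂ) * cexp (-(ζ * r)) =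
      Real.Gamma a * ζ ^ (-(a : ℂ)) := by
  have hU : IsOpen {z : ℂ | 0 < z.re} := isOpen_lt continuous_const Complex.continuous_re
  have hf : AnalyticOnNhd ℂ
      (fun ζ : ℂ ↦ ∫ r in Ioi (0 : ℝ), ((r ^ (a - 1) : ℝ) : ℂ) * cexp (-(ζ * r)))
      {z : ℂ | 0 < z.re} := by
    refine DifferentiableOn.analyticOnNhd (fun z hz ↦ ?_) hU
    refine (differentiableAt_laplace (c := 0) (aestronglyMeasurable_ofReal_rpow _ _)
      (fun s hs ↦ ?_) hz).differentiableWithinAt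
    refine (integrableOn_rpow_mul_exp ha hs).congr_fun (fun r hr ↦ ?_) measurableSet_Ioi
    have hr : 0 < r := hr
    simp only [Complex.norm_real]
    rw [Real.norm_of_nonneg (by positivity)]
  have hg : AnalyticOnNhd ℂ (fun ζ : ℂ ↦ (Real.Gamma a : ℂ) * ζ ^ (-(a : ℂ)))
      {z : ℂ | 0 < z.re} := by
    refine DifferentiableOn.analyticOnNhd (fun z hz ↦ ?_) hU
    refine (DifferentiableAt.const_mul ?_ _).differentiableWithinAt
    exact (differentiableAt_id.cpow_const (Or.inl hz))
  have hconn : IsPreconnected {z : ℂ | 0 < z.re} := (convex_halfSpace_re_gt 0).isPreconnected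
  refine hf.eqOn_of_preconnected_of_frequently_eq hg hconn (z₀ := 1) (by simp) ?_ hζ
  have hreal : ∀ s : ℝ, 0 < s →
      ∫ r in Ioi (0 : ℝ), ((r ^ (a - 1) : ℝ) : ℂ) * cexp (-((s : ℂ) * r)) =
      Real.Gamma a * (s : ℂ) ^ (-(a : ℂ)) := by
    intro s hs
    have := Real.integral_rpow_mul_exp_neg_mul_Ioi ha hs
    have h2 : ∫ r in Ioi (0 : ℝ), ((r ^ (a - 1) : ℝ) : ℂ) * cexp (-((s : ℂ) * r)) =
        ∫ r in Ioi (0 : ℝ), ((r ^ (a - 1) * Real.exp (-(s * r)) : ℝ) : ℂ) := by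
      simp
    rw [h2, integral_complex_ofReal, this, ← Complex.ofReal_neg, ← Complex.ofReal_cpow hs.le,
      ← Complex.ofReal_mul]
    congr 1
    rw [one_div, Real.inv_rpow hs.le, Real.rpow_neg hs.le, mul_comm]
  have hlim : Tendsto (fun n : ℕ ↦ ((1 + 1 / ((n : ℝ) + 1) : ℝ) : ℂ)) atTop (𝓝[≠] 1) := by
    refine tendsto_nhdsWithin_iff.2 ⟨?_, Eventually.of_forall fun n ↦ ?_⟩
    · have h1 : Tendsto (fun n : ℕ ↦ (1 + 1 / ((n : ℝ) + 1) : ℝ)) atTop (𝓝 (1 + 0)) :=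
        tendsto_const_nhds.add tendsto_one_div_add_atTop_nhds_zero_nat
      have h2 := (Complex.continuous_ofReal.tendsto (1 + 0 : ℝ)).comp h1
      simpa [Function.comp_def] using! h2
    · have h1 : (0 : ℝ) < 1 / ((n : ℝ) + 1) := by positivity
      intro h
      have h2 : (1 + 1 / ((n : ℝ) + 1) : ℝ) = 1 := by
        apply Complex.ofReal_injective
        simpa using h
      linarith
  exact hlim.frequently (Frequently.of_forall fun n ↦ hreal _ (by positivity))

/-- A smooth function on the line that vanishes for `r < 1/2` and equals `c r ^ q` for `r > 1`. -/
structure IsSymbolLike (c q : ℝ) (f : ℝ → ℝ) : Prop where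
  smooth : ContDiff ℝ ∞ f
  zero : ∀ r < 1 / 2, f r = 0
  tail : ∀ r, 1 < r → f r = c * r ^ q

theorem IsSymbolLike.deriv {c q : ℝ} {f : ℝ → ℝ} (hf : IsSymbolLike c q f) :
    IsSymbolLike (c * q) (q - 1) (deriv f) where
  smooth := by
    have := hf.smooth
    rw [show (∞ : WithTop ℕ∞) = ∞ + 1 from rfl] at this
    exact (contDiff_succ_iff_deriv.1 this).2.2
  zero r hr := by
    have : f =ᶠ[𝓝 r] fun _ ↦ 0 := by
      filter_upwards [Iio_mem_nhds hr] with s hs using hf.zero s hs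
    rw [this.deriv_eq, deriv_const]
  tail r hr := by
    have : f =ᶠ[𝓝 r] fun s ↦ c * s ^ q := by
      filter_upwards [Ioi_mem_nhds hr] with s hs using hf.tail s hs
    rw [this.deriv_eq]
    have := (Real.hasDerivAt_rpow_const (p := q) (Or.inl (by linarith : r ≠ 0))).const_mul c
    rw [this.deriv]
    ring

/-- A crude polynomial bound, which makes all Laplace integrals absolutely convergent. -/
theorem IsSymbolLike.exists_bound {c q : ℝ} {f : ℝ → ℝ} (hf : IsSymbolLike c q f) :
    ∃ C a : ℝ, 0 < a ∧ ∀ r, 0 < r → |f r| ≤ C * r ^ (a - 1) := by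
  set m : ℝ := |q| + 1
  obtain ⟨B, hB⟩ := (isCompact_Icc (a := (0 : ℝ)) (b := 1)).exists_bound_of_continuousOn
    hf.smooth.continuous.continuousOn
  have hB0 : 0 ≤ B := (norm_nonneg _).trans (hB 0 (by simp))
  have hm : 0 ≤ m := by positivity
  refine ⟨B * 2 ^ m + |c|, m + 1, by positivity, fun r hr ↦ ?_⟩
  rw [add_sub_cancel_right]
  rcases lt_or_ge r (1 / 2) with h | h
  · rw [hf.zero r h, abs_zero]; positivity
  rcases le_or_gt r 1 with h1 | h1
  · have h2 : (1 : ℝ) ≤ 2 ^ m * r ^ m := by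
      rw [← Real.mul_rpow (by norm_num) hr.le]
      exact Real.one_le_rpow (by linarith) hm
    calc |f r| ≤ B := hB r ⟨hr.le, h1⟩
      _ ≤ B * (2 ^ m * r ^ m) := le_mul_of_one_le_right hB0 h2
      _ ≤ (B * 2 ^ m + |c|) * r ^ m := by
          have : 0 ≤ |c| * r ^ m := by positivity
          linarith
  · rw [hf.tail r h1, abs_mul, abs_of_pos (Real.rpow_pos_of_pos hr q)]
    have h2 : r ^ q ≤ r ^ m :=
      Real.rpow_le_rpow_of_exponent_le h1.le (by linarith [le_abs_self q])
    have : 0 ≤ B * 2 ^ m * r ^ m := by positivity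
    have := mul_le_mul_of_nonneg_left h2 (abs_nonneg c)
    linarith

theorem IsSymbolLike.integrableOn {c q : ℝ} {f : ℝ → ℝ} (hf : IsSymbolLike c q f) {ζ : ℂ}
    (hζ : 0 < ζ.re) : IntegrableOn (fun r : ℝ ↦ (f r : ℂ) * cexp (-(ζ * r))) (Ioi 0) := by
  obtain ⟨C, a, ha, hC⟩ := hf.exists_bound
  have hc := hf.smooth.continuous
  refine ((integrableOn_rpow_mul_exp ha hζ).const_mul C).mono'
    (by apply Continuous.aestronglyMeasurable; fun_prop) ?_
  filter_upwards [ae_restrict_mem measurableSet_Ioi] with r hr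
  rw [norm_mul, Complex.norm_exp, Complex.norm_real, ← mul_assoc]
  have : (-(ζ * r)).re = -(ζ.re * r) := by simp
  rw [this]
  gcongr
  exact hC r hr

/-- Integration by parts in the Laplace integral. -/
theorem IsSymbolLike.laplace_deriv {c q : ℝ} {f : ℝ → ℝ} (hf : IsSymbolLike c q f) {ζ : ℂ}
    (hζ : 0 < ζ.re) :
    ζ * ∫ r in Ioi (0 : ℝ), (f r : ℂ) * cexp (-(ζ * r)) =
      ∫ r in Ioi (0 : ℝ), ((_root_.deriv f r : ℝ) : ℂ) * cexp (-(ζ * r)) := by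
  have h1 := hf.integrableOn hζ
  have h2 := hf.deriv.integrableOn hζ
  obtain ⟨C, a, ha, hC⟩ := hf.exists_bound
  have hd : ∀ r : ℝ, HasDerivAt (fun r : ℝ ↦ (f r : ℂ) * cexp (-(ζ * r)))
      (((_root_.deriv f r : ℝ) : ℂ) * cexp (-(ζ * r)) - ζ * ((f r : ℂ) * cexp (-(ζ * r)))) r := by
    intro r
    have e1 : HasDerivAt (fun r : ℝ ↦ (f r : ℂ)) ((_root_.deriv f r : ℝ) : ℂ) r :=
      ((hf.smooth.differentiable (by simp)) r).hasDerivAt.ofReal_comp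
    have e2 : HasDerivAt (fun r : ℝ ↦ -(ζ * (r : ℂ))) (-ζ) r := by
      simpa using ((hasDerivAt_id r).ofReal_comp.const_mul ζ).fun_neg
    convert! e1.mul e2.cexp using 1
    ring
  have hlim : Tendsto (fun r : ℝ ↦ (f r : ℂ) * cexp (-(ζ * r))) atTop (𝓝 0) := by
    rw [tendsto_zero_iff_norm_tendsto_zero]
    have h3 := (tendsto_rpow_mul_exp_neg_mul_atTop_nhds_zero (a - 1) ζ.re hζ).const_mul C
    rw [mul_zero] at h3
    refine squeeze_zero' (Eventually.of_forall fun r ↦ norm_nonneg _) ?_ h3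
    filter_upwards [eventually_gt_atTop 0] with r hr
    rw [norm_mul, Complex.norm_exp, Complex.norm_real, ← mul_assoc]
    have : (-(ζ * r)).re = -ζ.re * r := by simp
    rw [this]
    gcongr
    exact hC r hr
  have := integral_Ioi_of_hasDerivAt_of_tendsto' (a := 0) (m := 0)
    (f := fun r : ℝ ↦ (f r : ℂ) * cexp (-(ζ * r))) (fun r _ ↦ hd r) (h2.sub (h1.const_mul ζ)) hlim
  rw [integral_sub h2 (h1.const_mul ζ), integral_const_mul, hf.zero 0 (by norm_num)] at this
  simp only [ofReal_zero, zero_mul, sub_zero] at this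
  exact (sub_eq_zero.1 this).symm

/-- Repeated integration by parts: the Laplace integral decays to any order that makes the
differentiated amplitude integrable. -/
theorem IsSymbolLike.laplace_decay (m : ℕ) : ∀ {c q : ℝ} {f : ℝ → ℝ}, IsSymbolLike c q f →
    q - m < -1 → ∃ C : ℝ, ∀ ζ : ℂ, 0 < ζ.re →
      ‖∫ r in Ioi (0 : ℝ), (f r : ℂ) * cexp (-(ζ * r))‖ ≤ C * ‖ζ‖ ^ (-(m : ℝ)) := by
  induction m with
  | zero =>
    intro c q f hf hq
    have hq : q < -1 := by simpa using hq
    have hint : IntegrableOn (fun r ↦ ‖f r‖) (Ioi 0) := by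
      rw [← Ioc_union_Ioi_eq_Ioi (zero_le_one (α := ℝ))]
      refine IntegrableOn.union ?_ ?_
      · exact (hf.smooth.continuous.norm.integrableOn_Icc).mono_set Ioc_subset_Icc_self
      · have h1 : IntegrableOn (fun r : ℝ ↦ c * r ^ q) (Ioi 1) :=
          (integrableOn_Ioi_rpow_of_lt hq one_pos).const_mul c
        have h2 : IntegrableOn f (Ioi 1) :=
          h1.congr_fun (fun r hr ↦ (hf.tail r hr).symm) measurableSet_Ioi
        exact h2.norm
    refine ⟨∫ r in Ioi (0 : ℝ), ‖f r‖, fun ζ hζ ↦ ?_⟩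
    simp only [CharP.cast_eq_zero, neg_zero, Real.rpow_zero, mul_one]
    refine norm_integral_le_of_norm_le hint ?_
    filter_upwards [ae_restrict_mem measurableSet_Ioi] with r hr
    have hr : 0 < r := hr
    rw [norm_mul, Complex.norm_exp, Complex.norm_real]
    refine mul_le_of_le_one_right (norm_nonneg _) (Real.exp_le_one_iff.2 ?_)
    simp only [neg_re, re_mul_ofReal]
    nlinarith
  | succ m ih =>
    intro c q f hf hq
    obtain ⟨C, hC⟩ := ih hf.deriv (by push_cast at hq; linarith)
    refine ⟨C, fun ζ hζ ↦ ?_⟩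
    have hζ0 : 0 < ‖ζ‖ := norm_pos_iff.2 (by rintro rfl; simp at hζ)
    have h := hC ζ hζ
    rw [← hf.laplace_deriv hζ, norm_mul] at h
    have e : ‖ζ‖ ^ (-((m + 1 : ℕ) : ℝ)) = ‖ζ‖ ^ (-(m : ℝ)) / ‖ζ‖ := by
      rw [← Real.rpow_sub_one hζ0.ne']; congr 1; push_cast; ring
    rw [e, ← mul_div_assoc, le_div_iff₀ hζ0]
    linarith

/-! ### The Laplace profile of a cut-off power -/

/-- A radial profile of a low frequency cutoff: smooth, `0` near the origin, `1` far out. -/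
structure IsCutoffProfile (h : ℝ → ℝ) : Prop where
  smooth : ContDiff ℝ ∞ h
  zero : ∀ r < 1 / 2, h r = 0
  one : ∀ r, 1 ≤ r → h r = 1

theorem IsCutoffProfile.isSymbolLike {h : ℝ → ℝ} (hh : IsCutoffProfile h) (q : ℝ) :
    IsSymbolLike 1 q (fun r ↦ r ^ q * h r) where
  smooth := by
    rw [contDiff_iff_contDiffAt]
    intro r
    rcases lt_or_ge r (1 / 2) with hr | hr
    · refine (contDiffAt_const (c := (0 : ℝ))).congr_of_eventuallyEq ?_
      filter_upwards [Iio_mem_nhds hr] with s hs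
      rw [hh.zero s hs, mul_zero]
    · exact (Real.contDiffAt_rpow_const_of_ne (by linarith)).mul hh.smooth.contDiffAt
  zero r hr := by rw [hh.zero r hr, mul_zero]
  tail r hr := by rw [hh.one r hr.le]; ring

theorem IsCutoffProfile.exists_bound {h : ℝ → ℝ} (hh : IsCutoffProfile h) :
    ∃ B : ℝ, ∀ r, |h r| ≤ B := by
  obtain ⟨B, hB⟩ := (isCompact_Icc (a := (0 : ℝ)) (b := 1)).exists_bound_of_continuousOn
    hh.smooth.continuous.continuousOn
  have hB1 : 1 ≤ B := by simpa [hh.one 1 le_rfl] using hB 1 (by simp)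
  refine ⟨B, fun r ↦ ?_⟩
  rcases lt_or_ge r 0 with h0 | h0
  · rw [hh.zero r (by linarith), abs_zero]; linarith
  rcases le_or_gt r 1 with h1 | h1
  · exact hB r ⟨h0, h1⟩
  · rw [hh.one r h1.le, abs_one]; exact hB1

/-- The Laplace transform of `r ^ (p - 1) (1 - h r)`, an entire function. -/
noncomputable def lowLaplace (p : ℝ) (h : ℝ → ℝ) (ζ : ℂ) : ℂ :=
  ∫ r in Ioi (0 : ℝ), ((r ^ (p - 1) * (1 - h r) : ℝ) : ℂ) * cexp (-(ζ * r))

/-- The Laplace transform of `r ^ (p - 1) h r`, continued holomorphically to the slit plane by means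
of `∫₀^∞ r ^ (p - 1) e^{-ζ r} dr = Γ(p) ζ ^ (-p)`. -/
noncomputable def coneProfile (p : ℝ) (h : ℝ → ℝ) (ζ : ℂ) : ℂ :=
  Real.Gamma p * ζ ^ (-(p : ℂ)) - lowLaplace p h ζ

section

variable {p : ℝ} {h : ℝ → ℝ}

theorem aestronglyMeasurable_low (hh : IsCutoffProfile h) :
    AEStronglyMeasurable (fun r : ℝ ↦ ((r ^ (p - 1) * (1 - h r) : ℝ) : ℂ))
      (volume.restrict (Ioi 0)) := by
  have := hh.smooth.continuous.measurable
  apply Measurable.aestronglyMeasurable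
  fun_prop

theorem integrableOn_low (hp : 0 < p) (hh : IsCutoffProfile h) (s : ℝ) :
    IntegrableOn (fun r : ℝ ↦ ‖((r ^ (p - 1) * (1 - h r) : ℝ) : ℂ)‖ * Real.exp (-(s * r)))
      (Ioi 0) := by
  obtain ⟨B, hB⟩ := hh.exists_bound
  have hc := hh.smooth.continuous.measurable
  refine ((integrableOn_rpow_mul_exp hp one_pos).const_mul
    ((1 + B) * Real.exp (1 + |s|))).mono'
    (by apply Measurable.aestronglyMeasurable; fun_prop) ?_
  filter_upwards [ae_restrict_mem measurableSet_Ioi] with r hr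
  have hr : 0 < r := hr
  have hrp : 0 < r ^ (p - 1) := Real.rpow_pos_of_pos hr _
  have hB0 : 0 ≤ B := (abs_nonneg _).trans (hB 0)
  rw [norm_mul, norm_norm, Complex.norm_real, norm_mul, Real.norm_of_nonneg hrp.le,
    Real.norm_of_nonneg (Real.exp_pos _).le]
  rcases le_or_gt r 1 with h1 | h1
  · have e1 : ‖1 - h r‖ ≤ 1 + B := by
      refine (norm_sub_le _ _).trans ?_
      rw [norm_one]
      gcongr
      exact hB r
    have e2 : Real.exp (-(s * r)) ≤ Real.exp (1 + |s|) * Real.exp (-(1 * r)) := by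
      rw [← Real.exp_add]
      apply Real.exp_le_exp.2
      have h3 : -(s * r) ≤ |s| * r := by nlinarith [neg_abs_le s]
      nlinarith [abs_nonneg s]
    calc r ^ (p - 1) * ‖1 - h r‖ * Real.exp (-(s * r))
        ≤ r ^ (p - 1) * (1 + B) * (Real.exp (1 + |s|) * Real.exp (-(1 * r))) := by gcongr
      _ = _ := by ring
  · rw [hh.one r h1.le, sub_self, norm_zero, mul_zero, zero_mul]
    positivity

theorem differentiable_lowLaplace (hp : 0 < p) (hh : IsCutoffProfile h) :
    Differentiable ℂ (lowLaplace p h) := fun ζ ↦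
  differentiableAt_laplace (c := ζ.re - 1) (aestronglyMeasurable_low hh)
    (fun s _ ↦ integrableOn_low hp hh s) (by linarith)

theorem exists_bound_lowLaplace (hp : 0 < p) (hh : IsCutoffProfile h) :
    ∃ C : ℝ, 0 ≤ C ∧ ∀ ζ : ℂ, 0 ≤ ζ.re → ‖lowLaplace p h ζ‖ ≤ C := by
  have hi := integrableOn_low hp hh 0
  simp only [zero_mul, neg_zero, Real.exp_zero, mul_one] at hi
  refine ⟨∫ r in Ioi (0 : ℝ), ‖((r ^ (p - 1) * (1 - h r) : ℝ) : ℂ)‖,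
    integral_nonneg fun _ ↦ norm_nonneg _, fun ζ hζ ↦ ?_⟩
  refine norm_integral_le_of_norm_le hi ?_
  filter_upwards [ae_restrict_mem measurableSet_Ioi] with r hr
  have hr : 0 < r := hr
  rw [norm_mul, Complex.norm_exp]
  refine mul_le_of_le_one_right (norm_nonneg _) (Real.exp_le_one_iff.2 ?_)
  simp only [neg_re, re_mul_ofReal]
  nlinarith

theorem differentiableOn_coneProfile (hp : 0 < p) (hh : IsCutoffProfile h) :
    DifferentiableOn ℂ (coneProfile p h) slitPlane := fun ζ hζ ↦ by
  refine (DifferentiableAt.sub (DifferentiableAt.const_mul ?_ _)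
    (differentiable_lowLaplace hp hh ζ)).differentiableWithinAt
  exact differentiableAt_id.cpow_const hζ

theorem coneProfile_eq_integral (hp : 0 < p) (hh : IsCutoffProfile h) {ζ : ℂ} (hζ : 0 < ζ.re) :
    coneProfile p h ζ =
      ∫ r in Ioi (0 : ℝ), ((r ^ (p - 1) * h r : ℝ) : ℂ) * cexp (-(ζ * r)) := by
  have h1 := (hh.isSymbolLike (p - 1)).integrableOn hζ
  have h2 : IntegrableOn (fun r : ℝ ↦ ((r ^ (p - 1) * (1 - h r) : ℝ) : ℂ) * cexp (-(ζ * r)))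
      (Ioi 0) := by
    refine (integrableOn_low hp hh ζ.re).mono'
      ((aestronglyMeasurable_low hh).mul (by fun_prop)) (Eventually.of_forall fun r ↦ ?_)
    rw [norm_mul, Complex.norm_exp]
    simp
  have h3 := integral_add h1 h2
  rw [coneProfile, lowLaplace, ← integral_rpow_mul_cexp hp hζ, sub_eq_iff_eq_add, ← h3]
  congr 1
  ext r
  push_cast
  ring

theorem mem_slitPlane_of_re_nonneg {ζ : ℂ} (h : 0 ≤ ζ.re) (h0 : ζ ≠ 0) : ζ ∈ slitPlane := by
  rcases h.lt_or_eq with h | h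
  · exact Or.inl h
  · refine Or.inr fun him ↦ h0 (Complex.ext h.symm him)

theorem exists_bound_coneProfile (hp : 0 < p) (hh : IsCutoffProfile h) :
    ∃ C : ℝ, 0 ≤ C ∧ ∀ ζ : ℂ, 0 ≤ ζ.re → ‖coneProfile p h ζ‖ ≤ C * (‖ζ‖ ^ (-p) + 1) := by
  obtain ⟨C, hC0, hC⟩ := exists_bound_lowLaplace hp hh
  have hG : 0 ≤ Real.Gamma p := (Real.Gamma_pos_of_pos hp).le
  refine ⟨Real.Gamma p + C, by positivity, fun ζ hζ ↦ ?_⟩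
  have h1 : ‖(Real.Gamma p : ℂ) * ζ ^ (-(p : ℂ))‖ = Real.Gamma p * ‖ζ‖ ^ (-p) := by
    rw [norm_mul, Complex.norm_real, Real.norm_of_nonneg hG, ← ofReal_neg, Complex.norm_cpow_real]
  refine (norm_sub_le _ _).trans ?_
  rw [h1]
  have := hC ζ hζ
  have : 0 ≤ ‖ζ‖ ^ (-p) := by positivity
  nlinarith

/-- Since `h` vanishes near the origin, the profile decays to every order `N > p` on the closed right
half-plane, with the homogeneous singularity at `0` as the only obstruction. -/
theorem exists_decay_coneProfile (hp : 0 < p) (hh : IsCutoffProfile h) {N : ℝ} (hN : p < N) :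
    ∃ C : ℝ, 0 ≤ C ∧ ∀ ζ : ℂ, 0 ≤ ζ.re → ζ ≠ 0 → ‖coneProfile p h ζ‖ ≤ C * ‖ζ‖ ^ (-N) := by
  obtain ⟨C₁, hC₁0, hC₁⟩ := exists_bound_coneProfile hp hh
  obtain ⟨m, hm⟩ := exists_nat_ge N
  obtain ⟨C₂, hC₂⟩ := (hh.isSymbolLike (p - 1)).laplace_decay m (by linarith)
  have key : ∀ ζ : ℂ, 0 < ζ.re → ‖coneProfile p h ζ‖ ≤ (2 * C₁ + |C₂|) * ‖ζ‖ ^ (-N) := by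
    intro ζ hζ
    have h0 : 0 < ‖ζ‖ := norm_pos_iff.2 (by rintro rfl; simp at hζ)
    have hN0 : 0 ≤ ‖ζ‖ ^ (-N) := by positivity
    rcases le_or_gt ‖ζ‖ 1 with h1 | h1
    · have e1 : ‖ζ‖ ^ (-p) ≤ ‖ζ‖ ^ (-N) := Real.rpow_le_rpow_of_exponent_ge h0 h1 (by linarith)
      have e2 : 1 ≤ ‖ζ‖ ^ (-N) := Real.one_le_rpow_of_pos_of_le_one_of_nonpos h0 h1 (by linarith)
      have e3 := hC₁ ζ hζ.le
      have : 0 ≤ |C₂| * ‖ζ‖ ^ (-N) := by positivity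
      nlinarith
    · have e1 : ‖ζ‖ ^ (-(m : ℝ)) ≤ ‖ζ‖ ^ (-N) :=
        Real.rpow_le_rpow_of_exponent_le h1.le (by linarith)
      have e2 := hC₂ ζ hζ
      rw [← coneProfile_eq_integral hp hh hζ] at e2
      have e3 : C₂ * ‖ζ‖ ^ (-(m : ℝ)) ≤ |C₂| * ‖ζ‖ ^ (-N) := by
        refine (mul_le_mul_of_nonneg_right (le_abs_self _) (by positivity)).trans ?_
        gcongr
      have : 0 ≤ 2 * C₁ * ‖ζ‖ ^ (-N) := by positivity
      linarith
  refine ⟨2 * C₁ + |C₂|, by positivity, fun ζ hζ h0 ↦ ?_⟩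
  -- the boundary values are limits from inside the half-plane
  have hlim : Tendsto (fun ε : ℝ ↦ ζ + ε) (𝓝[>] 0) (𝓝 ζ) := by
    have : Tendsto (fun ε : ℝ ↦ ζ + ε) (𝓝 0) (𝓝 (ζ + (0 : ℝ))) :=
      Continuous.tendsto (by fun_prop) 0
    simpa using this.mono_left nhdsWithin_le_nhds
  have hd := (differentiableOn_coneProfile hp hh).differentiableAt
    (isOpen_slitPlane.mem_nhds (mem_slitPlane_of_re_nonneg hζ h0))
  refine le_of_tendsto_of_tendsto ((hd.continuousAt.tendsto.comp hlim).norm)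
    ((hlim.norm.rpow_const (Or.inl (norm_ne_zero_iff.2 h0))).const_mul _) ?_
  filter_upwards [self_mem_nhdsWithin] with ε hε
  refine key _ ?_
  have : 0 < ε := hε
  simp only [add_re, ofReal_re]
  linarith

end

/-! ### Deformation of the slice integral -/

/-- The branch of `(1 + v²) ^ κ` that is holomorphic for `0 < Re v`. -/
noncomputable def archWeight (κ : ℝ) (v : ℂ) : ℂ := (v + I) ^ (κ : ℂ) * (v - I) ^ (κ : ℂ)

/-- The integral of `f` over the horizontal segment from `e i` to `1 + e i`. -/
noncomputable def legIntegral (e : ℝ) (f : ℂ → ℂ) : ℂ := ∫ w in (0 : ℝ)..1, f (w + e * I)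

/-- `-i` times the integral of `f` along the polygon `-i → 1 - i → 1 + i → i`. -/
noncomputable def archIntegral (f : ℂ → ℂ) : ℂ :=
  I * legIntegral 1 f - I * legIntegral (-1) f + ∫ τ in (-1 : ℝ)..1, f (1 + τ * I)

theorem intervalIntegrable_one_sub_sq_rpow {κ : ℝ} (hκ : -1 < κ) :
    IntervalIntegrable (fun τ : ℝ ↦ (1 - τ ^ 2) ^ κ) volume (-1) 1 := by
  have h1 : IntervalIntegrable (fun τ : ℝ ↦ (1 + τ) ^ κ) volume (-1) 1 := by
    have := (intervalIntegral.intervalIntegrable_rpow' (a := 0) (b := 2) hκ).comp_add_left 1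
    norm_num at this
    exact this
  have h2 : IntervalIntegrable (fun τ : ℝ ↦ (1 - τ) ^ κ) volume (-1) 1 := by
    have := (intervalIntegral.intervalIntegrable_rpow' (a := 2) (b := 0) hκ).comp_sub_left 1
    norm_num at this
    exact this
  refine ((h1.add h2).const_mul (2 ^ |κ|)).mono_fun'
    (by apply Measurable.aestronglyMeasurable; fun_prop) ?_
  rw [uIoc_of_le (by norm_num)]
  filter_upwards [ae_restrict_mem measurableSet_Ioc] with τ hτ
  have hx : 0 ≤ 1 + τ := by linarith [hτ.1]
  have hy : 0 ≤ 1 - τ := by linarith [hτ.2]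
  have hbig : ∀ x : ℝ, 1 ≤ x → x ≤ 2 → x ^ κ ≤ 2 ^ |κ| := fun x h1 h2 ↦
    (Real.rpow_le_rpow_of_exponent_le h1 (le_abs_self κ)).trans
      (Real.rpow_le_rpow (by linarith) h2 (abs_nonneg κ))
  rw [show 1 - τ ^ 2 = (1 + τ) * (1 - τ) by ring, Real.mul_rpow hx hy,
    Real.norm_of_nonneg (by positivity)]
  have hxk : 0 ≤ (1 + τ) ^ κ := by positivity
  have hyk : 0 ≤ (1 - τ) ^ κ := by positivity
  have h2k : (0 : ℝ) ≤ 2 ^ |κ| := by positivity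
  rcases le_total 0 τ with h0 | h0
  · have := mul_le_mul_of_nonneg_right (hbig (1 + τ) (by linarith) (by linarith [hτ.2])) hyk
    nlinarith
  · have := mul_le_mul_of_nonneg_left (hbig (1 - τ) (by linarith) (by linarith [hτ.1])) hxk
    nlinarith

theorem norm_archWeight (κ : ℝ) (v : ℂ) : ‖archWeight κ v‖ = ‖v + I‖ ^ κ * ‖v - I‖ ^ κ := by
  rw [archWeight, norm_mul, norm_cpow_real, norm_cpow_real]

theorem differentiableAt_archWeight (κ : ℝ) {v : ℂ} (hv : 0 < v.re) :
    DifferentiableAt ℂ (archWeight κ) v :=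
  ((differentiableAt_id.add_const I).cpow_const (Or.inl (by simpa using hv))).mul
    ((differentiableAt_id.sub_const I).cpow_const (Or.inl (by simpa using hv)))

/-- On the imaginary axis the weight is real, because the two factors have opposite arguments. -/
theorem archWeight_mul_I (κ : ℝ) {τ : ℝ} (h1 : -1 < τ) (h2 : τ < 1) :
    archWeight κ (τ * I) = ((1 - τ ^ 2) ^ κ : ℝ) := by
  have hx : 0 < 1 + τ := by linarith
  have hy : 0 < 1 - τ := by linarith
  have hxc : ((1 + τ : ℝ) : ℂ) ≠ 0 := by exact_mod_cast hx.ne'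
  have hyc : ((1 - τ : ℝ) : ℂ) ≠ 0 := by exact_mod_cast hy.ne'
  have e1 : (τ * I + I : ℂ) = ((1 + τ : ℝ) : ℂ) * I := by push_cast; ring
  have e2 : (τ * I - I : ℂ) = ((1 - τ : ℝ) : ℂ) * (-I) := by push_cast; ring
  rw [archWeight, e1, e2, cpow_def_of_ne_zero (mul_ne_zero hxc I_ne_zero),
    cpow_def_of_ne_zero (mul_ne_zero hyc (neg_ne_zero.2 I_ne_zero)), log_ofReal_mul hx I_ne_zero,
    log_ofReal_mul hy (neg_ne_zero.2 I_ne_zero), log_I, log_neg_I,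
    show 1 - τ ^ 2 = (1 + τ) * (1 - τ) by ring, Real.mul_rpow hx.le hy.le,
    Real.rpow_def_of_pos hx, Real.rpow_def_of_pos hy, ← Complex.exp_add]
  push_cast
  rw [← Complex.exp_add]
  congr 1
  ring

theorem archWeight_leg (κ : ℝ) {e : ℝ} (he : e = 1 ∨ e = -1) (w : ℝ) :
    archWeight κ (w + e * I) = (w : ℂ) ^ (κ : ℂ) * (w + 2 * e * I) ^ (κ : ℂ) := by
  rcases he with rfl | rfl
  · rw [archWeight, mul_comm]
    congr 2 <;> push_cast <;> ring
  · rw [archWeight]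
    congr 2 <;> push_cast <;> ring

theorem add_two_mul_I_mem_slitPlane {e : ℝ} (he : e = 1 ∨ e = -1) (w : ℝ) :
    (w + 2 * e * I : ℂ) ∈ slitPlane := by
  refine Or.inr ?_
  rcases he with rfl | rfl <;> simp

theorem intervalIntegrable_archWeight {κ : ℝ} (hκ : -1 < κ) {e : ℝ} (he : e = 1 ∨ e = -1) :
    IntervalIntegrable (fun w : ℝ ↦ archWeight κ (w + e * I)) volume 0 1 := by
  simp_rw [archWeight_leg κ he]
  refine (intervalIntegral.intervalIntegrable_cpow' (by simpa using hκ)).mul_continuousOn ?_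
  refine Continuous.continuousOn (continuous_iff_continuousAt.2 fun w ↦ ?_)
  exact ContinuousAt.cpow (f := fun w : ℝ ↦ (w + 2 * e * I : ℂ)) (by fun_prop) continuousAt_const
    (add_two_mul_I_mem_slitPlane he w)

theorem continuous_archWeight_right (κ : ℝ) :
    Continuous (fun τ : ℝ ↦ archWeight κ (1 + τ * I)) := by
  refine continuous_iff_continuousAt.2 fun τ ↦ ?_
  have h := (differentiableAt_archWeight κ (v := 1 + τ * I) (by simp)).continuousAt
  exact ContinuousAt.comp (f := fun τ : ℝ ↦ (1 + τ * I : ℂ)) h (by fun_prop)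

/-- Off the imaginary axis the weight is dominated, uniformly in the distance to the axis. -/
theorem norm_archWeight_le (κ : ℝ) {s τ : ℝ} (hs : 0 ≤ s) (hs1 : s ≤ 1) (h1 : -1 < τ)
    (h2 : τ < 1) : ‖archWeight κ (s + τ * I)‖ ≤ (1 - τ ^ 2) ^ κ + 9 ^ |κ| := by
  have hx : 0 < 1 + τ := by linarith
  have hy : 0 < 1 - τ := by linarith
  have e1 : (s + τ * I + I : ℂ) = s + ((1 + τ : ℝ) : ℂ) * I := by push_cast; ring
  have e2 : (s + τ * I - I : ℂ) = s + ((-(1 - τ) : ℝ) : ℂ) * I := by push_cast; ring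
  have b1 : ∀ x : ℝ, |x| ≤ ‖(s + (x : ℂ) * I : ℂ)‖ := fun x ↦ by
    simpa using abs_im_le_norm (s + (x : ℂ) * I : ℂ)
  have b2 : ∀ x : ℝ, |x| ≤ 2 → ‖(s + (x : ℂ) * I : ℂ)‖ ≤ 3 := fun x hx ↦ by
    refine (norm_add_le _ _).trans ?_
    rw [norm_mul, norm_I, mul_one, norm_real, norm_real, Real.norm_of_nonneg hs, Real.norm_eq_abs]
    linarith
  rw [norm_archWeight, e1, e2, show 1 - τ ^ 2 = (1 + τ) * (1 - τ) by ring,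
    Real.mul_rpow hx.le hy.le]
  have c1 := b1 (1 + τ)
  have c2 := b1 (-(1 - τ))
  have d1 := b2 (1 + τ) (by rw [abs_of_pos hx]; linarith)
  have d2 := b2 (-(1 - τ)) (by rw [abs_neg, abs_of_pos hy]; linarith)
  rw [abs_of_pos hx] at c1
  rw [abs_neg, abs_of_pos hy] at c2
  rcases le_total κ 0 with hκ | hκ
  · have := mul_le_mul (Real.rpow_le_rpow_of_nonpos hx c1 hκ)
      (Real.rpow_le_rpow_of_nonpos hy c2 hκ) (by positivity) (by positivity)
    have : (0 : ℝ) ≤ 9 ^ |κ| := by positivity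
    linarith
  · have := mul_le_mul (Real.rpow_le_rpow (norm_nonneg _) d1 hκ)
      (Real.rpow_le_rpow (norm_nonneg _) d2 hκ) (by positivity) (by positivity)
    rw [← Real.mul_rpow (x := 3) (by norm_num) (by norm_num), show (3 : ℝ) * 3 = 9 by norm_num]
      at this
    rw [abs_of_nonneg hκ]
    have : 0 ≤ (1 + τ) ^ κ * (1 - τ) ^ κ := by positivity
    linarith

/-- Cauchy's theorem moves the segment from `-i` to `i` to the polygon through `1 - i` and `1 + i`.
The rectangle is first kept away from the imaginary axis, where the weight may be singular. -/
theorem integral_eq_archIntegral {κ : ℝ} (hκ : -1 < κ) {G : ℂ → ℂ}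
    (hG : ∀ v : ℂ, 0 ≤ v.re → DifferentiableAt ℂ G v) :
    ∫ τ in (-1 : ℝ)..1, (((1 - τ ^ 2) ^ κ : ℝ) : ℂ) * G (τ * I) =
      archIntegral (fun v ↦ archWeight κ v * G v) := by
  set f : ℂ → ℂ := fun v ↦ archWeight κ v * G v with hf
  have hGc : ∀ v : ℂ, 0 ≤ v.re → ContinuousAt G v := fun v hv ↦ (hG v hv).continuousAt
  have hleg : ∀ e : ℝ, e = 1 ∨ e = -1 →
      IntervalIntegrable (fun w : ℝ ↦ f (w + e * I)) volume 0 1 := by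
    intro e he
    refine (intervalIntegrable_archWeight hκ he).mul_continuousOn ?_
    intro w hw
    rw [uIcc_of_le zero_le_one] at hw
    refine ContinuousAt.continuousWithinAt ?_
    exact ContinuousAt.comp (f := fun w : ℝ ↦ (w + e * I : ℂ)) (hGc _ (by simpa using hw.1))
      (by fun_prop)
  -- Cauchy's theorem on the rectangle with corners `s - i` and `1 + i`
  have hcauchy : ∀ s ∈ Ioo (0 : ℝ) 1, ∫ τ in (-1 : ℝ)..1, f (s + τ * I) =
      I * (∫ w in s..1, f (w + (1 : ℝ) * I)) - I * (∫ w in s..1, f (w + (-1 : ℝ) * I)) +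
        ∫ τ in (-1 : ℝ)..1, f (1 + τ * I) := by
    intro s hs
    have := integral_boundary_rect_eq_zero_of_differentiableOn f (s - I) (1 + I) ?_
    · simp only [sub_re, ofReal_re, I_re, sub_zero, add_re, one_re, add_zero, sub_im, ofReal_im,
        I_im, zero_sub, add_im, one_im, zero_add, smul_eq_mul, ofReal_one] at this
      simp only [ofReal_one]
      linear_combination I * this - ((∫ τ in (-1 : ℝ)..1, f (1 + τ * I)) -
        ∫ τ in (-1 : ℝ)..1, f (s + τ * I)) * I_sq
    · intro v hv
      have h1 : s ≤ v.re := by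
        have := hv.1
        simp only [sub_re, ofReal_re, I_re, sub_zero, add_re, one_re, add_zero] at this
        rw [mem_preimage, uIcc_of_le hs.2.le] at this
        exact this.1
      exact ((differentiableAt_archWeight κ (hs.1.trans_le h1)).mul
        (hG v (hs.1.le.trans h1))).differentiableWithinAt
  -- the left edge tends to the segment on the imaginary axis as `s → 0`, by domination
  have hl : Tendsto (fun s : ℝ ↦ ∫ τ in (-1 : ℝ)..1, f (s + τ * I)) (𝓝[>] 0)
      (𝓝 (∫ τ in (-1 : ℝ)..1, (((1 - τ ^ 2) ^ κ : ℝ) : ℂ) * G (τ * I))) := by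
    obtain ⟨M, hM⟩ := ((isCompact_Icc (a := (0 : ℝ)) (b := 1)).prod
      (isCompact_Icc (a := (-1 : ℝ)) (b := 1))).exists_bound_of_continuousOn
      (f := fun q : ℝ × ℝ ↦ G (q.1 + q.2 * I)) (fun q hq ↦ by
        refine ContinuousAt.continuousWithinAt ?_
        exact ContinuousAt.comp (f := fun q : ℝ × ℝ ↦ (q.1 + q.2 * I : ℂ))
          (hGc _ (by simpa using hq.1.1)) (by fun_prop))
    have hpos : ∀ᶠ s in 𝓝[>] (0 : ℝ), 0 < s ∧ s < 1 := by
      filter_upwards [self_mem_nhdsWithin, nhdsWithin_le_nhds (Iio_mem_nhds one_pos)] with s h1 h2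
      exact ⟨h1, h2⟩
    have hne : ∀ᵐ τ : ℝ, τ ≠ 1 := by simp [ae_iff]
    refine intervalIntegral.tendsto_integral_filter_of_dominated_convergence
      (fun τ ↦ ((1 - τ ^ 2) ^ κ + 9 ^ |κ|) * M) ?_ ?_ ?_ ?_
    · filter_upwards [hpos] with s hs
      refine Continuous.aestronglyMeasurable (continuous_iff_continuousAt.2 fun τ ↦ ?_)
      exact ContinuousAt.comp (f := fun τ : ℝ ↦ (s + τ * I : ℂ))
        (((differentiableAt_archWeight κ (v := s + τ * I) (by simpa using hs.1)).continuousAt).mul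
          (hGc _ (by simpa using hs.1.le))) (by fun_prop)
    · filter_upwards [hpos] with s hs
      filter_upwards [hne] with τ hτ1 hτ
      rw [uIoc_of_le (by norm_num)] at hτ
      have h3 := norm_archWeight_le κ hs.1.le hs.2.le hτ.1 (lt_of_le_of_ne hτ.2 hτ1)
      have h4 := hM (s, τ) ⟨⟨hs.1.le, hs.2.le⟩, ⟨hτ.1.le, hτ.2⟩⟩
      rw [hf, norm_mul]
      exact mul_le_mul h3 h4 (norm_nonneg _) ((norm_nonneg _).trans h3)
    · exact ((intervalIntegrable_one_sub_sq_rpow hκ).add intervalIntegrable_const).mul_const M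
    · filter_upwards [hne] with τ hτ1 hτ
      rw [uIoc_of_le (by norm_num)] at hτ
      have hτ2 := lt_of_le_of_ne hτ.2 hτ1
      rw [← archWeight_mul_I κ hτ.1 hτ2]
      have hc : ContinuousAt f (τ * I) := by
        refine ContinuousAt.mul (ContinuousAt.mul ?_ ?_) (hGc _ (by simp))
        · refine ContinuousAt.cpow (by fun_prop) continuousAt_const (Or.inr ?_)
          simp only [add_im, mul_im, ofReal_re, I_im, mul_one, ofReal_im, I_re, mul_zero, add_zero]
          linarith [hτ.1]
        · refine ContinuousAt.cpow (by fun_prop) continuousAt_const (Or.inr ?_)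
          simp only [sub_im, mul_im, ofReal_re, I_im, mul_one, ofReal_im, I_re, mul_zero, add_zero]
          linarith
      have h0 : Tendsto (fun s : ℝ ↦ (s + τ * I : ℂ)) (𝓝[>] 0) (𝓝 (τ * I)) := by
        have : Tendsto (fun s : ℝ ↦ (s + τ * I : ℂ)) (𝓝 0) (𝓝 ((0 : ℝ) + τ * I)) :=
          Continuous.tendsto (by fun_prop) 0
        simpa using this.mono_left nhdsWithin_le_nhds
      exact hc.tendsto.comp h0
  have hr : Tendsto (fun s : ℝ ↦ I * (∫ w in s..1, f (w + (1 : ℝ) * I)) -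
      I * (∫ w in s..1, f (w + (-1 : ℝ) * I)) + ∫ τ in (-1 : ℝ)..1, f (1 + τ * I)) (𝓝[>] 0)
      (𝓝 (archIntegral f)) := by
    have hend : ∀ e : ℝ, e = 1 ∨ e = -1 → Tendsto (fun s : ℝ ↦ ∫ w in s..1, f (w + e * I))
        (𝓝[>] 0) (𝓝 (∫ w in (0 : ℝ)..1, f (w + e * I))) := by
      intro e he
      have hc := intervalIntegral.continuousOn_primitive_interval_left
        (μ := volume) (f := fun w : ℝ ↦ f (w + e * I)) (a := 0) (b := 1)
        ((intervalIntegrable_iff_integrableOn_Icc_of_le zero_le_one).1 (hleg e he) |> fun h ↦ by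
          rwa [uIcc_of_le zero_le_one])
      have h0 := hc 0 (by simp)
      rw [uIcc_of_le zero_le_one] at h0
      refine (h0.tendsto).mono_left ?_
      rw [nhdsWithin_le_iff]
      filter_upwards [self_mem_nhdsWithin, nhdsWithin_le_nhds (Iio_mem_nhds one_pos)] with s h1 h2
      exact ⟨le_of_lt h1, le_of_lt h2⟩
    exact ((((hend 1 (Or.inl rfl)).const_mul I)).sub ((hend (-1) (Or.inr rfl)).const_mul I)).add
      tendsto_const_nhds
  refine tendsto_nhds_unique hl (hr.congr' ?_)
  filter_upwards [self_mem_nhdsWithin, nhdsWithin_le_nhds (Iio_mem_nhds one_pos)] with s h1 h2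
  exact (hcauchy s ⟨h1, h2⟩).symm

/-! ### The half-wave kernel and its bounds -/

theorem rpow_le_three_rpow_abs {x : ℝ} (κ : ℝ) (h1 : 1 ≤ x) (h3 : x ≤ 3) : x ^ κ ≤ 3 ^ |κ| :=
  (Real.rpow_le_rpow_of_exponent_le h1 (le_abs_self κ)).trans
    (Real.rpow_le_rpow (by linarith) h3 (abs_nonneg κ))

theorem norm_archWeight_leg_le (κ : ℝ) {e : ℝ} (he : e = 1 ∨ e = -1) {w : ℝ}
    (hw : w ∈ Ioc (0 : ℝ) 1) : ‖archWeight κ (w + e * I)‖ ≤ 3 ^ |κ| * w ^ κ := by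
  have habs : |e| = 1 := by rcases he with rfl | rfl <;> simp
  have h1 : 1 ≤ ‖(w + 2 * e * I : ℂ)‖ := by
    refine le_trans ?_ (abs_im_le_norm _)
    have : (w + 2 * e * I : ℂ).im = 2 * e := by simp
    rw [this, abs_mul, habs]; norm_num
  have h2 : ‖(w + 2 * e * I : ℂ)‖ ≤ 3 := by
    refine (norm_add_le _ _).trans ?_
    simp only [norm_mul, norm_real, norm_I, mul_one, Real.norm_eq_abs, habs, abs_of_pos hw.1,
      Complex.norm_ofNat]
    linarith [hw.2]
  rw [archWeight_leg κ he, norm_mul, norm_cpow_real, norm_cpow_real, norm_real,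
    Real.norm_of_nonneg hw.1.le, mul_comm]
  exact mul_le_mul_of_nonneg_right (rpow_le_three_rpow_abs κ h1 h2) (Real.rpow_nonneg hw.1.le _)

theorem norm_archWeight_top_le (κ : ℝ) {τ : ℝ} (hτ : τ ∈ Icc (-1 : ℝ) 1) :
    ‖archWeight κ (1 + τ * I)‖ ≤ 3 ^ |κ| * 3 ^ |κ| := by
  have b1 : ∀ x : ℝ, 1 ≤ ‖(1 + (x : ℂ) * I : ℂ)‖ := fun x ↦ by
    simpa using abs_re_le_norm (1 + (x : ℂ) * I : ℂ)
  have b2 : ∀ x : ℝ, |x| ≤ 2 → ‖(1 + (x : ℂ) * I : ℂ)‖ ≤ 3 := fun x hx ↦ by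
    refine (norm_add_le _ _).trans ?_
    rw [norm_mul, norm_I, mul_one, norm_real, norm_one, Real.norm_eq_abs]
    linarith
  have e1 : (1 + τ * I + I : ℂ) = 1 + ((τ + 1 : ℝ) : ℂ) * I := by push_cast; ring
  have e2 : (1 + τ * I - I : ℂ) = 1 + ((τ - 1 : ℝ) : ℂ) * I := by push_cast; ring
  rw [norm_archWeight, e1, e2]
  refine mul_le_mul (rpow_le_three_rpow_abs κ (b1 _) (b2 _ ?_))
    (rpow_le_three_rpow_abs κ (b1 _) (b2 _ ?_)) (by positivity) (by positivity)
  · rw [abs_le]; constructor <;> linarith [hτ.1, hτ.2]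
  · rw [abs_le]; constructor <;> linarith [hτ.1, hτ.2]

/-- Bounding the weighted integral over the polygon; the integrand may be as singular as
`w ^ (-q)` at the end points `±i`. -/
theorem exists_norm_archIntegral_le {κ q : ℝ} (hq : q < κ + 1) :
    ∃ K : ℝ, 0 ≤ K ∧ ∀ (g : ℂ → ℂ) (B : ℝ),
      (∀ e : ℝ, e = 1 ∨ e = -1 → ∀ w ∈ Ioc (0 : ℝ) 1, ‖g (w + e * I)‖ ≤ B * w ^ (-q)) →
      (∀ τ ∈ Icc (-1 : ℝ) 1, ‖g (1 + τ * I)‖ ≤ B) →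
      ‖archIntegral (fun v ↦ archWeight κ v * g v)‖ ≤ K * B := by
  have h3 : (0 : ℝ) ≤ 3 ^ |κ| := by positivity
  have hint : IntervalIntegrable (fun w : ℝ ↦ w ^ (κ - q)) volume 0 1 :=
    intervalIntegral.intervalIntegrable_rpow' (by linarith)
  have hI : 0 ≤ ∫ w in (0 : ℝ)..1, w ^ (κ - q) :=
    intervalIntegral.integral_nonneg zero_le_one fun w hw ↦ Real.rpow_nonneg hw.1 _
  refine ⟨3 ^ |κ| * (∫ w in (0 : ℝ)..1, w ^ (κ - q)) + 3 ^ |κ| * (∫ w in (0 : ℝ)..1, w ^ (κ - q)) +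
    3 ^ |κ| * 3 ^ |κ| * 2, by positivity, fun g B hleg htop ↦ ?_⟩
  have hB : 0 ≤ B := (norm_nonneg _).trans (htop 0 (by simp))
  have l : ∀ e : ℝ, e = 1 ∨ e = -1 → ‖legIntegral e (fun v ↦ archWeight κ v * g v)‖ ≤
      3 ^ |κ| * (∫ w in (0 : ℝ)..1, w ^ (κ - q)) * B := by
    intro e he
    have := intervalIntegral.norm_integral_le_of_norm_le (μ := volume) zero_le_one
      (f := fun w : ℝ ↦ archWeight κ (w + e * I) * g (w + e * I))
      (g := fun w ↦ (3 ^ |κ| * B) * w ^ (κ - q)) (Eventually.of_forall fun w hw ↦ ?_)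
      (hint.const_mul _)
    · rw [intervalIntegral.integral_const_mul] at this
      refine this.trans (le_of_eq (by ring))
    · rw [norm_mul]
      refine (mul_le_mul (norm_archWeight_leg_le κ he hw) (hleg e he w hw) (norm_nonneg _)
        (mul_nonneg h3 (Real.rpow_nonneg hw.1.le _))).trans (le_of_eq ?_)
      rw [sub_eq_add_neg, Real.rpow_add hw.1]
      ring
  have ht : ‖∫ τ in (-1 : ℝ)..1, archWeight κ (1 + τ * I) * g (1 + τ * I)‖ ≤
      3 ^ |κ| * 3 ^ |κ| * B * 2 := by
    have := intervalIntegral.norm_integral_le_of_norm_le_const (a := -1) (b := 1)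
      (f := fun τ : ℝ ↦ archWeight κ (1 + τ * I) * g (1 + τ * I)) (C := 3 ^ |κ| * 3 ^ |κ| * B)
      (fun τ hτ ↦ ?_)
    · refine this.trans (le_of_eq ?_); norm_num
    · rw [uIoc_of_le (by norm_num)] at hτ
      rw [norm_mul]
      exact mul_le_mul (norm_archWeight_top_le κ ⟨hτ.1.le, hτ.2⟩) (htop τ ⟨hτ.1.le, hτ.2⟩)
        (norm_nonneg _) (by positivity)
  rw [archIntegral]
  refine (norm_add_le _ _).trans ((add_le_add (norm_sub_le _ _) ht).trans ?_)
  rw [norm_mul, norm_mul, norm_I, one_mul, one_mul]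
  have l1 := l 1 (Or.inl rfl)
  have l2 := l (-1) (Or.inr rfl)
  linarith

/-- The half-wave kernel in dimension `2κ + 3` at distance `ρ` from the origin and complex time
`i y`, up to a constant factor. -/
noncomputable def waveKernel (κ p : ℝ) (h : ℝ → ℝ) (y : ℂ) (ρ : ℝ) : ℂ :=
  archIntegral (fun v ↦ archWeight κ v * coneProfile p h (y + ρ * v))

section

variable {κ p : ℝ} {h : ℝ → ℝ}

theorem re_add_mul_nonneg {y v : ℂ} {ρ : ℝ} (hy : 0 ≤ y.re) (hρ : 0 ≤ ρ) (hv : 0 ≤ v.re) :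
    0 ≤ (y + ρ * v).re := by
  simp only [add_re, re_ofReal_mul]
  positivity

theorem mul_le_norm_add_mul {y : ℂ} {ρ : ℝ} (hy : 0 ≤ y.re) (v : ℂ) :
    ρ * v.re ≤ ‖y + ρ * v‖ := by
  refine le_trans ?_ (re_le_norm _)
  simp only [add_re, re_ofReal_mul]
  linarith

theorem abs_le_norm_add_mul (y : ℂ) (ρ : ℝ) (v : ℂ) : |y.im + ρ * v.im| ≤ ‖y + ρ * v‖ := by
  refine le_trans (le_of_eq ?_) (abs_im_le_norm _)
  simp

theorem leg_re (w e : ℝ) : (w + e * I : ℂ).re = w := by simp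
theorem leg_im (w e : ℝ) : (w + e * I : ℂ).im = e := by simp
theorem top_re (τ : ℝ) : (1 + τ * I : ℂ).re = 1 := by simp
theorem top_im (τ : ℝ) : (1 + τ * I : ℂ).im = τ := by simp

theorem abs_sub_le_abs_add_mul_sign {t ρ e : ℝ} (hρ : 0 ≤ ρ) (he : e = 1 ∨ e = -1) :
    ρ - |t| ≤ |t + ρ * e| := by
  have h1 : |ρ * e| = ρ := by rcases he with rfl | rfl <;> simp [abs_of_nonneg hρ]
  have := abs_sub_abs_le_abs_sub (ρ * e) (-t)
  rw [abs_neg, h1, sub_neg_eq_add, add_comm (ρ * e)] at this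
  exact this

/-- Rapid decay of the kernel away from the light cone. -/
theorem exists_decay_waveKernel (hκ : -1 < κ) (hp : 0 < p) (hh : IsCutoffProfile h) {A N : ℝ}
    (hA : 1 < A) (hN : p < N) : ∃ C : ℝ, ∀ (y : ℂ) (ρ : ℝ), 0 ≤ y.re → 0 < ρ → A * |y.im| ≤ ρ →
      ‖waveKernel κ p h y ρ‖ ≤ C * ρ ^ (-N) := by
  obtain ⟨K, hK0, hK⟩ := exists_norm_archIntegral_le (κ := κ) (q := 0) (by linarith)
  obtain ⟨C, hC0, hC⟩ := exists_decay_coneProfile hp hh hN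
  set a : ℝ := 1 - A⁻¹ with ha
  have ha0 : 0 < a := sub_pos.2 (inv_lt_one_of_one_lt₀ hA)
  refine ⟨K * (C * a ^ (-N)), fun y ρ hy hρ hAρ ↦ ?_⟩
  have hyρ : |y.im| ≤ A⁻¹ * ρ := by
    rw [inv_mul_eq_div, le_div_iff₀ (by linarith)]; linarith
  have key : ∀ v : ℂ, 0 ≤ v.re → a * ρ ≤ ‖y + ρ * v‖ →
      ‖coneProfile p h (y + ρ * v)‖ ≤ C * a ^ (-N) * ρ ^ (-N) := by
    intro v hv hle
    have hpos : 0 < a * ρ := by positivity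
    refine (hC _ (re_add_mul_nonneg hy hρ.le hv) (norm_pos_iff.1 (hpos.trans_le hle))).trans ?_
    rw [mul_assoc, ← Real.mul_rpow ha0.le hρ.le]
    exact mul_le_mul_of_nonneg_left
      (Real.rpow_le_rpow_of_nonpos hpos hle (by linarith)) hC0
  refine (hK _ (C * a ^ (-N) * ρ ^ (-N)) ?_ ?_).trans (le_of_eq (by ring))
  · intro e he w hw
    rw [neg_zero, Real.rpow_zero, mul_one]
    refine key _ (by rw [leg_re]; exact hw.1.le) (le_trans ?_ (abs_le_norm_add_mul _ _ _))
    rw [leg_im]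
    refine le_trans ?_ (abs_sub_le_abs_add_mul_sign hρ.le he)
    rw [ha]; linarith
  · intro τ _
    refine key _ (by rw [top_re]; norm_num) (le_trans ?_ (mul_le_norm_add_mul hy _))
    rw [top_re, mul_one]
    have : 0 < A⁻¹ := by positivity
    nlinarith

/-- If `p < κ + 1` the profile is integrable against the weight up to the cone. -/
theorem exists_bound_waveKernel_of_lt (hp : 0 < p) (hpκ : p < κ + 1) (hh : IsCutoffProfile h) :
    ∃ C : ℝ, 0 ≤ C ∧ ∀ (y : ℂ) (ρ : ℝ), 0 ≤ y.re → 0 < ρ →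
      ‖waveKernel κ p h y ρ‖ ≤ C * (ρ ^ (-p) + 1) := by
  obtain ⟨K, hK0, hK⟩ := exists_norm_archIntegral_le (κ := κ) (q := p) hpκ
  obtain ⟨C, hC0, hC⟩ := exists_bound_coneProfile hp hh
  refine ⟨K * C, by positivity, fun y ρ hy hρ ↦ ?_⟩
  have key : ∀ v : ℂ, 0 < v.re → v.re ≤ 1 →
      ‖coneProfile p h (y + ρ * v)‖ ≤ C * (ρ ^ (-p) + 1) * v.re ^ (-p) := by
    intro v hv hv1
    refine (hC _ (re_add_mul_nonneg hy hρ.le hv.le)).trans ?_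
    rw [mul_assoc]
    refine mul_le_mul_of_nonneg_left ?_ hC0
    have h1 := Real.rpow_le_rpow_of_nonpos (z := -p) (by positivity) (mul_le_norm_add_mul (ρ := ρ) hy v)
      (by linarith)
    rw [Real.mul_rpow hρ.le hv.le] at h1
    have h2 := Real.one_le_rpow_of_pos_of_le_one_of_nonpos (z := -p) hv hv1 (by linarith)
    nlinarith
  rw [mul_assoc]
  refine hK _ _ ?_ ?_
  · intro e he w hw
    have := key (w + e * I) (by rw [leg_re]; exact hw.1) (by rw [leg_re]; exact hw.2)
    rwa [leg_re] at this
  · intro τ _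
    have := key (1 + τ * I) (by rw [top_re]; exact one_pos) (by rw [top_re])
    rwa [top_re, Real.one_rpow, mul_one] at this

/-- A bound that is integrable across the cone and uniform up to the boundary `Re y = 0`. -/
theorem exists_integrable_bound_waveKernel (hp : 0 < p) {b : ℝ} (hb : 0 ≤ b) (hbp : b ≤ p)
    (hpb : p - b < κ + 1) (hh : IsCutoffProfile h) {t : ℝ} (ht : t ≠ 0) :
    ∃ C : ℝ, ∀ (y : ℂ) (ρ : ℝ), 0 ≤ y.re → y.im = t → 0 < ρ → t + ρ ≠ 0 → t - ρ ≠ 0 →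
      ‖waveKernel κ p h y ρ‖ ≤ C * (1 + |t + ρ| ^ (-b) + |t - ρ| ^ (-b)) := by
  obtain ⟨K, hK0, hK⟩ := exists_norm_archIntegral_le (κ := κ) (q := p - b) hpb
  obtain ⟨C, hC0, hC⟩ := exists_bound_coneProfile hp hh
  set a : ℝ := |t| / 2 with ha
  have ha0 : 0 < a := by positivity
  set M : ℝ := a ^ (-p) + 1 + a ^ (-(p - b)) with hM
  have hM0 : 0 ≤ M := by positivity
  refine ⟨K * (C * M), fun y ρ hy hyt hρ hp1 hp2 ↦ ?_⟩
  set S : ℝ := 1 + |t + ρ| ^ (-b) + |t - ρ| ^ (-b) with hS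
  have hx1 : 0 ≤ |t + ρ| ^ (-b) := by positivity
  have hx2 : 0 ≤ |t - ρ| ^ (-b) := by positivity
  have key : ∀ v : ℂ, 0 ≤ v.re → ∀ x : ℝ, ‖y + ρ * v‖ ^ (-p) + 1 ≤ M * S * x →
      ‖coneProfile p h (y + ρ * v)‖ ≤ C * M * S * x := by
    intro v hv x hle
    refine (hC _ (re_add_mul_nonneg hy hρ.le hv)).trans ?_
    rw [mul_assoc, mul_assoc]
    refine mul_le_mul_of_nonneg_left (by rwa [← mul_assoc]) hC0
  -- away from the cone the profile is simply bounded
  have far : ∀ v : ℂ, a ≤ ‖y + ρ * v‖ → ∀ x : ℝ, 1 ≤ x → ‖y + ρ * v‖ ^ (-p) + 1 ≤ M * S * x := by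
    intro v hv x hx
    have h1 := Real.rpow_le_rpow_of_nonpos (z := -p) ha0 hv (by linarith)
    have h2 : 0 ≤ a ^ (-(p - b)) := by positivity
    have h3 : M * 1 * 1 ≤ M * S * x := by
      have : 1 ≤ S := by rw [hS]; linarith
      gcongr
    linarith
  rw [show K * (C * M) * S = K * (C * M * S) by ring]
  refine hK _ _ ?_ ?_
  · intro e he w hw
    have hw0 : 0 < w := hw.1
    have hwx : 1 ≤ w ^ (-(p - b)) :=
      Real.one_le_rpow_of_pos_of_le_one_of_nonpos hw.1 hw.2 (by linarith)
    refine key _ (by rw [leg_re]; exact hw.1.le) _ ?_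
    have him := abs_le_norm_add_mul y ρ (w + e * I)
    rw [leg_im, hyt] at him
    rcases lt_or_ge ρ a with hρa | hρa
    · refine far _ (le_trans ?_ him) _ hwx
      have h1 : |ρ * e| = ρ := by rcases he with rfl | rfl <;> simp [abs_of_pos hρ]
      have := abs_sub_abs_le_abs_sub t (-(ρ * e))
      rw [abs_neg, h1, sub_neg_eq_add] at this
      rw [ha] at hρa ⊢
      linarith
    -- near the cone `‖ζ‖ ^ (-p) = ‖ζ‖ ^ (-b) ‖ζ‖ ^ (-(p - b))` is bounded by the distance to the cone
    -- in the first factor and by `Re ζ ≥ ρ w` in the second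
    · have hte : 0 < |t + ρ * e| := by
        rcases he with rfl | rfl
        · simpa using hp1
        · simpa [sub_eq_add_neg] using hp2
      have hteS : |t + ρ * e| ^ (-b) ≤ S := by
        rcases he with rfl | rfl
        · rw [mul_one]; linarith
        · rw [mul_neg_one, ← sub_eq_add_neg]; linarith
      have hre := mul_le_norm_add_mul (ρ := ρ) hy (w + e * I)
      rw [leg_re] at hre
      have hz : 0 < ‖y + ρ * (w + e * I)‖ := hte.trans_le him
      have h1 : ‖y + ρ * (w + e * I)‖ ^ (-b) ≤ S :=
        (Real.rpow_le_rpow_of_nonpos hte him (by linarith)).trans hteS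
      have h2 : ‖y + ρ * (w + e * I)‖ ^ (-(p - b)) ≤ a ^ (-(p - b)) * w ^ (-(p - b)) := by
        rw [← Real.mul_rpow ha0.le hw0.le]
        refine Real.rpow_le_rpow_of_nonpos (by positivity) (le_trans ?_ hre) (by linarith)
        gcongr
      have h3 : ‖y + ρ * (w + e * I)‖ ^ (-p) ≤ S * (a ^ (-(p - b)) * w ^ (-(p - b))) := by
        rw [show -p = -b + -(p - b) by ring, Real.rpow_add hz]
        exact mul_le_mul h1 h2 (by positivity) (by linarith)
      have h4 : 1 ≤ S * w ^ (-(p - b)) := by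
        have : 1 ≤ S := by linarith
        nlinarith
      have h5 : 0 ≤ a ^ (-p) * (S * w ^ (-(p - b))) := by positivity
      rw [hM]
      nlinarith
  · intro τ hτ
    have := key (1 + τ * I) (by rw [top_re]; norm_num) 1 (far _ ?_ 1 le_rfl)
    · rwa [mul_one] at this
    · rcases lt_or_ge ρ a with hρa | hρa
      · have him := abs_le_norm_add_mul y ρ (1 + τ * I)
        rw [top_im, hyt] at him
        refine le_trans ?_ him
        have h1 : |ρ * τ| ≤ ρ := by
          rw [abs_mul, abs_of_pos hρ]
          exact mul_le_of_le_one_right hρ.le (abs_le.2 hτ)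
        have := abs_sub_abs_le_abs_sub t (-(ρ * τ))
        rw [abs_neg, sub_neg_eq_add] at this
        rw [ha] at hρa ⊢
        linarith
      · have := mul_le_norm_add_mul (ρ := ρ) hy (1 + τ * I)
        rw [top_re, mul_one] at this
        exact hρa.trans this

end

/-! ### Dependence on the parameters -/

/-- Holomorphic dependence of a weighted integral of `H (y + z γ(w))` on the parameter `z`. -/
theorem differentiableAt_integral_comp_affine {A γ : ℝ → ℂ} {a b : ℝ} (hab : a ≤ b)
    (hA : IntervalIntegrable A volume a b) (hγ : Continuous γ) {H : ℂ → ℂ} {Ω : Set ℂ}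
    (hΩ : IsOpen Ω) (hH : DifferentiableOn ℂ H Ω) {y z₀ : ℂ}
    (hin : ∀ w ∈ Icc a b, y + z₀ * γ w ∈ Ω) :
    ∀ᶠ z in 𝓝 z₀, DifferentiableAt ℂ (fun z ↦ ∫ w in a..b, A w * H (y + z * γ w)) z := by
  have hopen : ∀ z₁ : ℂ, (∀ w ∈ Icc a b, y + z₁ * γ w ∈ Ω) →
      ∀ᶠ z in 𝓝 z₁, ∀ w ∈ Icc a b, y + z * γ w ∈ Ω := by
    intro z₁ h₁
    refine isCompact_Icc.eventually_forall_of_forall_eventually fun w hw ↦ ?_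
    have hc : Continuous fun q : ℂ × ℝ ↦ y + q.1 * γ q.2 := by fun_prop
    exact hc.continuousAt.eventually_mem (hΩ.mem_nhds (h₁ w hw))
  filter_upwards [hopen z₀ hin] with z₁ h₁
  obtain ⟨δ, hδ, hball⟩ := Metric.nhds_basis_closedBall.mem_iff.1 (hopen z₁ h₁)
  have hd : ContinuousOn (deriv H) Ω := (hH.deriv hΩ).continuousOn
  have hcomp : ∀ z ∈ closedBall z₁ δ, ∀ F : ℂ → ℂ, ContinuousOn F Ω →
      ContinuousOn (fun w ↦ F (y + z * γ w)) (Icc a b) := fun z hz F hF ↦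
    hF.comp (by fun_prop) (fun w hw ↦ hball hz w hw)
  have hmeas : ∀ z ∈ closedBall z₁ δ, ∀ F : ℂ → ℂ, ContinuousOn F Ω →
      AEStronglyMeasurable (fun w ↦ F (y + z * γ w)) (volume.restrict (Set.uIoc a b)) := by
    intro z hz F hF
    rw [uIoc_of_le hab]
    exact ((hcomp z hz F hF).aestronglyMeasurable measurableSet_Icc).mono_measure
      (Measure.restrict_mono Ioc_subset_Icc_self le_rfl)
  obtain ⟨M, hM⟩ := ((isCompact_closedBall z₁ δ).prod
    (isCompact_Icc (a := a) (b := b))).exists_bound_of_continuousOn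
    (f := fun q : ℂ × ℝ ↦ deriv H (y + q.1 * γ q.2) * γ q.2)
    ((hd.comp (by fun_prop) (fun q hq ↦ hball hq.1 q.2 hq.2)).mul (by fun_prop))
  have hA' : AEStronglyMeasurable A (volume.restrict (Set.uIoc a b)) :=
    hA.aestronglyMeasurable_restrict_uIoc
  have hz₁ : z₁ ∈ closedBall z₁ δ := mem_closedBall_self hδ.le
  refine (intervalIntegral.hasDerivAt_integral_of_dominated_loc_of_deriv_le (𝕜 := ℂ)
    (F' := fun z w ↦ A w * (deriv H (y + z * γ w) * γ w)) (bound := fun w ↦ ‖A w‖ * M)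
    (s := closedBall z₁ δ) (closedBall_mem_nhds z₁ hδ) ?_ ?_ ?_ ?_ ?_ ?_).2.differentiableAt
  · filter_upwards [closedBall_mem_nhds z₁ hδ] with z hz
    exact hA'.mul (hmeas z hz H hH.continuousOn)
  · refine hA.mul_continuousOn ?_
    rw [uIcc_of_le hab]
    exact hcomp z₁ hz₁ H hH.continuousOn
  · exact hA'.mul ((hmeas z₁ hz₁ _ hd).mul hγ.aestronglyMeasurable)
  · refine Eventually.of_forall fun w hw z hz ↦ ?_
    rw [uIoc_of_le hab] at hw
    rw [norm_mul]
    exact mul_le_mul_of_nonneg_left (hM (z, w) ⟨hz, Ioc_subset_Icc_self hw⟩) (norm_nonneg _)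
  · exact hA.norm.mul_const M
  · refine Eventually.of_forall fun w hw z hz ↦ ?_
    rw [uIoc_of_le hab] at hw
    have h1 : HasDerivAt (fun z : ℂ ↦ y + z * γ w) (γ w) z := by
      simpa using ((hasDerivAt_id z).mul_const (γ w)).const_add y
    have h2 := (hH.differentiableAt
      (hΩ.mem_nhds (hball hz w (Ioc_subset_Icc_self hw)))).hasDerivAt
    exact (h2.comp z h1).const_mul _

/-- A dominated limit in the parameter `y` of a weighted integral of `H (y + z γ(w))`. -/
theorem tendsto_integral_comp_affine {A γ : ℝ → ℂ} {a b : ℝ} (hab : a ≤ b)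
    (hA : IntervalIntegrable A volume a b) (hγ : Continuous γ) {H : ℂ → ℂ} {Ω : Set ℂ}
    (hΩ : IsOpen Ω) (hH : ContinuousOn H Ω) {y₀ z : ℂ}
    (hin : ∀ w ∈ Icc a b, y₀ + z * γ w ∈ Ω) :
    ContinuousAt (fun y ↦ ∫ w in a..b, A w * H (y + z * γ w)) y₀ := by
  have hopen : ∀ᶠ y in 𝓝 y₀, ∀ w ∈ Icc a b, y + z * γ w ∈ Ω := by
    refine isCompact_Icc.eventually_forall_of_forall_eventually fun w hw ↦ ?_
    have hc : Continuous fun q : ℂ × ℝ ↦ q.1 + z * γ q.2 := by fun_prop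
    exact hc.continuousAt.eventually_mem (hΩ.mem_nhds (hin w hw))
  obtain ⟨δ, hδ, hball⟩ := Metric.nhds_basis_closedBall.mem_iff.1 hopen
  obtain ⟨M, hM⟩ := ((isCompact_closedBall y₀ δ).prod
    (isCompact_Icc (a := a) (b := b))).exists_bound_of_continuousOn
    (f := fun q : ℂ × ℝ ↦ H (q.1 + z * γ q.2))
    (hH.comp (by fun_prop) (fun q hq ↦ hball hq.1 q.2 hq.2))
  refine intervalIntegral.tendsto_integral_filter_of_dominated_convergence
    (fun w ↦ ‖A w‖ * M) ?_ ?_ (hA.norm.mul_const M) ?_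
  · filter_upwards [closedBall_mem_nhds y₀ hδ] with y hy
    refine hA.aestronglyMeasurable_restrict_uIoc.mul ?_
    rw [uIoc_of_le hab]
    have : ContinuousOn (fun w ↦ H (y + z * γ w)) (Icc a b) :=
      hH.comp (by fun_prop) (fun w hw ↦ hball hy w hw)
    exact (this.aestronglyMeasurable measurableSet_Icc).mono_measure
      (Measure.restrict_mono Ioc_subset_Icc_self le_rfl)
  · filter_upwards [closedBall_mem_nhds y₀ hδ] with y hy
    refine Eventually.of_forall fun w hw ↦ ?_
    rw [uIoc_of_le hab] at hw
    rw [norm_mul]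
    exact mul_le_mul_of_nonneg_left (hM (y, w) ⟨hy, Ioc_subset_Icc_self hw⟩) (norm_nonneg _)
  · refine Eventually.of_forall fun w hw ↦ ?_
    rw [uIoc_of_le hab] at hw
    have h1 := hH.continuousAt (hΩ.mem_nhds (hin w (Ioc_subset_Icc_self hw)))
    have h2 : ContinuousAt (fun y : ℂ ↦ y + z * γ w) y₀ := by fun_prop
    exact (ContinuousAt.comp (f := fun y : ℂ ↦ y + z * γ w) h1 h2).const_mul _

section

variable {κ p : ℝ} {h : ℝ → ℝ}

theorem leg_mem_slitPlane {y : ℂ} {ρ : ℝ} (hy : 0 ≤ y.re) (hρ : 0 < ρ) {e w : ℝ} (hw : 0 ≤ w)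
    (hne : y.im + ρ * e ≠ 0) : y + ρ * (w + e * I) ∈ slitPlane := by
  refine mem_slitPlane_of_re_nonneg (re_add_mul_nonneg hy hρ.le (by simpa using hw)) fun h0 ↦ hne ?_
  have := congrArg Complex.im h0
  simpa using this

theorem top_mem_slitPlane {y : ℂ} {ρ : ℝ} (hy : 0 ≤ y.re) (hρ : 0 < ρ) (τ : ℝ) :
    y + ρ * (1 + τ * I) ∈ slitPlane := by
  refine Or.inl ?_
  simp only [add_re, mul_re, ofReal_re, one_re, I_re, mul_zero, ofReal_im, I_im, mul_one,
    sub_self, add_zero, add_im, one_im, mul_im, zero_mul, sub_zero]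
  linarith

theorem continuousAt_waveKernel (hκ : -1 < κ) (hp : 0 < p) (hh : IsCutoffProfile h) {y : ℂ} {ρ : ℝ}
    (hy : 0 ≤ y.re) (hρ : 0 < ρ) (h1 : y.im + ρ ≠ 0) (h2 : y.im - ρ ≠ 0) :
    ContinuousAt (fun y ↦ waveKernel κ p h y ρ) y := by
  have hH := (differentiableOn_coneProfile hp hh).continuousOn
  have hleg : ∀ e : ℝ, e = 1 ∨ e = -1 → ContinuousAt (fun y ↦
      legIntegral e (fun v ↦ archWeight κ v * coneProfile p h (y + ρ * v))) y := by
    intro e he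
    refine tendsto_integral_comp_affine zero_le_one (intervalIntegrable_archWeight hκ he)
      (by fun_prop) isOpen_slitPlane hH fun w hw ↦ leg_mem_slitPlane hy hρ hw.1 ?_
    rcases he with rfl | rfl
    · simpa using h1
    · simpa [sub_eq_add_neg] using h2
  exact (((hleg 1 (Or.inl rfl)).const_mul I).sub ((hleg (-1) (Or.inr rfl)).const_mul I)).add
    (tendsto_integral_comp_affine (by norm_num)
      ((continuous_archWeight_right κ).intervalIntegrable _ _) (by fun_prop) isOpen_slitPlane hH
      fun τ _ ↦ top_mem_slitPlane hy hρ τ)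

/-- The kernel is smooth in the distance to the origin away from the light cone. -/
theorem contDiffAt_waveKernel (hκ : -1 < κ) (hp : 0 < p) (hh : IsCutoffProfile h) {y : ℂ} {ρ : ℝ}
    (hy : 0 ≤ y.re) (hρ : 0 < ρ) (h1 : y.im + ρ ≠ 0) (h2 : y.im - ρ ≠ 0) :
    ContDiffAt ℝ ∞ (fun ρ ↦ waveKernel κ p h y ρ) ρ := by
  have hH := differentiableOn_coneProfile hp hh
  set Φ : ℂ → ℂ := fun z ↦ archIntegral (fun v ↦ archWeight κ v * coneProfile p h (y + z * v))
  have hleg : ∀ e : ℝ, e = 1 ∨ e = -1 → ∀ᶠ z in 𝓝 (ρ : ℂ), DifferentiableAt ℂ (fun z ↦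
      legIntegral e (fun v ↦ archWeight κ v * coneProfile p h (y + z * v))) z := by
    intro e he
    refine differentiableAt_integral_comp_affine zero_le_one (intervalIntegrable_archWeight hκ he)
      (by fun_prop) isOpen_slitPlane hH fun w hw ↦ leg_mem_slitPlane hy hρ hw.1 ?_
    rcases he with rfl | rfl
    · simpa using h1
    · simpa [sub_eq_add_neg] using h2
  have htop := differentiableAt_integral_comp_affine (y := y) (z₀ := ρ) (a := -1) (b := 1)
    (by norm_num) ((continuous_archWeight_right κ).intervalIntegrable _ _)
    (γ := fun τ ↦ 1 + τ * I) (by fun_prop) isOpen_slitPlane hH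
      fun τ _ ↦ top_mem_slitPlane hy hρ τ
  have hΦ : ∀ᶠ z in 𝓝 (ρ : ℂ), DifferentiableAt ℂ Φ z := by
    filter_upwards [hleg 1 (Or.inl rfl), hleg (-1) (Or.inr rfl), htop] with z e1 e2 e3
    exact ((e1.const_mul I).sub (e2.const_mul I)).add e3
  have hc : ContDiffAt ℂ ∞ Φ ρ := (analyticAt_iff_eventually_differentiableAt.2 hΦ).contDiffAt
  exact (hc.restrict_scalars ℝ).comp ρ ofRealCLM.contDiff.contDiffAt

end

/-! ### The singularity on the light cone -/

theorem integrable_rpow_mul_rpow_mul_cexp {κ p : ℝ} (hκ : -1 < κ) (hp : κ + 1 < p) {ζ : ℂ}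
    (hζ : 0 < ζ.re) {ρ : ℝ} (hρ : 0 < ρ) :
    Integrable (Function.uncurry fun w r : ℝ ↦
      ((w ^ κ : ℝ) : ℂ) * (((r ^ (p - 1) : ℝ) : ℂ) * cexp (-((ζ + ρ * w) * r))))
      ((volume.restrict (Ioi 0)).prod (volume.restrict (Ioi 0))) := by
  have hnorm : ∀ w r : ℝ, 0 < w → 0 < r →
      ‖((w ^ κ : ℝ) : ℂ) * (((r ^ (p - 1) : ℝ) : ℂ) * cexp (-((ζ + ρ * w) * r)))‖ =
      r ^ (p - 1) * Real.exp (-(ζ.re * r)) * (w ^ (κ + 1 - 1) * Real.exp (-((ρ * r) * w))) := by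
    intro w r hw hr
    have e : (-((ζ + ρ * w) * r) : ℂ).re = -(ζ.re * r) + -((ρ * r) * w) := by
      simp; ring
    rw [norm_mul, norm_mul, Complex.norm_exp, e, Real.exp_add, norm_real, norm_real,
      Real.norm_of_nonneg (Real.rpow_nonneg hw.le _), Real.norm_of_nonneg (Real.rpow_nonneg hr.le _),
      add_sub_cancel_right]
    ring
  have hmeas : Measurable (Function.uncurry fun w r : ℝ ↦
      ((w ^ κ : ℝ) : ℂ) * (((r ^ (p - 1) : ℝ) : ℂ) * cexp (-((ζ + ρ * w) * r)))) := by
    unfold Function.uncurry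
    fun_prop
  rw [integrable_prod_iff' hmeas.aestronglyMeasurable]
  constructor
  · filter_upwards [ae_restrict_mem measurableSet_Ioi] with r hr
    have hr : 0 < r := hr
    refine ((integrableOn_rpow_mul_exp (a := κ + 1) (by linarith)
      (mul_pos hρ hr)).const_mul (r ^ (p - 1) * Real.exp (-(ζ.re * r)))).mono'
      (hmeas.comp (by fun_prop : Measurable fun w : ℝ ↦ (w, r))).aestronglyMeasurable ?_
    filter_upwards [ae_restrict_mem measurableSet_Ioi] with w hw
    exact (hnorm w r hw hr).le
  · have h1 : IntegrableOn (fun r : ℝ ↦ ρ ^ (-(κ + 1)) * Real.Gamma (κ + 1) *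
        (r ^ (p - κ - 1 - 1) * Real.exp (-(ζ.re * r)))) (Ioi 0) :=
      (integrableOn_rpow_mul_exp (a := p - κ - 1) (by linarith) hζ).const_mul _
    refine h1.congr_fun_ae ?_
    filter_upwards [ae_restrict_mem measurableSet_Ioi] with r hr
    have hr : 0 < r := hr
    have e : ∫ w in Ioi (0 : ℝ), ‖Function.uncurry (fun w r : ℝ ↦
        ((w ^ κ : ℝ) : ℂ) * (((r ^ (p - 1) : ℝ) : ℂ) * cexp (-((ζ + ρ * w) * r)))) (w, r)‖ =
        ∫ w in Ioi (0 : ℝ), r ^ (p - 1) * Real.exp (-(ζ.re * r)) *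
          (w ^ (κ + 1 - 1) * Real.exp (-((ρ * r) * w))) :=
      setIntegral_congr_fun measurableSet_Ioi fun w hw ↦ hnorm w r hw hr
    rw [e, integral_const_mul, Real.integral_rpow_mul_exp_neg_mul_Ioi (by linarith)
      (mul_pos hρ hr), one_div, Real.inv_rpow (by positivity), ← Real.rpow_neg (by positivity),
      Real.mul_rpow hρ.le hr.le, show p - κ - 1 - 1 = (p - 1) + -(κ + 1) by ring,
      Real.rpow_add hr]
    ring

/-- The Beta integral, with a complex shift; it produces the homogeneous singularity on the cone. -/
theorem integral_rpow_mul_add_cpow {κ p : ℝ} (hκ : -1 < κ) (hp : κ + 1 < p) {ζ : ℂ}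
    (hζ : 0 < ζ.re) {ρ : ℝ} (hρ : 0 < ρ) :
    IntegrableOn (fun w : ℝ ↦ ((w ^ κ : ℝ) : ℂ) * (Real.Gamma p * (ζ + ρ * w) ^ (-(p : ℂ))))
      (Ioi 0) ∧
    ∫ w in Ioi (0 : ℝ), ((w ^ κ : ℝ) : ℂ) * (Real.Gamma p * (ζ + ρ * w) ^ (-(p : ℂ))) =
      Real.Gamma (κ + 1) * Real.Gamma (p - κ - 1) * ((ρ ^ (-(κ + 1)) : ℝ) : ℂ) *
        ζ ^ (-((p - κ - 1 : ℝ) : ℂ)) := by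
  have hint := integrable_rpow_mul_rpow_mul_cexp hκ hp hζ hρ
  have hinner : ∀ w ∈ Ioi (0 : ℝ), ∫ r in Ioi (0 : ℝ),
      ((w ^ κ : ℝ) : ℂ) * (((r ^ (p - 1) : ℝ) : ℂ) * cexp (-((ζ + ρ * w) * r))) =
      ((w ^ κ : ℝ) : ℂ) * (Real.Gamma p * (ζ + ρ * w) ^ (-(p : ℂ))) := by
    intro w hw
    have hw : 0 < w := hw
    rw [integral_const_mul, integral_rpow_mul_cexp (by linarith)]
    simp only [add_re, re_ofReal_mul, ofReal_re]
    positivity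
  refine ⟨?_, ?_⟩
  · have := hint.integral_prod_left
    refine IntegrableOn.congr_fun this (fun w hw ↦ ?_) measurableSet_Ioi
    exact hinner w hw
  · rw [← setIntegral_congr_fun measurableSet_Ioi hinner, integral_integral_swap hint]
    have houter : ∀ r ∈ Ioi (0 : ℝ), ∫ w in Ioi (0 : ℝ),
        ((w ^ κ : ℝ) : ℂ) * (((r ^ (p - 1) : ℝ) : ℂ) * cexp (-((ζ + ρ * w) * r))) =
        (Real.Gamma (κ + 1) * ((ρ ^ (-(κ + 1)) : ℝ) : ℂ)) *
          (((r ^ (p - κ - 1 - 1) : ℝ) : ℂ) * cexp (-(ζ * r))) := by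
      intro r hr
      have hr : 0 < r := hr
      have e1 : ∀ w : ℝ, ((w ^ κ : ℝ) : ℂ) *
          (((r ^ (p - 1) : ℝ) : ℂ) * cexp (-((ζ + ρ * w) * r))) =
          (((r ^ (p - 1) : ℝ) : ℂ) * cexp (-(ζ * r))) *
            ((w ^ (κ + 1 - 1) * Real.exp (-((ρ * r) * w)) : ℝ) : ℂ) := by
        intro w
        rw [add_sub_cancel_right, show (-((ζ + ρ * w) * r) : ℂ) = -(ζ * r) + -((ρ * r) * w) by ring,
          Complex.exp_add]
        push_cast
        ring
      simp_rw [e1]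
      rw [integral_const_mul, integral_complex_ofReal,
        Real.integral_rpow_mul_exp_neg_mul_Ioi (by linarith) (mul_pos hρ hr), one_div,
        Real.inv_rpow (by positivity), ← Real.rpow_neg (by positivity),
        Real.mul_rpow hρ.le hr.le, show p - κ - 1 - 1 = (p - 1) + -(κ + 1) by ring,
        Real.rpow_add hr]
      push_cast
      ring
    rw [setIntegral_congr_fun measurableSet_Ioi houter, integral_const_mul,
      integral_rpow_mul_cexp (by linarith) hζ]
    ring

/-- The regular factor of the weight is Lipschitz at the end point of a leg. -/
theorem exists_norm_cpow_sub_le (κ : ℝ) {e : ℝ} (he : e = 1 ∨ e = -1) :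
    ∃ L : ℝ, 0 ≤ L ∧ ∀ w ∈ Icc (0 : ℝ) 1,
      ‖(w + 2 * e * I : ℂ) ^ (κ : ℂ) - (2 * e * I : ℂ) ^ (κ : ℂ)‖ ≤ L * w := by
  have hd : ∀ w : ℝ, HasDerivAt (fun w : ℝ ↦ (w + 2 * e * I : ℂ) ^ (κ : ℂ))
      (κ * (w + 2 * e * I : ℂ) ^ ((κ : ℂ) - 1) * 1) w := fun w ↦ by
    have h1 : HasDerivAt (fun z : ℂ ↦ z + 2 * e * I) 1 (w : ℂ) :=
      (hasDerivAt_id (w : ℂ)).add_const (2 * e * I : ℂ)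
    exact (h1.cpow_const (add_two_mul_I_mem_slitPlane he w)).comp_ofReal
  have hc : Continuous fun w : ℝ ↦ (κ * (w + 2 * e * I : ℂ) ^ ((κ : ℂ) - 1) * 1 : ℂ) := by
    refine continuous_iff_continuousAt.2 fun w ↦ ?_
    refine (ContinuousAt.const_mul ?_ _).mul_const _
    exact ContinuousAt.cpow (f := fun w : ℝ ↦ (w + 2 * e * I : ℂ)) (by fun_prop)
      continuousAt_const (add_two_mul_I_mem_slitPlane he w)
  obtain ⟨L, hL⟩ := (isCompact_Icc (a := (0 : ℝ)) (b := 1)).exists_bound_of_continuousOn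
    hc.continuousOn
  refine ⟨L, (norm_nonneg _).trans (hL 0 (by simp)), fun w hw ↦ ?_⟩
  have := Convex.norm_image_sub_le_of_norm_hasDerivWithin_le
    (fun x _ ↦ (hd x).hasDerivWithinAt) hL (convex_Icc 0 1) (show (0 : ℝ) ∈ Icc 0 1 by simp) hw
  simpa [abs_of_nonneg hw.1] using this

/-- The singular part of one leg of the polygon integral. -/
noncomputable def legMain (κ b : ℝ) (e : ℝ) (y : ℂ) (ρ : ℝ) : ℂ :=
  (2 * e * I : ℂ) ^ (κ : ℂ) * (Real.Gamma (κ + 1) * Real.Gamma b * ((ρ ^ (-(κ + 1)) : ℝ) : ℂ) *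
    (y + ρ * (e * I)) ^ (-(b : ℂ)))

section

variable {κ p : ℝ} {h : ℝ → ℝ}

/-- The weight is replaced by its leading term `(2 e i w) ^ κ` at the end point and the leg is
extended to a half-line; both errors are absolutely convergent integrals. -/
theorem exists_norm_legIntegral_sub_le (hκ : -1 < κ) (hp : κ + 1 < p) (hp2 : p < κ + 2)
    (hh : IsCutoffProfile h) {e : ℝ} (he : e = 1 ∨ e = -1) :
    ∃ C : ℝ, 0 ≤ C ∧ ∀ (y : ℂ) (ρ : ℝ), 0 < y.re → 0 < ρ →
      ‖legIntegral e (fun v ↦ archWeight κ v * coneProfile p h (y + ρ * v)) -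
        legMain κ (p - κ - 1) e y ρ‖ ≤ C * (ρ ^ (-p) + 1) := by
  have hp0 : 0 < p := by linarith
  have hG : 0 ≤ Real.Gamma p := (Real.Gamma_pos_of_pos hp0).le
  -- `J1`, `J2`, `J3` bound the error of freezing the weight, the contribution of the entire part of
  -- the profile, and the tail of the half-line
  obtain ⟨L, hL0, hL⟩ := exists_norm_cpow_sub_le κ he
  obtain ⟨Cl, hCl0, hCl⟩ := exists_bound_lowLaplace hp0 hh
  set Λ : ℝ := ‖(2 * e * I : ℂ) ^ (κ : ℂ)‖ with hΛ
  have i1 : IntervalIntegrable (fun w : ℝ ↦ w ^ (κ + 1 - p)) volume 0 1 :=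
    intervalIntegral.intervalIntegrable_rpow' (by linarith)
  have i2 : IntervalIntegrable (fun w : ℝ ↦ w ^ κ) volume 0 1 :=
    intervalIntegral.intervalIntegrable_rpow' hκ
  have i3 : IntegrableOn (fun w : ℝ ↦ w ^ (κ - p)) (Ioi 1) :=
    integrableOn_Ioi_rpow_of_lt (by linarith) one_pos
  set J1 := ∫ w in (0 : ℝ)..1, w ^ (κ + 1 - p)
  set J2 := ∫ w in (0 : ℝ)..1, w ^ κ
  set J3 := ∫ w in Ioi (1 : ℝ), w ^ (κ - p)
  have hJ1 : 0 ≤ J1 :=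
    intervalIntegral.integral_nonneg zero_le_one fun w hw ↦ Real.rpow_nonneg hw.1 _
  have hJ2 : 0 ≤ J2 :=
    intervalIntegral.integral_nonneg zero_le_one fun w hw ↦ Real.rpow_nonneg hw.1 _
  have hJ3 : 0 ≤ J3 := setIntegral_nonneg measurableSet_Ioi fun w (hw : 1 < w) ↦
    Real.rpow_nonneg (by linarith) _
  refine ⟨L * Real.Gamma p * J1 + (L + Λ) * Cl * J2 + Λ * Real.Gamma p * J3, by positivity,
    fun y ρ hy hρ ↦ ?_⟩
  set ζ : ℂ := y + ρ * (e * I) with hζ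
  have hζre : 0 < ζ.re := by simpa [hζ] using hy
  have hadd : ∀ w : ℝ, y + ρ * (w + e * I) = ζ + ρ * w := fun w ↦ by rw [hζ]; ring
  have hpow : ∀ w : ℝ, 0 < w → ‖(ζ + ρ * w) ^ (-(p : ℂ))‖ ≤ ρ ^ (-p) * w ^ (-p) := by
    intro w hw
    rw [← ofReal_neg, norm_cpow_real, ← Real.mul_rpow hρ.le hw.le]
    refine Real.rpow_le_rpow_of_nonpos (by positivity) ?_ (by linarith)
    refine le_trans ?_ (re_le_norm _)
    simp only [add_re, re_ofReal_mul, ofReal_re]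
    linarith
  set f : ℝ → ℂ := fun w ↦ ((w ^ κ : ℝ) : ℂ) * (Real.Gamma p * (ζ + ρ * w) ^ (-(p : ℂ))) with hf
  obtain ⟨hfi, hfint⟩ := integral_rpow_mul_add_cpow hκ hp hζre hρ
  have hf01 : IntervalIntegrable f volume 0 1 := by
    rw [intervalIntegrable_iff_integrableOn_Ioc_of_le zero_le_one]
    exact hfi.mono_set Ioc_subset_Ioi_self
  have hsplit : ∫ w in Ioi (0 : ℝ), f w = (∫ w in (0 : ℝ)..1, f w) + ∫ w in Ioi (1 : ℝ), f w := by
    rw [intervalIntegral.integral_of_le zero_le_one, ← Ioc_union_Ioi_eq_Ioi (zero_le_one (α := ℝ)),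
      setIntegral_union (Ioc_disjoint_Ioi le_rfl) measurableSet_Ioi
        (hfi.mono_set Ioc_subset_Ioi_self) (hfi.mono_set (Ioi_subset_Ioi zero_le_one))]
  have htail : ‖∫ w in Ioi (1 : ℝ), f w‖ ≤ Real.Gamma p * ρ ^ (-p) * J3 := by
    rw [← integral_const_mul]
    refine norm_integral_le_of_norm_le (i3.const_mul _) ?_
    filter_upwards [ae_restrict_mem measurableSet_Ioi] with w hw
    have hw : 0 < w := one_pos.trans hw
    rw [hf, norm_mul, norm_mul, norm_real, norm_real, Real.norm_of_nonneg hG,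
      Real.norm_of_nonneg (Real.rpow_nonneg hw.le _), sub_eq_add_neg, Real.rpow_add hw]
    have := mul_le_mul_of_nonneg_left (hpow w hw) (mul_nonneg (Real.rpow_nonneg hw.le κ) hG)
    linarith
  have hcone : ContinuousOn (fun w : ℝ ↦ coneProfile p h (y + ρ * (w + e * I))) (uIcc 0 1) := by
    rw [uIcc_of_le zero_le_one]
    refine (differentiableOn_coneProfile hp0 hh).continuousOn.comp (by fun_prop) fun w hw ↦ ?_
    rw [hadd]
    refine Or.inl ?_
    simp only [add_re, re_ofReal_mul, ofReal_re]
    have := hw.1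
    positivity
  have hdiff : ‖legIntegral e (fun v ↦ archWeight κ v * coneProfile p h (y + ρ * v)) -
      (2 * e * I : ℂ) ^ (κ : ℂ) * ∫ w in (0 : ℝ)..1, f w‖ ≤
      L * Real.Gamma p * ρ ^ (-p) * J1 + (L + Λ) * Cl * J2 := by
    rw [legIntegral, ← intervalIntegral.integral_const_mul, ← intervalIntegral.integral_sub
      ((intervalIntegrable_archWeight hκ he).mul_continuousOn hcone) (hf01.const_mul _),
      ← intervalIntegral.integral_const_mul, ← intervalIntegral.integral_const_mul,
      ← intervalIntegral.integral_add (i1.const_mul _) (i2.const_mul _)]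
    refine intervalIntegral.norm_integral_le_of_norm_le zero_le_one
      (Eventually.of_forall fun w hw ↦ ?_) ((i1.const_mul _).add (i2.const_mul _))
    have hw0 : 0 < w := hw.1
    have hl := hL w ⟨hw.1.le, hw.2⟩
    have hA : ‖(w + 2 * e * I : ℂ) ^ (κ : ℂ)‖ ≤ L + Λ := by
      have := norm_add_le ((w + 2 * e * I : ℂ) ^ (κ : ℂ) - (2 * e * I : ℂ) ^ (κ : ℂ))
        ((2 * e * I : ℂ) ^ (κ : ℂ))
      rw [sub_add_cancel] at this
      nlinarith [hw.2]
    have hwκ : ‖((w ^ κ : ℝ) : ℂ)‖ = w ^ κ := by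
      rw [norm_real, Real.norm_of_nonneg (Real.rpow_nonneg hw0.le _)]
    have hlow : ‖lowLaplace p h (ζ + ρ * w)‖ ≤ Cl := by
      refine hCl _ ?_
      simp only [add_re, re_ofReal_mul, ofReal_re]
      positivity
    have e1 : archWeight κ (w + e * I) * coneProfile p h (y + ρ * (w + e * I)) -
        (2 * e * I : ℂ) ^ (κ : ℂ) * f w = ((w ^ κ : ℝ) : ℂ) *
        (((w + 2 * e * I : ℂ) ^ (κ : ℂ) - (2 * e * I : ℂ) ^ (κ : ℂ)) *
          (Real.Gamma p * (ζ + ρ * w) ^ (-(p : ℂ)))) - ((w ^ κ : ℝ) : ℂ) *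
        ((w + 2 * e * I : ℂ) ^ (κ : ℂ) * lowLaplace p h (ζ + ρ * w)) := by
      rw [archWeight_leg κ he, hadd, coneProfile, hf]
      simp only [ofReal_cpow hw0.le]
      ring
    rw [e1]
    refine (norm_sub_le _ _).trans (add_le_add ?_ ?_)
    · rw [norm_mul, norm_mul, norm_mul, hwκ, norm_real, Real.norm_of_nonneg hG]
      have hprod := mul_le_mul hl (mul_le_mul_of_nonneg_left (hpow w hw0) hG) (by positivity)
        (by positivity)
      refine (mul_le_mul_of_nonneg_left hprod (Real.rpow_nonneg hw0.le κ)).trans (le_of_eq ?_)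
      rw [show κ + 1 - p = κ + 1 + -p by ring, Real.rpow_add hw0, Real.rpow_add hw0, Real.rpow_one]
      ring
    · rw [norm_mul, norm_mul, hwκ]
      have hprod := mul_le_mul hA hlow (norm_nonneg _) (by positivity)
      refine (mul_le_mul_of_nonneg_left hprod (Real.rpow_nonneg hw0.le κ)).trans (le_of_eq ?_)
      ring
  have hmain : legMain κ (p - κ - 1) e y ρ = (2 * e * I : ℂ) ^ (κ : ℂ) *
      (∫ w in (0 : ℝ)..1, f w) + (2 * e * I : ℂ) ^ (κ : ℂ) * ∫ w in Ioi (1 : ℝ), f w := by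
    rw [← mul_add, ← hsplit, hfint, legMain]
  rw [hmain, ← sub_sub]
  refine (norm_sub_le _ _).trans ((add_le_add hdiff
    ((norm_mul_le _ _).trans (mul_le_mul_of_nonneg_left htail (norm_nonneg _)))).trans ?_)
  have hρp : 0 ≤ ρ ^ (-p) := by positivity
  have t1 : 0 ≤ L * Real.Gamma p * J1 := by positivity
  have t2 : 0 ≤ (L + Λ) * Cl * J2 * ρ ^ (-p) := by positivity
  have t3 : 0 ≤ Λ * Real.Gamma p * J3 := by positivity
  rw [← hΛ]
  linarith

/-- The singular part of `waveKernel`. -/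
noncomputable def waveMain (κ b : ℝ) (y : ℂ) (ρ : ℝ) : ℂ :=
  I * legMain κ b 1 y ρ - I * legMain κ b (-1) y ρ

/-- The kernel differs from its singular part by a term that is bounded across the light cone; the
contribution of the vertical edge of the polygon is bounded as well. -/
theorem exists_norm_waveKernel_sub_waveMain_le (hκ : -1 < κ) (hp : κ + 1 < p) (hp2 : p < κ + 2)
    (hh : IsCutoffProfile h) :
    ∃ C : ℝ, 0 ≤ C ∧ ∀ (y : ℂ) (ρ : ℝ), 0 ≤ y.re → 0 < ρ → y.im + ρ ≠ 0 → y.im - ρ ≠ 0 →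
      ‖waveKernel κ p h y ρ - waveMain κ (p - κ - 1) y ρ‖ ≤ C * (ρ ^ (-p) + 1) := by
  have hp0 : 0 < p := by linarith
  obtain ⟨C1, hC10, hC1⟩ := exists_norm_legIntegral_sub_le hκ hp hp2 hh (Or.inl rfl)
  obtain ⟨C2, hC20, hC2⟩ := exists_norm_legIntegral_sub_le hκ hp hp2 hh (Or.inr rfl)
  obtain ⟨C3, hC30, hC3⟩ := exists_bound_coneProfile hp0 hh
  have key : ∀ (y : ℂ) (ρ : ℝ), 0 < y.re → 0 < ρ →
      ‖waveKernel κ p h y ρ - waveMain κ (p - κ - 1) y ρ‖ ≤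
        (C1 + C2 + 3 ^ |κ| * 3 ^ |κ| * C3 * 2) * (ρ ^ (-p) + 1) := by
    intro y ρ hy hρ
    have ht : ‖∫ τ in (-1 : ℝ)..1, archWeight κ (1 + τ * I) *
        coneProfile p h (y + ρ * (1 + τ * I))‖ ≤
        3 ^ |κ| * 3 ^ |κ| * (C3 * (ρ ^ (-p) + 1)) * 2 := by
      have := intervalIntegral.norm_integral_le_of_norm_le_const (a := -1) (b := 1)
        (f := fun τ : ℝ ↦ archWeight κ (1 + τ * I) * coneProfile p h (y + ρ * (1 + τ * I)))
        (C := 3 ^ |κ| * 3 ^ |κ| * (C3 * (ρ ^ (-p) + 1))) (fun τ hτ ↦ ?_)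
      · refine this.trans (le_of_eq ?_); norm_num
      · rw [uIoc_of_le (by norm_num)] at hτ
        rw [norm_mul]
        refine mul_le_mul (norm_archWeight_top_le κ ⟨hτ.1.le, hτ.2⟩) ?_ (norm_nonneg _)
          (by positivity)
        have h1 := mul_le_norm_add_mul (ρ := ρ) hy.le (1 + τ * I)
        rw [top_re, mul_one] at h1
        refine (hC3 _ (re_add_mul_nonneg hy.le hρ.le (by rw [top_re]; norm_num))).trans ?_
        have := Real.rpow_le_rpow_of_nonpos (z := -p) hρ h1 (by linarith)
        gcongr
    have e : waveKernel κ p h y ρ - waveMain κ (p - κ - 1) y ρ =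
        I * (legIntegral 1 (fun v ↦ archWeight κ v * coneProfile p h (y + ρ * v)) -
          legMain κ (p - κ - 1) 1 y ρ) -
        I * (legIntegral (-1) (fun v ↦ archWeight κ v * coneProfile p h (y + ρ * v)) -
          legMain κ (p - κ - 1) (-1) y ρ) + ∫ τ in (-1 : ℝ)..1, archWeight κ (1 + τ * I) *
        coneProfile p h (y + ρ * (1 + τ * I)) := by
      rw [waveKernel, archIntegral, waveMain]; ring
    rw [e]
    refine (norm_add_le _ _).trans ((add_le_add (norm_sub_le _ _) ht).trans ?_)
    rw [norm_mul, norm_mul, norm_I, one_mul, one_mul]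
    have l1 := hC1 y ρ hy hρ
    have l2 := hC2 y ρ hy hρ
    linarith
  refine ⟨C1 + C2 + 3 ^ |κ| * 3 ^ |κ| * C3 * 2, by positivity, fun y ρ hy hρ h1 h2 ↦ ?_⟩
  -- both sides are continuous up to the boundary `Re y = 0` off the light cone
  have hlim : Tendsto (fun ε : ℝ ↦ y + ε) (𝓝[>] 0) (𝓝 y) := by
    have : Tendsto (fun ε : ℝ ↦ y + ε) (𝓝 0) (𝓝 (y + (0 : ℝ))) :=
      Continuous.tendsto (by fun_prop) 0
    simpa using this.mono_left nhdsWithin_le_nhds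
  have hleg : ∀ e : ℝ, y.im + ρ * e ≠ 0 →
      ContinuousAt (fun y ↦ legMain κ (p - κ - 1) e y ρ) y := by
    intro e he
    refine ContinuousAt.const_mul (ContinuousAt.const_mul ?_ _) _
    refine ContinuousAt.cpow (by fun_prop) continuousAt_const ?_
    have := leg_mem_slitPlane hy hρ le_rfl he
    simpa using this
  have hmain : ContinuousAt (fun y ↦ waveMain κ (p - κ - 1) y ρ) y :=
    ((hleg 1 (by simpa using h1)).const_mul I).sub
      ((hleg (-1) (by simpa [sub_eq_add_neg] using h2)).const_mul I)
  refine le_of_tendsto ((((continuousAt_waveKernel hκ hp0 hh hy hρ h1 h2).sub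
    hmain).tendsto.comp hlim).norm) ?_
  filter_upwards [self_mem_nhdsWithin] with ε hε
  refine key (y + ε) ρ ?_ hρ
  have : 0 < ε := hε
  simp only [add_re, ofReal_re]
  linarith

end

/-! ### Radial oscillatory integrals -/

/-- Splitting off the first coordinate of a Euclidean space. -/
noncomputable def splitFirst (m : ℕ) :
    EuclideanSpace ℝ (Fin (m + 1)) ≃ᵐ ℝ × EuclideanSpace ℝ (Fin m) :=
  (MeasurableEquiv.toLp 2 (Fin (m + 1) → ℝ)).symm.trans
    ((MeasurableEquiv.piFinSuccAbove (fun _ ↦ ℝ) 0).trans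
      ((MeasurableEquiv.refl ℝ).prodCongr (MeasurableEquiv.toLp 2 (Fin m → ℝ))))

theorem measurePreserving_splitFirst (m : ℕ) : MeasurePreserving (splitFirst m) := by
  have h1 := EuclideanSpace.volume_preserving_symm_measurableEquiv_toLp (Fin (m + 1))
  have h2 := volume_preserving_piFinSuccAbove (fun _ : Fin (m + 1) ↦ ℝ) 0
  have h3 := (MeasurePreserving.id (volume : Measure ℝ)).prod (PiLp.volume_preserving_toLp (Fin m))
  exact h3.comp (h2.comp h1)

theorem splitFirst_fst {m : ℕ} (ξ : EuclideanSpace ℝ (Fin (m + 1))) : (splitFirst m ξ).1 = ξ 0 :=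
  rfl

theorem norm_eq_sqrt_splitFirst {m : ℕ} (ξ : EuclideanSpace ℝ (Fin (m + 1))) :
    ‖ξ‖ = √((splitFirst m ξ).1 ^ 2 + ‖(splitFirst m ξ).2‖ ^ 2) := by
  rw [EuclideanSpace.real_norm_sq_eq, splitFirst_fst, EuclideanSpace.norm_eq]
  congr 1
  rw [Fin.sum_univ_succ]
  simp only [Real.norm_eq_abs, sq_abs]
  rfl

/-- Radial integration in all but the first coordinate. -/
theorem integral_first_coord_norm {m : ℕ} (hm : 1 ≤ m) {F : ℝ → ℂ} (hF : Measurable F)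
    (hint : Integrable fun ξ : EuclideanSpace ℝ (Fin (m + 1)) ↦ F ‖ξ‖) (ρ : ℝ) :
    ∫ ξ : EuclideanSpace ℝ (Fin (m + 1)), cexp (I * (ρ * ξ 0 : ℝ)) * F ‖ξ‖ =
      (m * volume.real (ball (0 : EuclideanSpace ℝ (Fin m)) 1) : ℝ) *
        ∫ q in (univ ×ˢ Ioi 0 : Set (ℝ × ℝ)),
          cexp (I * (ρ * q.1 : ℝ)) * (((q.2 ^ (m - 1) : ℝ) : ℂ) * F √(q.1 ^ 2 + q.2 ^ 2)) := by
  have : Nonempty (Fin m) := ⟨⟨0, hm⟩⟩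
  set c : ℝ := m * volume.real (ball (0 : EuclideanSpace ℝ (Fin m)) 1) with hc
  have hcpos : 0 < c := by
    have : 0 < volume.real (ball (0 : EuclideanSpace ℝ (Fin m)) 1) :=
      ENNReal.toReal_pos (measure_ball_pos _ _ one_pos).ne' measure_ball_lt_top.ne
    have : (0 : ℝ) < m := by exact_mod_cast hm
    positivity
  have hrad : ∀ f : ℝ → ℂ, ∫ y : EuclideanSpace ℝ (Fin m), f ‖y‖ =
      c * ∫ s in Ioi (0 : ℝ), ((s ^ (m - 1) : ℝ) : ℂ) * f s := by
    intro f
    rw [integral_fun_norm_addHaar]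
    simp only [finrank_euclideanSpace, Fintype.card_fin, nsmul_eq_mul, real_smul, hc]
    push_cast
    ring
  have hradr : ∀ f : ℝ → ℝ, ∫ y : EuclideanSpace ℝ (Fin m), f ‖y‖ =
      c * ∫ s in Ioi (0 : ℝ), s ^ (m - 1) * f s := by
    intro f
    rw [integral_fun_norm_addHaar]
    simp only [finrank_euclideanSpace, Fintype.card_fin, nsmul_eq_mul, smul_eq_mul, hc]
    ring
  have hradi : ∀ f : ℝ → ℂ, Integrable (fun y : EuclideanSpace ℝ (Fin m) ↦ f ‖y‖) ↔
      IntegrableOn (fun s : ℝ ↦ ((s ^ (m - 1) : ℝ) : ℂ) * f s) (Ioi 0) := by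
    intro f
    rw [integrable_fun_norm_addHaar]
    simp only [finrank_euclideanSpace, Fintype.card_fin, real_smul]
  have hmp := measurePreserving_splitFirst m
  have hi1 : Integrable fun q : ℝ × EuclideanSpace ℝ (Fin m) ↦ F √(q.1 ^ 2 + ‖q.2‖ ^ 2) := by
    rw [← hmp.integrable_comp_emb (splitFirst m).measurableEmbedding]
    refine hint.congr (Eventually.of_forall fun ξ ↦ ?_)
    simp only [Function.comp_def]
    rw [norm_eq_sqrt_splitFirst]
  have hi2 : Integrable fun q : ℝ × EuclideanSpace ℝ (Fin m) ↦
      cexp (I * (ρ * q.1 : ℝ)) * F √(q.1 ^ 2 + ‖q.2‖ ^ 2) := by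
    refine hi1.bdd_mul (c := 1) (by fun_prop) (Eventually.of_forall fun q ↦ ?_)
    rw [mul_comm I, norm_exp_ofReal_mul_I]
  have hi3 : Integrable (fun q : ℝ × ℝ ↦
      cexp (I * (ρ * q.1 : ℝ)) * (((q.2 ^ (m - 1) : ℝ) : ℂ) * F √(q.1 ^ 2 + q.2 ^ 2)))
      (volume.prod (volume.restrict (Ioi 0))) := by
    have hmeas : Measurable fun q : ℝ × ℝ ↦
      cexp (I * (ρ * q.1 : ℝ)) * (((q.2 ^ (m - 1) : ℝ) : ℂ) * F √(q.1 ^ 2 + q.2 ^ 2)) := by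
      fun_prop
    rw [integrable_prod_iff hmeas.aestronglyMeasurable]
    obtain ⟨j1, j2⟩ := (integrable_prod_iff hi1.aestronglyMeasurable).1 hi1
    constructor
    · filter_upwards [j1] with a ha
      exact ((hradi fun s ↦ F √(a ^ 2 + s ^ 2)).1 ha).const_mul _
    · refine (j2.const_mul c⁻¹).congr (Eventually.of_forall fun a ↦ ?_)
      simp only
      rw [hradr fun s ↦ ‖F √(a ^ 2 + s ^ 2)‖, inv_mul_cancel_left₀ hcpos.ne']
      refine setIntegral_congr_fun measurableSet_Ioi fun s hs ↦ ?_
      have hs : 0 < s := hs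
      rw [norm_mul, norm_mul, mul_comm I, norm_exp_ofReal_mul_I, one_mul, norm_real,
        Real.norm_of_nonneg (by positivity)]
  have hvol : (volume : Measure (ℝ × ℝ)).restrict (univ ×ˢ Ioi 0) =
      volume.prod (volume.restrict (Ioi 0)) := by
    rw [Measure.volume_eq_prod, ← Measure.prod_restrict, Measure.restrict_univ]
  rw [hvol, integral_prod _ hi3]
  have e1 : ∫ ξ : EuclideanSpace ℝ (Fin (m + 1)), cexp (I * (ρ * ξ 0 : ℝ)) * F ‖ξ‖ =
      ∫ q : ℝ × EuclideanSpace ℝ (Fin m), cexp (I * (ρ * q.1 : ℝ)) * F √(q.1 ^ 2 + ‖q.2‖ ^ 2) := by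
    rw [← hmp.integral_comp (splitFirst m).measurableEmbedding]
    refine integral_congr_ae (Eventually.of_forall fun ξ ↦ ?_)
    simp only [norm_eq_sqrt_splitFirst ξ, splitFirst_fst]
  rw [e1, Measure.volume_eq_prod, integral_prod _ hi2, ← integral_const_mul]
  refine integral_congr_ae (Eventually.of_forall fun a ↦ ?_)
  simp only
  rw [integral_const_mul, integral_const_mul, hrad fun s ↦ F √(a ^ 2 + s ^ 2)]
  ring

/-- The substitution `u = cos θ`, with the density of the first coordinate on a sphere. -/
theorem integral_sin_pow_comp_cos {m : ℕ} (hm : 1 ≤ m) (g : ℝ → ℂ) :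
    ∫ θ in Ioo 0 Real.pi, ((Real.sin θ ^ (m - 1) : ℝ) : ℂ) * g (Real.cos θ) =
      ∫ u in (-1 : ℝ)..1, (((1 - u ^ 2) ^ (((m : ℝ) - 2) / 2) : ℝ) : ℂ) * g u := by
  have himg : Real.cos '' Ioo 0 Real.pi = Ioo (-1) 1 :=
    Real.cosPartialHomeomorph.image_source_eq_target
  rw [intervalIntegral.integral_of_le (by norm_num), integral_Ioc_eq_integral_Ioo, ← himg,
    integral_image_eq_integral_abs_deriv_smul measurableSet_Ioo
      (fun θ _ ↦ (Real.hasDerivAt_cos θ).hasDerivWithinAt)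
      (Real.injOn_cos.mono Ioo_subset_Icc_self)]
  refine setIntegral_congr_fun measurableSet_Ioo fun θ hθ ↦ ?_
  have hs : 0 < Real.sin θ := Real.sin_pos_of_mem_Ioo hθ
  rw [abs_neg, abs_of_pos hs, real_smul, ← mul_assoc, ← ofReal_mul]
  congr 2
  have : 1 - Real.cos θ ^ 2 = Real.sin θ ^ 2 := by
    rw [← Real.sin_sq_add_cos_sq θ]; ring
  rw [this, ← Real.rpow_natCast (Real.sin θ) 2, ← Real.rpow_mul hs.le]
  have hmul : ∀ a : ℝ, Real.sin θ * Real.sin θ ^ a = Real.sin θ ^ (1 + a) := fun a ↦ by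
    rw [Real.rpow_add hs, Real.rpow_one]
  rw [hmul, ← Real.rpow_natCast, Nat.cast_sub hm]
  congr 1
  push_cast
  ring

/-- The plane integral over the upper half-plane in polar coordinates. -/
theorem integral_halfPlane_polar {m : ℕ} (hm : 1 ≤ m) {F : ℝ → ℂ}
    (hint : IntegrableOn (fun r : ℝ ↦ ((r ^ m : ℝ) : ℂ) * F r) (Ioi 0)) (ρ : ℝ) :
    ∫ q in (univ ×ˢ Ioi 0 : Set (ℝ × ℝ)),
      cexp (I * (ρ * q.1 : ℝ)) * (((q.2 ^ (m - 1) : ℝ) : ℂ) * F √(q.1 ^ 2 + q.2 ^ 2)) =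
    ∫ u in (-1 : ℝ)..1, (((1 - u ^ 2) ^ (((m : ℝ) - 2) / 2) : ℝ) : ℂ) *
      ∫ r in Ioi (0 : ℝ), ((r ^ m : ℝ) : ℂ) * F r * cexp (I * (ρ * (r * u) : ℝ)) := by
  have hS : MeasurableSet (univ ×ˢ Ioi 0 : Set (ℝ × ℝ)) := MeasurableSet.univ.prod measurableSet_Ioi
  set G : ℝ × ℝ → ℂ := fun q ↦
    (((q.1 ^ m : ℝ) : ℂ) * F q.1) * (((Real.sin q.2 ^ (m - 1) : ℝ) : ℂ) *
      cexp (I * (ρ * (q.1 * Real.cos q.2) : ℝ))) with hG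
  have hinter : polarCoord.target ∩ (univ ×ˢ Ioi 0 : Set (ℝ × ℝ)) =
      Ioi 0 ×ˢ Ioo 0 Real.pi := by
    ext q
    simp only [polarCoord_target, mem_inter_iff, mem_prod, mem_Ioi, mem_Ioo, mem_univ, true_and]
    constructor
    · rintro ⟨⟨h1, h2⟩, h3⟩
      exact ⟨h1, h3, h2.2⟩
    · rintro ⟨h1, h2, h3⟩
      exact ⟨⟨h1, by linarith [Real.pi_pos], h3⟩, h2⟩
  have hGi : Integrable G ((volume.restrict (Ioi 0)).prod (volume.restrict (Ioo 0 Real.pi))) := by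
    have h1 : Integrable (fun q : ℝ × ℝ ↦ (((q.1 ^ m : ℝ) : ℂ) * F q.1) * 1)
        ((volume.restrict (Ioi 0)).prod (volume.restrict (Ioo 0 Real.pi))) :=
      Integrable.mul_prod (f := fun r : ℝ ↦ ((r ^ m : ℝ) : ℂ) * F r) (g := fun _ ↦ (1 : ℂ)) hint
        (integrable_const _)
    simp only [mul_one] at h1
    refine h1.mul_bdd (c := 1) ?_ (Eventually.of_forall fun q ↦ ?_)
    · apply Measurable.aestronglyMeasurable
      fun_prop
    · rw [norm_mul, mul_comm I, norm_exp_ofReal_mul_I, mul_one, norm_real, norm_pow]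
      exact pow_le_one₀ (norm_nonneg _) (Real.abs_sin_le_one _)
  rw [← integral_indicator hS, ← integral_comp_polarCoord_symm]
  have e1 : ∫ q in polarCoord.target, q.1 • (univ ×ˢ Ioi 0 : Set (ℝ × ℝ)).indicator (fun q ↦
      cexp (I * (ρ * q.1 : ℝ)) * (((q.2 ^ (m - 1) : ℝ) : ℂ) * F √(q.1 ^ 2 + q.2 ^ 2)))
        (polarCoord.symm q) =
      ∫ q in polarCoord.target, (univ ×ˢ Ioi 0 : Set (ℝ × ℝ)).indicator G q := by
    refine setIntegral_congr_fun polarCoord.open_target.measurableSet fun q hq ↦ ?_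
    obtain ⟨r, θ⟩ := q
    simp only [polarCoord_target, mem_prod, mem_Ioi, mem_Ioo] at hq
    obtain ⟨hr, hθ1, hθ2⟩ := hq
    simp only [polarCoord_symm_apply]
    have hiff : ((r * Real.cos θ, r * Real.sin θ) ∈ (univ ×ˢ Ioi 0 : Set (ℝ × ℝ))) ↔
        ((r, θ) ∈ (univ ×ˢ Ioi 0 : Set (ℝ × ℝ))) := by
      simp only [mem_prod, mem_univ, mem_Ioi, true_and, mul_pos_iff_of_pos_left hr]
      constructor
      · intro h
        by_contra h0
        exact absurd (Real.sin_nonpos_of_nonpos_of_neg_pi_le (not_lt.1 h0) hθ1.le) (not_le.2 h)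
      · exact fun h ↦ Real.sin_pos_of_pos_of_lt_pi h hθ2
    by_cases hmem : (r, θ) ∈ (univ ×ˢ Ioi 0 : Set (ℝ × ℝ))
    · rw [indicator_of_mem hmem, indicator_of_mem (hiff.2 hmem)]
      have hsq : √((r * Real.cos θ) ^ 2 + (r * Real.sin θ) ^ 2) = r := by
        rw [show (r * Real.cos θ) ^ 2 + (r * Real.sin θ) ^ 2 =
          r ^ 2 * (Real.sin θ ^ 2 + Real.cos θ ^ 2) by ring, Real.sin_sq_add_cos_sq, mul_one,
          Real.sqrt_sq hr.le]
      obtain ⟨k, rfl⟩ : ∃ k, m = k + 1 := ⟨m - 1, by omega⟩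
      simp only [hsq, hG, real_smul, Nat.add_sub_cancel]
      push_cast
      ring
    · rw [indicator_of_notMem hmem, indicator_of_notMem (fun h ↦ hmem (hiff.1 h)), smul_zero]
  rw [e1, setIntegral_indicator hS, hinter, Measure.volume_eq_prod, ← Measure.prod_restrict,
    integral_prod_symm _ hGi, ← integral_sin_pow_comp_cos hm]
  refine integral_congr_ae (Eventually.of_forall fun θ ↦ ?_)
  simp only [hG]
  rw [← integral_const_mul]
  congr 1
  ext r
  ring

/-- The reflection that moves `x` to the first coordinate axis turns a radial oscillatory integral
over `ℝ ^ (m + 1)` into a one-dimensional superposition of Fourier integrals. -/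
theorem integral_cexp_inner_mul_norm {m : ℕ} (hm : 1 ≤ m) {F : ℝ → ℂ} (hF : Measurable F)
    (hint : Integrable fun ξ : EuclideanSpace ℝ (Fin (m + 1)) ↦ F ‖ξ‖)
    (x : EuclideanSpace ℝ (Fin (m + 1))) :
    ∫ ξ : EuclideanSpace ℝ (Fin (m + 1)), cexp (I * (inner ℝ x ξ : ℝ)) * F ‖ξ‖ =
      (m * volume.real (ball (0 : EuclideanSpace ℝ (Fin m)) 1) : ℝ) *
      ∫ u in (-1 : ℝ)..1, (((1 - u ^ 2) ^ (((m : ℝ) - 2) / 2) : ℝ) : ℂ) *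
        ∫ r in Ioi (0 : ℝ), ((r ^ m : ℝ) : ℂ) * F r * cexp (I * (‖x‖ * (r * u) : ℝ)) := by
  set e₀ : EuclideanSpace ℝ (Fin (m + 1)) := EuclideanSpace.single 0 ‖x‖ with he₀
  have hnorm : ‖x‖ = ‖e₀‖ := by simp [he₀]
  set R := (ℝ ∙ (x - e₀))ᗮ.reflection with hR
  have hRx : R x = e₀ := Submodule.reflection_sub hnorm
  have hint' : IntegrableOn (fun r : ℝ ↦ ((r ^ m : ℝ) : ℂ) * F r) (Ioi 0) := by
    have := (integrable_fun_norm_addHaar volume).1 hint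
    simpa only [finrank_euclideanSpace, Fintype.card_fin, Nat.add_sub_cancel, real_smul] using this
  rw [← integral_halfPlane_polar hm hint', ← integral_first_coord_norm hm hF hint,
    ← R.measurePreserving.integral_comp R.toHomeomorph.measurableEmbedding]
  refine integral_congr_ae (Eventually.of_forall fun ξ ↦ ?_)
  have h1 : inner ℝ x (R ξ) = ‖x‖ * ξ 0 := by
    rw [← R.inner_map_map x (R ξ), hRx, hR, Submodule.reflection_reflection, he₀,
      EuclideanSpace.inner_single_left]
    simp
  simp only [h1, R.norm_map]

/-! ### The cutoff and the damped symbol -/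

section

variable {d : ℕ} {ψ : EuclideanSpace ℝ (Fin d) → ℝ}

theorem norm_le_of_mollifier_ne_zero (hψ : IsRadialMollifier ψ) {η : EuclideanSpace ℝ (Fin d)}
    (h : ψ ((4 : ℝ) • η) ≠ 0) : ‖η‖ ≤ 1 / 4 := by
  have := hψ.support (Function.mem_support.2 h)
  rw [mem_closedBall_zero_iff, norm_smul] at this
  norm_num at this
  linarith

theorem cutoff_apply (ψ : EuclideanSpace ℝ (Fin d) → ℝ) (ξ : EuclideanSpace ℝ (Fin d)) :
    cutoff ψ ξ = 1 - ∫ η, ((4 : ℝ) ^ d * ψ ((4 : ℝ) • η)) *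
      (ball (0 : EuclideanSpace ℝ (Fin d)) (3 / 4)).indicator (fun _ ↦ (1 : ℝ)) (ξ - η) := rfl

theorem cutoff_eq_zero (hψ : IsRadialMollifier ψ) {ξ : EuclideanSpace ℝ (Fin d)}
    (hξ : ‖ξ‖ < 1 / 2) : cutoff ψ ξ = 0 := by
  have h1 : ∀ η, ((4 : ℝ) ^ d * ψ ((4 : ℝ) • η)) *
      (ball (0 : EuclideanSpace ℝ (Fin d)) (3 / 4)).indicator (fun _ ↦ (1 : ℝ)) (ξ - η) =
      (4 : ℝ) ^ d * ψ ((4 : ℝ) • η) := by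
    intro η
    by_cases h : ψ ((4 : ℝ) • η) = 0
    · simp [h]
    · have h2 := norm_le_of_mollifier_ne_zero hψ h
      have h3 : ξ - η ∈ ball (0 : EuclideanSpace ℝ (Fin d)) (3 / 4) := by
        rw [mem_ball_zero_iff]
        exact (norm_sub_le _ _).trans_lt (by linarith)
      rw [indicator_of_mem h3, mul_one]
  rw [cutoff_apply]
  simp_rw [h1]
  rw [integral_const_mul, Measure.integral_comp_smul, hψ.integral_eq_one, finrank_euclideanSpace,
    Fintype.card_fin, abs_of_pos (by positivity)]
  simp

theorem cutoff_eq_one (hψ : IsRadialMollifier ψ) {ξ : EuclideanSpace ℝ (Fin d)}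
    (hξ : 1 ≤ ‖ξ‖) : cutoff ψ ξ = 1 := by
  have h1 : ∀ η, ((4 : ℝ) ^ d * ψ ((4 : ℝ) • η)) *
      (ball (0 : EuclideanSpace ℝ (Fin d)) (3 / 4)).indicator (fun _ ↦ (1 : ℝ)) (ξ - η) = 0 := by
    intro η
    by_cases h : ψ ((4 : ℝ) • η) = 0
    · simp [h]
    · have h2 := norm_le_of_mollifier_ne_zero hψ h
      have h3 : ξ - η ∉ ball (0 : EuclideanSpace ℝ (Fin d)) (3 / 4) := by
        rw [mem_ball_zero_iff, not_lt]
        exact le_trans (by linarith) (norm_sub_norm_le ξ η)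
      rw [indicator_of_notMem h3, mul_zero]
  rw [cutoff_apply]
  simp_rw [h1]
  simp

theorem contDiff_cutoff (hψ : IsRadialMollifier ψ) : ContDiff ℝ ∞ (cutoff ψ) := by
  have hsmooth : ContDiff ℝ ∞ fun η ↦ (4 : ℝ) ^ d * ψ ((4 : ℝ) • η) :=
    contDiff_const.mul (hψ.smooth.comp (contDiff_const_smul _))
  have hsupp : HasCompactSupport fun η ↦ (4 : ℝ) ^ d * ψ ((4 : ℝ) • η) := by
    refine HasCompactSupport.intro (isCompact_closedBall 0 (1 / 4)) fun η hη ↦ ?_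
    by_contra h
    exact hη (mem_closedBall_zero_iff.2
      (norm_le_of_mollifier_ne_zero hψ (right_ne_zero_of_mul h)))
  have hloc : LocallyIntegrable
      ((ball (0 : EuclideanSpace ℝ (Fin d)) (3 / 4)).indicator fun _ ↦ (1 : ℝ)) :=
    (locallyIntegrable_const 1).indicator measurableSet_ball
  exact contDiff_const.sub (hsupp.contDiff_convolution_left _ hsmooth hloc)

/-- The cutoff is invariant under rotations, since both convolution factors are radial. -/
theorem cutoff_map (hψ : IsRadialMollifier ψ)
    (U : EuclideanSpace ℝ (Fin d) ≃ₗᵢ[ℝ] EuclideanSpace ℝ (Fin d))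
    (ξ : EuclideanSpace ℝ (Fin d)) : cutoff ψ (U ξ) = cutoff ψ ξ := by
  obtain ⟨ψ₁, hψ₁⟩ := hψ.radial
  rw [cutoff_apply, cutoff_apply,
    ← U.measurePreserving.integral_comp U.toHomeomorph.measurableEmbedding]
  congr 2
  ext η
  congr 1
  · simp only [hψ₁, norm_smul, U.norm_map]
  · rw [← map_sub]
    simp only [indicator, mem_ball_zero_iff, U.norm_map]

theorem cutoff_eq_of_norm_eq (hψ : IsRadialMollifier ψ) {ξ η : EuclideanSpace ℝ (Fin d)}
    (h : ‖ξ‖ = ‖η‖) : cutoff ψ ξ = cutoff ψ η := by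
  rw [← Submodule.reflection_sub h, cutoff_map hψ]

end

/-- The cutoff is a smooth function of `|ξ|`. -/
theorem exists_cutoffProfile {m : ℕ} {ψ : EuclideanSpace ℝ (Fin (m + 1)) → ℝ}
    (hψ : IsRadialMollifier ψ) :
    ∃ h : ℝ → ℝ, IsCutoffProfile h ∧ ∀ ξ, cutoff ψ ξ = h ‖ξ‖ := by
  set e₀ : EuclideanSpace ℝ (Fin (m + 1)) := EuclideanSpace.single 0 1 with he₀
  have hn : ∀ r : ℝ, ‖r • e₀‖ = |r| := fun r ↦ by simp [he₀, norm_smul]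
  -- the transition function removes the reflected copy of the profile on the negative half-line
  refine ⟨fun r ↦ Real.smoothTransition (4 * r) * cutoff ψ (r • e₀), ⟨?_, ?_, ?_⟩, ?_⟩
  · exact (Real.smoothTransition.contDiff.comp (contDiff_const.mul contDiff_id)).mul
      ((contDiff_cutoff hψ).comp (contDiff_id.smul contDiff_const))
  · intro r hr
    rcases le_or_gt r 0 with h0 | h0
    · rw [Real.smoothTransition.zero_of_nonpos (by linarith), zero_mul]
    · rw [cutoff_eq_zero hψ (by rw [hn, abs_of_pos h0]; exact hr), mul_zero]
  · intro r hr
    rw [cutoff_eq_one hψ (by rw [hn, abs_of_pos (by linarith)]; exact hr),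
      Real.smoothTransition.one_of_one_le (by linarith), mul_one]
  · intro ξ
    simp only
    have h1 : cutoff ψ (‖ξ‖ • e₀) = cutoff ψ ξ :=
      cutoff_eq_of_norm_eq hψ (by rw [hn, abs_norm])
    rw [h1]
    rcases lt_or_ge ‖ξ‖ (1 / 2) with h | h
    · rw [cutoff_eq_zero hψ h, mul_zero]
    · rw [Real.smoothTransition.one_of_one_le (by linarith), one_mul]

section

variable {m : ℕ} {p lam : ℝ} {h : ℝ → ℝ}

theorem pow_mul_rpow_eq (hpl : p = m + 1 - lam) {r : ℝ} (hr : 0 < r) :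
    r ^ m * r ^ (-lam) = r ^ (p - 1) := by
  rw [← Real.rpow_natCast, ← Real.rpow_add hr, hpl]
  congr 1
  ring

theorem integrable_damped_symbol (hpl : p = m + 1 - lam) (hh : IsCutoffProfile h) {y : ℂ}
    (hy : 0 < y.re) : Integrable fun ξ : EuclideanSpace ℝ (Fin (m + 1)) ↦
      cexp (-(y * ‖ξ‖)) * ((h ‖ξ‖ * ‖ξ‖ ^ (-lam) : ℝ) : ℂ) := by
  refine (integrable_fun_norm_addHaar volume
    (f := fun r : ℝ ↦ cexp (-(y * r)) * ((h r * r ^ (-lam) : ℝ) : ℂ))).2 ?_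
  simp only [finrank_euclideanSpace, Fintype.card_fin, Nat.add_sub_cancel, real_smul]
  refine ((hh.isSymbolLike (p - 1)).integrableOn hy).congr_fun (fun r hr ↦ ?_) measurableSet_Ioi
  simp only
  rw [← pow_mul_rpow_eq hpl hr]
  push_cast
  ring

/-- For positive damping the kernel is an absolutely convergent Fourier integral. -/
theorem integral_damped_eq_waveKernel (hm : 1 ≤ m) (hp : 0 < p) (hpl : p = m + 1 - lam)
    (hh : IsCutoffProfile h) {y : ℂ} (hy : 0 < y.re) (x : EuclideanSpace ℝ (Fin (m + 1))) :
    ∫ ξ : EuclideanSpace ℝ (Fin (m + 1)), cexp (I * (inner ℝ x ξ : ℝ)) *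
      (cexp (-(y * ‖ξ‖)) * ((h ‖ξ‖ * ‖ξ‖ ^ (-lam) : ℝ) : ℂ)) =
      (m * volume.real (ball (0 : EuclideanSpace ℝ (Fin m)) 1) : ℝ) *
        waveKernel (((m : ℝ) - 2) / 2) p h y ‖x‖ := by
  have hκ : -1 < ((m : ℝ) - 2) / 2 := by
    have : (1 : ℝ) ≤ m := by exact_mod_cast hm
    linarith
  have hmeas : Measurable fun r : ℝ ↦ cexp (-(y * r)) * ((h r * r ^ (-lam) : ℝ) : ℂ) := by
    have := hh.smooth.continuous.measurable
    fun_prop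
  rw [integral_cexp_inner_mul_norm hm (F := fun r : ℝ ↦
    cexp (-(y * r)) * ((h r * r ^ (-lam) : ℝ) : ℂ)) hmeas (integrable_damped_symbol hpl hh hy) x]
  congr 1
  rw [waveKernel, ← integral_eq_archIntegral hκ (G := fun v ↦ coneProfile p h (y + ‖x‖ * v))]
  · have hneg := intervalIntegral.integral_comp_neg (a := -1) (b := 1) fun τ : ℝ ↦
      (((1 - τ ^ 2) ^ (((m : ℝ) - 2) / 2) : ℝ) : ℂ) * coneProfile p h (y + ‖x‖ * (τ * I))
    rw [neg_neg] at hneg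
    rw [← hneg]
    refine intervalIntegral.integral_congr fun u _ ↦ ?_
    simp only [neg_sq]
    congr 1
    rw [coneProfile_eq_integral hp hh (by simpa using hy)]
    refine setIntegral_congr_fun measurableSet_Ioi fun r hr ↦ ?_
    rw [← pow_mul_rpow_eq hpl hr,
      show -((y + ‖x‖ * (((-u : ℝ) : ℂ) * I)) * r) = -(y * r) + I * (‖x‖ * (r * u) : ℝ) by
        push_cast; ring, Complex.exp_add]
    push_cast
    ring
  · intro v hv
    have hd := (differentiableOn_coneProfile hp hh).differentiableAt (x := y + ‖x‖ * v)
      (isOpen_slitPlane.mem_nhds (Or.inl ?_))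
    · exact hd.comp v (by fun_prop : DifferentiableAt ℂ (fun v : ℂ ↦ y + ‖x‖ * v) v)
    · simp only [add_re, re_ofReal_mul]
      positivity

end

/-! ### Distributions given by functions -/

theorem integrable_abs_sub_rpow {b : ℝ} (hb : b < 1) (s : ℝ) :
    Integrable ((Ioc (s - 1) (s + 1)).indicator fun r : ℝ ↦ |s - r| ^ (-b)) := by
  rw [integrable_indicator_iff measurableSet_Ioc, ← intervalIntegrable_iff_integrableOn_Ioc_of_le
    (by linarith)]
  have h0 : IntervalIntegrable (fun r : ℝ ↦ r ^ (-b)) volume 0 1 :=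
    intervalIntegral.intervalIntegrable_rpow' (by linarith)
  have h1 : IntervalIntegrable (fun r : ℝ ↦ |s - r| ^ (-b)) volume (s - 1) s := by
    have := (h0.comp_sub_left s).symm
    rw [sub_zero] at this
    refine this.congr fun r hr ↦ ?_
    rw [uIoc_of_le (by linarith)] at hr
    rw [abs_of_nonneg (by linarith [hr.2])]
  have h2 : IntervalIntegrable (fun r : ℝ ↦ |s - r| ^ (-b)) volume s (s + 1) := by
    have := h0.comp_sub_right s
    rw [zero_add, add_comm 1 s] at this
    refine this.congr fun r hr ↦ ?_
    rw [uIoc_of_le (by linarith)] at hr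
    rw [abs_sub_comm, abs_of_nonneg (by linarith [hr.1])]
  exact h1.trans h2

/-- The singularity on a sphere is integrable against Schwartz functions. -/
theorem integrable_schwartz_mul_abs_sub_rpow {m : ℕ}
    (φ : 𝓢(EuclideanSpace ℝ (Fin (m + 1)), ℂ)) {b : ℝ} (hb0 : 0 ≤ b) (hb : b < 1) (s : ℝ) :
    Integrable fun x : EuclideanSpace ℝ (Fin (m + 1)) ↦ ‖φ x‖ * |s - ‖x‖| ^ (-b) := by
  obtain ⟨M, hM⟩ : ∃ M : ℝ, ∀ x, ‖φ x‖ ≤ M := by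
    obtain ⟨C, -, hC⟩ := φ.decay 0 0
    exact ⟨C, fun x ↦ by simpa using hC x⟩
  have hsph : Integrable fun x : EuclideanSpace ℝ (Fin (m + 1)) ↦
      (Ioc (s - 1) (s + 1)).indicator (fun r : ℝ ↦ |s - r| ^ (-b)) ‖x‖ := by
    rw [integrable_fun_norm_addHaar volume]
    simp only [finrank_euclideanSpace, Fintype.card_fin, Nat.add_sub_cancel, smul_eq_mul]
    refine ((integrable_abs_sub_rpow hb s).const_mul ((|s| + 1) ^ m)).integrableOn.mono' ?_ ?_
    · apply Measurable.aestronglyMeasurable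
      refine Measurable.mul (by fun_prop) (Measurable.indicator (by fun_prop) measurableSet_Ioc)
    · filter_upwards [ae_restrict_mem measurableSet_Ioi] with r hr
      have hr : 0 < r := hr
      by_cases h : r ∈ Ioc (s - 1) (s + 1)
      · rw [indicator_of_mem h, norm_mul, Real.norm_of_nonneg (by positivity),
          Real.norm_of_nonneg (by positivity)]
        gcongr
        linarith [h.2, le_abs_self s]
      · rw [indicator_of_notMem h]; simp
  refine (φ.integrable.norm.add (hsph.const_mul M)).mono'
    (φ.continuous.norm.aestronglyMeasurable.mul (by
      apply Measurable.aestronglyMeasurable; fun_prop)) (Eventually.of_forall fun x ↦ ?_)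
  have hφ := norm_nonneg (φ x)
  have hpow : 0 ≤ |s - ‖x‖| ^ (-b) := by positivity
  rw [Real.norm_of_nonneg (by positivity)]
  simp only [Pi.add_apply]
  by_cases h : ‖x‖ ∈ Ioc (s - 1) (s + 1)
  · rw [indicator_of_mem h]
    have := mul_le_mul_of_nonneg_right (hM x) hpow
    linarith
  · rw [indicator_of_notMem h, mul_zero, add_zero]
    refine mul_le_of_le_one_right hφ (Real.rpow_le_one_of_one_le_of_nonpos ?_ (by linarith))
    by_contra hlt
    rw [not_le, abs_lt] at hlt
    exact h ⟨by linarith [hlt.2], by linarith [hlt.1]⟩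

section

variable {d : ℕ}

theorem exists_isGivenBy_of_bounded {g : EuclideanSpace ℝ (Fin d) → ℂ} (hg : Measurable g) {B : ℝ}
    (hB : ∀ x, ‖g x‖ ≤ B) : ∃ T, IsGivenBy T g := by
  have hmem : MemLp g ⊤ (volume : Measure (EuclideanSpace ℝ (Fin d))) :=
    memLp_top_of_bound hg.aestronglyMeasurable B (Eventually.of_forall hB)
  refine ⟨Lp.toTemperedDistribution hmem.toLp, fun φ ↦ ⟨?_, ?_⟩⟩
  · exact φ.integrable.mul_bdd hg.aestronglyMeasurable (Eventually.of_forall hB)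
  · rw [Lp.toTemperedDistribution_apply]
    refine integral_congr_ae ?_
    filter_upwards [hmem.coeFn_toLp] with x hx
    rw [hx, smul_eq_mul]

theorem IsGivenBy.const_smul {T : 𝓢'(EuclideanSpace ℝ (Fin d), ℂ)}
    {g : EuclideanSpace ℝ (Fin d) → ℂ} (hT : IsGivenBy T g) (c : ℂ) :
    IsGivenBy (c • T) fun x ↦ c * g x := by
  intro φ
  obtain ⟨h1, h2⟩ := hT φ
  have e : (fun x ↦ φ x * (c * g x)) = fun x ↦ c * (φ x * g x) := by ext x; ring
  rw [e]
  refine ⟨h1.const_mul c, ?_⟩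
  rw [integral_const_mul, ← h2]
  rfl

/-- The symbol `e^{it|ξ|} h(ξ) |ξ|^{-λ}` of the distribution `⟨D⟩^{σ-1} e^{it|D|} F_λ`. -/
noncomputable def waveSymbol (ψ : EuclideanSpace ℝ (Fin d) → ℝ) (lam t : ℝ)
    (ξ : EuclideanSpace ℝ (Fin d)) : ℂ :=
  cexp (I * t * ‖ξ‖) * ((cutoff ψ ξ * ‖ξ‖ ^ (-lam) : ℝ) : ℂ)

theorem measurable_cutoff {ψ : EuclideanSpace ℝ (Fin d) → ℝ} (hψ : IsRadialMollifier ψ) :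
    Measurable (cutoff ψ) := (contDiff_cutoff hψ).continuous.measurable

theorem exists_bound_cutoff_mul_rpow {m : ℕ} {ψ : EuclideanSpace ℝ (Fin (m + 1)) → ℝ}
    (hψ : IsRadialMollifier ψ) {lam : ℝ} (hlam : 0 < lam) :
    ∃ B : ℝ, 0 ≤ B ∧ ∀ ξ, |cutoff ψ ξ * ‖ξ‖ ^ (-lam)| ≤ B := by
  obtain ⟨h, hh, hcut⟩ := exists_cutoffProfile hψ
  obtain ⟨B, hB⟩ := hh.exists_bound
  have hB0 : 0 ≤ B := (abs_nonneg _).trans (hB 0)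
  refine ⟨B * (1 / 2) ^ (-lam), by positivity, fun ξ ↦ ?_⟩
  rcases lt_or_ge ‖ξ‖ (1 / 2) with h1 | h1
  · rw [cutoff_eq_zero hψ h1, zero_mul, abs_zero]
    positivity
  · rw [abs_mul, hcut, abs_of_nonneg (by positivity : 0 ≤ ‖ξ‖ ^ (-lam))]
    exact mul_le_mul (hB _) (Real.rpow_le_rpow_of_nonpos (by norm_num) h1 (by linarith))
      (by positivity) hB0

/-- The powers of `⟨D⟩` cancel, and the distribution is the inverse transform of its symbol. -/
theorem exists_bracketD_halfWave_FLam_eq {m : ℕ} {ψ : EuclideanSpace ℝ (Fin (m + 1)) → ℝ}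
    (hψ : IsRadialMollifier ψ) {lam : ℝ} (hlam : 0 < lam) (t : ℝ) {σ : ℝ} (hσ : 1 ≤ σ) :
    ∃ T : 𝓢'(EuclideanSpace ℝ (Fin (m + 1)), ℂ),
      IsGivenBy T (fun η ↦ ((2 * Real.pi : ℝ) ^ (m + 1) : ℂ) *
        waveSymbol ψ lam t ((2 * Real.pi) • η)) ∧
      bracketD (σ - 1) (halfWave t (FLam ψ σ lam)) = 𝓕⁻ T := by
  set c : ℂ := ((2 * Real.pi : ℝ) ^ (m + 1) : ℂ) with hc
  obtain ⟨B, hB0, hB⟩ := exists_bound_cutoff_mul_rpow hψ hlam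
  have hcm := measurable_cutoff hψ
  have hbr1 : ∀ ξ : EuclideanSpace ℝ (Fin (m + 1)), 1 ≤ bracket ξ := fun ξ ↦ by
    rw [bracket, Real.one_le_sqrt]
    have := sq_nonneg ‖ξ‖
    linarith
  have hbrm : Measurable (bracket : EuclideanSpace ℝ (Fin (m + 1)) → ℝ) := by
    unfold bracket; fun_prop
  have hgm : Measurable fun ξ : EuclideanSpace ℝ (Fin (m + 1)) ↦ (gLam ψ σ lam ξ : ℂ) := by
    unfold gLam; fun_prop
  have hgb : ∀ ξ, ‖(gLam ψ σ lam ξ : ℂ)‖ ≤ B := fun ξ ↦ by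
    rw [norm_real, gLam, mul_assoc, norm_mul, Real.norm_eq_abs, Real.norm_eq_abs,
      abs_of_pos (Real.rpow_pos_of_pos (one_pos.trans_le (hbr1 ξ)) _)]
    exact (mul_le_mul (Real.rpow_le_one_of_one_le_of_nonpos (hbr1 ξ) (by linarith)) (hB ξ)
      (abs_nonneg _) zero_le_one).trans (le_of_eq (one_mul B))
  have hexp : ∀ ξ : EuclideanSpace ℝ (Fin (m + 1)), ‖cexp (I * t * ‖ξ‖)‖ = 1 := fun ξ ↦ by
    rw [show (I * t * ‖ξ‖ : ℂ) = ((t * ‖ξ‖ : ℝ) : ℂ) * I by push_cast; ring,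
      norm_exp_ofReal_mul_I]
  obtain ⟨T₀, hT₀⟩ := exists_isGivenBy_of_bounded (d := m + 1)
    (g := fun η ↦ (gLam ψ σ lam ((2 * Real.pi) • η) : ℂ)) (hgm.comp (by fun_prop))
    (fun η ↦ hgb _)
  have hF : IsGivenBy (𝓕 (FLam ψ σ lam)) fun η ↦ c * (gLam ψ σ lam ((2 * Real.pi) • η) : ℂ) := by
    have : 𝓕 (FLam ψ σ lam) = c • T₀ := by
      rw [FLam, invFourier, ofFun_eq hT₀, FourierTransform.fourier_smul,
        FourierTransform.fourier_fourierInv_eq]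
    rw [this]
    exact hT₀.const_smul c
  obtain ⟨T₁, hT₁⟩ := exists_isGivenBy_of_bounded (d := m + 1) (B := ‖c‖ * B)
    (g := fun η ↦ cexp (I * t * ‖(2 * Real.pi) • η‖) *
      (c * (gLam ψ σ lam ((2 * Real.pi) • η) : ℂ)))
    (Measurable.mul (by fun_prop) ((hgm.comp (by fun_prop :
      Measurable fun η : EuclideanSpace ℝ (Fin (m + 1)) ↦ (2 * Real.pi) • η)).const_mul c))
    (fun η ↦ by
      rw [norm_mul, hexp, one_mul, norm_mul]
      exact mul_le_mul_of_nonneg_left (hgb _) (norm_nonneg _))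
  have h1 : halfWave t (FLam ψ σ lam) = 𝓕⁻ T₁ :=
    multiplier_eq hF (by rw [FourierTransform.fourier_fourierInv_eq]; exact hT₁)
  have hsymb : ∀ ξ, ((bracket ξ ^ (σ - 1) : ℝ) : ℂ) * (cexp (I * t * ‖ξ‖) *
      (c * (gLam ψ σ lam ξ : ℂ))) = c * waveSymbol ψ lam t ξ := fun ξ ↦ by
    have e : bracket ξ ^ (σ - 1) * bracket ξ ^ (-σ + 1) = 1 := by
      rw [← Real.rpow_add (one_pos.trans_le (hbr1 ξ))]
      simp
    have e' : ((bracket ξ ^ (σ - 1) : ℝ) : ℂ) * ((bracket ξ ^ (-σ + 1) : ℝ) : ℂ) = 1 := by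
      exact_mod_cast e
    rw [waveSymbol, gLam]
    push_cast at e' ⊢
    linear_combination (c * cexp (I * t * ‖ξ‖) * (cutoff ψ ξ : ℂ) *
      ((‖ξ‖ ^ (-lam) : ℝ) : ℂ)) * e'
  obtain ⟨T₂, hT₂⟩ := exists_isGivenBy_of_bounded (d := m + 1) (B := ‖c‖ * B)
    (g := fun η ↦ c * waveSymbol ψ lam t ((2 * Real.pi) • η))
    (by unfold waveSymbol; fun_prop)
    (fun η ↦ by
      rw [norm_mul, waveSymbol, norm_mul, hexp, one_mul, norm_real]
      exact mul_le_mul_of_nonneg_left (hB _) (norm_nonneg _))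
  refine ⟨T₂, hT₂, ?_⟩
  rw [h1]
  refine multiplier_eq (g := fun η ↦ cexp (I * t * ‖(2 * Real.pi) • η‖) *
    (c * (gLam ψ σ lam ((2 * Real.pi) • η) : ℂ))) ?_ ?_
  · rw [FourierTransform.fourier_fourierInv_eq]; exact hT₁
  · rw [FourierTransform.fourier_fourierInv_eq]
    simp_rw [hsymb]
    exact hT₂

end

/-! ### Removal of the damping -/

section

variable {m : ℕ} {p lam : ℝ} {h : ℝ → ℝ}

/-- The dimensional constant of radial integration in all but one coordinate. -/
noncomputable def sliceConst (m : ℕ) : ℝ :=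
  m * volume.real (ball (0 : EuclideanSpace ℝ (Fin m)) 1)

theorem sliceConst_pos (hm : 1 ≤ m) : 0 < sliceConst m := by
  have h1 : 0 < volume.real (ball (0 : EuclideanSpace ℝ (Fin m)) 1) :=
    ENNReal.toReal_pos (measure_ball_pos _ _ one_pos).ne' measure_ball_lt_top.ne
  have h2 : (0 : ℝ) < m := by exact_mod_cast hm
  exact mul_pos h2 h1

/-- The symbol with complex time, `e^{-y|ξ|} h(|ξ|) |ξ|^{-λ}`. -/
noncomputable def dampedSymbol (h : ℝ → ℝ) (lam : ℝ) (y : ℂ)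
    (ξ : EuclideanSpace ℝ (Fin (m + 1))) : ℂ :=
  cexp (-(y * ‖ξ‖)) * ((h ‖ξ‖ * ‖ξ‖ ^ (-lam) : ℝ) : ℂ)

theorem integrable_prod_damped (hpl : p = m + 1 - lam) (hh : IsCutoffProfile h) {y : ℂ}
    (hy : 0 < y.re) (φ : 𝓢(EuclideanSpace ℝ (Fin (m + 1)), ℂ)) (c : ℂ) :
    Integrable (Function.uncurry fun x η : EuclideanSpace ℝ (Fin (m + 1)) ↦
      φ x * (cexp ((2 * Real.pi * inner ℝ x η : ℝ) * I) *
        (c * dampedSymbol h lam y ((2 * Real.pi) • η)))) (volume.prod volume) := by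
  have h1 : Integrable fun η : EuclideanSpace ℝ (Fin (m + 1)) ↦
      c * dampedSymbol h lam y ((2 * Real.pi) • η) :=
    ((integrable_damped_symbol hpl hh hy).comp_smul (by positivity)).const_mul c
  have h2 := (φ.integrable (μ := volume)).mul_prod h1
  refine (h2.bdd_mul (c := 1) (f := fun q : EuclideanSpace ℝ (Fin (m + 1)) ×
    EuclideanSpace ℝ (Fin (m + 1)) ↦ cexp ((2 * Real.pi * inner ℝ q.1 q.2 : ℝ) * I))
    (by apply Continuous.aestronglyMeasurable; fun_prop) (Eventually.of_forall fun q ↦ ?_)).congr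
    (Eventually.of_forall fun q ↦ ?_)
  · rw [norm_exp_ofReal_mul_I]
  · simp only [Function.uncurry]
    ring

theorem integral_cexp_mul_dampedSymbol (hm : 1 ≤ m) (hp : 0 < p) (hpl : p = m + 1 - lam)
    (hh : IsCutoffProfile h) {y : ℂ} (hy : 0 < y.re) (x : EuclideanSpace ℝ (Fin (m + 1))) :
    ∫ η : EuclideanSpace ℝ (Fin (m + 1)), cexp ((2 * Real.pi * inner ℝ x η : ℝ) * I) *
      (((2 * Real.pi : ℝ) ^ (m + 1) : ℂ) * dampedSymbol h lam y ((2 * Real.pi) • η)) =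
      sliceConst m * waveKernel (((m : ℝ) - 2) / 2) p h y ‖x‖ := by
  have e : ∀ η : EuclideanSpace ℝ (Fin (m + 1)), cexp ((2 * Real.pi * inner ℝ x η : ℝ) * I) *
      (((2 * Real.pi : ℝ) ^ (m + 1) : ℂ) * dampedSymbol h lam y ((2 * Real.pi) • η)) =
      ((2 * Real.pi : ℝ) ^ (m + 1) : ℂ) *
        (fun ξ ↦ cexp (I * (inner ℝ x ξ : ℝ)) * dampedSymbol h lam y ξ) ((2 * Real.pi) • η) := by
    intro η
    simp only [inner_smul_right, mul_comm I]
    ring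
  simp_rw [e]
  rw [integral_const_mul, Measure.integral_comp_smul volume
    (fun ξ : EuclideanSpace ℝ (Fin (m + 1)) ↦
      cexp (I * (inner ℝ x ξ : ℝ)) * dampedSymbol h lam y ξ) (2 * Real.pi),
    finrank_euclideanSpace, Fintype.card_fin, abs_of_pos (by positivity), real_smul, ← mul_assoc]
  have hc : ((2 * Real.pi : ℝ) ^ (m + 1) : ℂ) * ((((2 * Real.pi) ^ (m + 1))⁻¹ : ℝ) : ℂ) = 1 := by
    rw [← ofReal_pow, ← ofReal_mul, mul_inv_cancel₀ (by positivity), ofReal_one]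
  rw [hc, one_mul]
  exact integral_damped_eq_waveKernel hm hp hpl hh hy x

/-- The duality between the damped symbol and the kernel with complex time. -/
theorem integral_schwartz_mul_waveKernel (hm : 1 ≤ m) (hp : 0 < p) (hpl : p = m + 1 - lam)
    (hh : IsCutoffProfile h) {y : ℂ} (hy : 0 < y.re)
    (φ : 𝓢(EuclideanSpace ℝ (Fin (m + 1)), ℂ)) :
    Integrable (fun x ↦ φ x * (sliceConst m * waveKernel (((m : ℝ) - 2) / 2) p h y ‖x‖)) ∧
    ∫ η, (𝓕⁻ φ) η * (((2 * Real.pi : ℝ) ^ (m + 1) : ℂ) *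
      dampedSymbol h lam y ((2 * Real.pi) • η)) =
    ∫ x, φ x * (sliceConst m * waveKernel (((m : ℝ) - 2) / 2) p h y ‖x‖) := by
  have hint := integrable_prod_damped hpl hh hy φ ((2 * Real.pi : ℝ) ^ (m + 1) : ℂ)
  have hinner : ∀ x : EuclideanSpace ℝ (Fin (m + 1)), ∫ η : EuclideanSpace ℝ (Fin (m + 1)),
      φ x * (cexp ((2 * Real.pi * inner ℝ x η : ℝ) * I) *
        (((2 * Real.pi : ℝ) ^ (m + 1) : ℂ) * dampedSymbol h lam y ((2 * Real.pi) • η))) =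
      φ x * (sliceConst m * waveKernel (((m : ℝ) - 2) / 2) p h y ‖x‖) := fun x ↦ by
    rw [integral_const_mul, integral_cexp_mul_dampedSymbol hm hp hpl hh hy]
  refine ⟨hint.integral_prod_left.congr (Eventually.of_forall hinner), ?_⟩
  simp_rw [← hinner]
  rw [integral_integral_swap hint]
  refine integral_congr_ae (Eventually.of_forall fun η ↦ ?_)
  simp only [SchwartzMap.fourierInv_coe, Real.fourierInv_eq', smul_eq_mul]
  rw [← integral_mul_const]
  refine integral_congr_ae (Eventually.of_forall fun x ↦ ?_)
  simp only
  ring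

theorem ae_norm_ne (t : ℝ) : ∀ᵐ x : EuclideanSpace ℝ (Fin (m + 1)),
    0 < ‖x‖ ∧ t + ‖x‖ ≠ 0 ∧ t - ‖x‖ ≠ 0 := by
  have h1 : ∀ r : ℝ, ∀ᵐ x : EuclideanSpace ℝ (Fin (m + 1)), ‖x‖ ≠ r := by
    intro r
    have := Measure.addHaar_sphere (volume : Measure (EuclideanSpace ℝ (Fin (m + 1)))) 0 r
    rw [← compl_mem_ae_iff] at this
    filter_upwards [this] with x hx hr
    exact hx (mem_sphere_zero_iff_norm.2 hr)
  filter_upwards [h1 0, h1 t, h1 (-t)] with x h0 h2 h3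
  exact ⟨lt_of_le_of_ne (norm_nonneg x) h0.symm, fun h ↦ h3 (by linarith), fun h ↦ h2 (by linarith)⟩

/-- The half-wave kernel as a function on space. -/
noncomputable def waveFun (m : ℕ) (p : ℝ) (h : ℝ → ℝ) (t : ℝ)
    (x : EuclideanSpace ℝ (Fin (m + 1))) : ℂ :=
  sliceConst m * waveKernel (((m : ℝ) - 2) / 2) p h (-(I * t)) ‖x‖

/-- The distribution is given by the boundary values of the kernel: the damping is removed by
dominated convergence on both sides of the duality. -/
theorem isGivenBy_waveFun (hm : 1 ≤ m) (hp : 0 < p) (hp2 : p < ((m : ℝ) - 2) / 2 + 2)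
    (hpl : p = m + 1 - lam) (hlam : 0 < lam) {ψ : EuclideanSpace ℝ (Fin (m + 1)) → ℝ}
    (hψ : IsRadialMollifier ψ) (hh : IsCutoffProfile h) (hcut : ∀ ξ, cutoff ψ ξ = h ‖ξ‖)
    {t : ℝ} (ht : t ≠ 0) {σ : ℝ} (hσ : 1 ≤ σ) :
    IsGivenBy (bracketD (σ - 1) (halfWave t (FLam ψ σ lam))) (waveFun m p h t) := by
  obtain ⟨T, hT, hTeq⟩ := exists_bracketD_halfWave_FLam_eq hψ hlam t hσ
  rw [hTeq]
  set κ : ℝ := ((m : ℝ) - 2) / 2 with hκdef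
  have hm1 : (1 : ℝ) ≤ m := by exact_mod_cast hm
  have hκ : -1 < κ := by rw [hκdef]; linarith
  -- an exponent strictly between `p - κ - 1` and `min 1 p`, or `0`: the singularity on the cone is
  -- integrable in `x`, and what is left of `H` is integrable against the weight
  set b : ℝ := max 0 ((p - κ - 1 + min 1 p) / 2) with hb
  have hmin1 : min 1 p ≤ 1 := min_le_left _ _
  have hminp : min 1 p ≤ p := min_le_right _ _
  have hlt : p - κ - 1 < min 1 p := lt_min (by linarith) (by linarith)
  have hb0 : 0 ≤ b := le_max_left _ _
  have hb1 : b < 1 := max_lt one_pos (by linarith)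
  have hbp : b ≤ p := max_le hp.le (by linarith)
  have hpb : p - b < κ + 1 := by
    have : (p - κ - 1 + min 1 p) / 2 ≤ b := le_max_right _ _
    linarith
  obtain ⟨C, hC⟩ := exists_integrable_bound_waveKernel hp hb0 hbp hpb hh (neg_ne_zero.2 ht)
  obtain ⟨B, hB0, hB⟩ := exists_bound_cutoff_mul_rpow hψ hlam
  -- damping parameters that tend to `-it` from inside the half-plane
  set y : ℕ → ℂ := fun n ↦ ((1 / ((n : ℝ) + 1) : ℝ) : ℂ) + -(I * t) with hydef
  have h0re : (-(I * t) : ℂ).re = 0 := by simp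
  have h0im : (-(I * t) : ℂ).im = -t := by simp
  have hyre : ∀ n, 0 < (y n).re := fun n ↦ by
    simp only [hydef, add_re, ofReal_re, h0re, add_zero]
    positivity
  have hyim : ∀ n, (y n).im = -t := fun n ↦ by simp [hydef]
  have hylim : Tendsto y atTop (𝓝 (-(I * t))) := by
    have h1 := (continuous_ofReal.tendsto 0).comp
      (tendsto_one_div_add_atTop_nhds_zero_nat (𝕜 := ℝ))
    have h2 := h1.add_const (-(I * t))
    simpa [hydef, Function.comp_def] using! h2
  intro φ
  set bound : EuclideanSpace ℝ (Fin (m + 1)) → ℝ := fun x ↦ |sliceConst m * C| *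
    (‖φ x‖ + ‖φ x‖ * |t - ‖x‖| ^ (-b) + ‖φ x‖ * |-t - ‖x‖| ^ (-b)) with hbound
  have hboundi : Integrable bound :=
    ((φ.integrable.norm.add (integrable_schwartz_mul_abs_sub_rpow φ hb0 hb1 t)).add
      (integrable_schwartz_mul_abs_sub_rpow φ hb0 hb1 (-t))).const_mul _
  have hdom : ∀ᵐ x : EuclideanSpace ℝ (Fin (m + 1)), ∀ z : ℂ, 0 ≤ z.re → z.im = -t →
      ‖φ x * (sliceConst m * waveKernel κ p h z ‖x‖)‖ ≤ bound x := by
    filter_upwards [ae_norm_ne (-t)] with x hx z hz hzt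
    have h1 := hC z ‖x‖ hz hzt hx.1 hx.2.1 hx.2.2
    have e1 : |-t + ‖x‖| = |t - ‖x‖| := by rw [← abs_neg]; congr 1; ring
    rw [e1] at h1
    have hS : 0 ≤ 1 + |t - ‖x‖| ^ (-b) + |-t - ‖x‖| ^ (-b) := by positivity
    rw [norm_mul, norm_mul, norm_real, Real.norm_eq_abs]
    calc ‖φ x‖ * (|sliceConst m| * ‖waveKernel κ p h z ‖x‖‖)
        ≤ ‖φ x‖ * (|sliceConst m| * (|C| * (1 + |t - ‖x‖| ^ (-b) + |-t - ‖x‖| ^ (-b)))) := by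
          gcongr
          exact h1.trans (mul_le_mul_of_nonneg_right (le_abs_self C) hS)
      _ = bound x := by rw [hbound]; simp only [abs_mul]; ring
  have hlim : ∀ᵐ x : EuclideanSpace ℝ (Fin (m + 1)),
      Tendsto (fun n ↦ φ x * (sliceConst m * waveKernel κ p h (y n) ‖x‖)) atTop
        (𝓝 (φ x * waveFun m p h t x)) := by
    filter_upwards [ae_norm_ne (-t)] with x hx
    have hc := continuousAt_waveKernel (y := -(I * t)) hκ hp hh h0re.ge hx.1
      (by rw [h0im]; exact hx.2.1) (by rw [h0im]; exact hx.2.2)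
    exact ((hc.tendsto.comp hylim).const_mul _).const_mul _
  have hmeas : ∀ n, AEStronglyMeasurable
      (fun x ↦ φ x * (sliceConst m * waveKernel κ p h (y n) ‖x‖)) :=
    fun n ↦ (integral_schwartz_mul_waveKernel hm hp hpl hh (hyre n) φ).1.aestronglyMeasurable
  refine ⟨hboundi.mono' (aestronglyMeasurable_of_tendsto_ae atTop hmeas hlim) ?_, ?_⟩
  · filter_upwards [hdom] with x hx
    exact hx _ h0re.ge h0im
  · have hL := tendsto_integral_of_dominated_convergence bound hmeas hboundi (fun n ↦ by
      filter_upwards [hdom] with x hx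
      exact hx _ (hyre n).le (hyim n)) hlim
    have hsymb : ∀ ξ : EuclideanSpace ℝ (Fin (m + 1)),
        waveSymbol ψ lam t ξ = dampedSymbol h lam (-(I * t)) ξ := fun ξ ↦ by
      rw [waveSymbol, dampedSymbol, hcut]; congr 2; ring
    have hR : Tendsto (fun n ↦ ∫ η, (𝓕⁻ φ) η * (((2 * Real.pi : ℝ) ^ (m + 1) : ℂ) *
        dampedSymbol h lam (y n) ((2 * Real.pi) • η))) atTop (𝓝 (∫ η, (𝓕⁻ φ) η *
        (((2 * Real.pi : ℝ) ^ (m + 1) : ℂ) * waveSymbol ψ lam t ((2 * Real.pi) • η)))) := by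
      have hhm := hh.smooth.continuous.measurable
      refine tendsto_integral_of_dominated_convergence
        (fun η ↦ ‖(𝓕⁻ φ) η‖ * (‖((2 * Real.pi : ℝ) ^ (m + 1) : ℂ)‖ * B)) (fun n ↦ ?_)
        ((𝓕⁻ φ).integrable.norm.mul_const _) (fun n ↦ Eventually.of_forall fun η ↦ ?_)
        (Eventually.of_forall fun η ↦ ?_)
      · refine (𝓕⁻ φ).continuous.aestronglyMeasurable.mul ?_
        apply Measurable.aestronglyMeasurable
        unfold dampedSymbol
        fun_prop
      · rw [norm_mul, norm_mul]
        gcongr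
        rw [dampedSymbol, norm_mul, Complex.norm_exp, norm_real, Real.norm_eq_abs, ← hcut]
        refine (mul_le_mul (Real.exp_le_one_iff.2 ?_) (hB _) (abs_nonneg _) zero_le_one).trans
          (le_of_eq (one_mul B))
        simp only [neg_re, re_mul_ofReal]
        have := mul_nonneg (hyre n).le (norm_nonneg ((2 * Real.pi) • η))
        linarith
      · rw [hsymb]
        refine (Tendsto.const_mul _ (Tendsto.mul_const _ ?_)).const_mul _
        exact ((hylim.mul_const _).neg).cexp
    have hTφ : (𝓕⁻ T) φ = ∫ η, (𝓕⁻ φ) η *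
        (((2 * Real.pi : ℝ) ^ (m + 1) : ℂ) * waveSymbol ψ lam t ((2 * Real.pi) • η)) :=
      (hT (𝓕⁻ φ)).2
    rw [hTφ]
    refine tendsto_nhds_unique hR (hL.congr fun n ↦ ?_)
    exact (integral_schwartz_mul_waveKernel hm hp hpl hh (hyre n) φ).2.symm

end

/-! ### The decomposition of the kernel -/

/-- The two one-sided powers with their phases are the boundary values of one holomorphic power. -/
theorem conePow_eq_cpow (b : ℝ) {s : ℝ} (hs : s ≠ 0) :
    conePow b s = (-(I * s)) ^ (-(b : ℂ)) := by
  rcases hs.lt_or_gt with h | h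
  · have h' : 0 < -s := neg_pos.2 h
    have e : (-(I * s) : ℂ) = ((-s : ℝ) : ℂ) * I := by push_cast; ring
    rw [conePow, posPow, negPow, if_neg h.not_gt, if_pos h, e, cpow_def_of_ne_zero
      (mul_ne_zero (by exact_mod_cast h'.ne') I_ne_zero), log_ofReal_mul h' I_ne_zero, log_I,
      Real.rpow_def_of_pos h', ofReal_zero, mul_zero, zero_add, ofReal_exp, ← Complex.exp_add]
    congr 1
    push_cast
    ring
  · have e : (-(I * s) : ℂ) = (s : ℂ) * (-I) := by ring
    rw [conePow, posPow, negPow, if_pos h, if_neg h.not_gt, e, cpow_def_of_ne_zero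
      (mul_ne_zero (by exact_mod_cast h.ne') (neg_ne_zero.2 I_ne_zero)),
      log_ofReal_mul h (neg_ne_zero.2 I_ne_zero), log_neg_I,
      Real.rpow_def_of_pos h, ofReal_zero, mul_zero, add_zero, ofReal_exp, ← Complex.exp_add]
    congr 1
    push_cast
    ring

theorem norm_conePow (b : ℝ) {s : ℝ} (hs : s ≠ 0) : ‖conePow b s‖ = |s| ^ (-b) := by
  rw [conePow_eq_cpow b hs, ← ofReal_neg, norm_cpow_real, norm_neg, norm_mul, norm_I, one_mul,
    norm_real, Real.norm_eq_abs]

/-- The amplitude of the singularity carried by the end point `e i` of the slice integral. -/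
noncomputable def waveConst (m : ℕ) (e : ℝ) : ℂ :=
  sliceConst m * (e * I * ((2 * e * I : ℂ) ^ (((((m : ℝ) - 2) / 2 : ℝ)) : ℂ) *
    Real.Gamma (((m : ℝ) - 2) / 2 + 1)))

theorem waveConst_ne_zero {m : ℕ} (hm : 1 ≤ m) {e : ℝ} (he : e ≠ 0) : waveConst m e ≠ 0 := by
  have hm1 : (1 : ℝ) ≤ m := by exact_mod_cast hm
  have h1 : (sliceConst m : ℂ) ≠ 0 := by exact_mod_cast (sliceConst_pos hm).ne'
  have h2 : (e : ℂ) ≠ 0 := by exact_mod_cast he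
  have h3 : (Real.Gamma (((m : ℝ) - 2) / 2 + 1) : ℂ) ≠ 0 := by
    have h0 : 0 < Real.Gamma (((m : ℝ) - 2) / 2 + 1) := Real.Gamma_pos_of_pos (by linarith)
    exact ofReal_ne_zero.2 h0.ne'
  have h4 : (2 * e * I : ℂ) ≠ 0 := mul_ne_zero (mul_ne_zero two_ne_zero h2) I_ne_zero
  have h5 : (2 * e * I : ℂ) ^ (((((m : ℝ) - 2) / 2 : ℝ)) : ℂ) ≠ 0 := by
    rw [cpow_def_of_ne_zero h4]; exact Complex.exp_ne_zero _
  exact mul_ne_zero h1 (mul_ne_zero (mul_ne_zero h2 I_ne_zero) (mul_ne_zero h5 h3))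

/-- On a bounded range a smaller negative power is dominated by a larger one. -/
theorem rpow_neg_le_of_le {q s R ρ : ℝ} (hρ : 0 < ρ) (hR : ρ ≤ R) (hqs : q ≤ s) :
    ρ ^ (-q) ≤ R ^ (s - q) * ρ ^ (-s) := by
  rw [show -q = (s - q) + -s by ring, Real.rpow_add hρ]
  gcongr

section

variable {m : ℕ} {p lam : ℝ} {h : ℝ → ℝ}

/-- The stated main term is the singular part of the kernel on the boundary `Re y = 0`. -/
theorem mainTerm_eq (hpl : p = m + 1 - lam) {t ρ : ℝ} (h1 : t + ρ ≠ 0) (h2 : t - ρ ≠ 0) :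
    mainTerm (m + 1) (waveConst m (-1)) (waveConst m 1) lam t ρ =
      sliceConst m * waveMain (((m : ℝ) - 2) / 2) (p - ((m : ℝ) - 2) / 2 - 1) (-(I * t)) ρ := by
  have e1 : (((m + 1 : ℕ) : ℝ) - 1) / 2 - lam + 1 = p - ((m : ℝ) - 2) / 2 - 1 := by
    rw [hpl]; push_cast; ring
  have e2 : (((m + 1 : ℕ) : ℝ) + 1) / 2 - lam = p - ((m : ℝ) - 2) / 2 - 1 := by
    rw [hpl]; push_cast; ring
  have e3 : (((m + 1 : ℕ) : ℝ) - 1) / 2 = ((m : ℝ) - 2) / 2 + 1 := by push_cast; ring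
  have h1' : ρ + t ≠ 0 := by rwa [add_comm]
  have h2' : -ρ + t ≠ 0 := by rwa [neg_add_eq_sub]
  rw [mainTerm, e1, e2, e3, conePow_eq_cpow _ h1', conePow_eq_cpow _ h2', waveMain, legMain,
    legMain, waveConst, waveConst]
  have f1 : (-(I * t) + ρ * (((1 : ℝ) : ℂ) * I) : ℂ) = -(I * ((-ρ + t : ℝ) : ℂ)) := by
    push_cast; ring
  have f2 : (-(I * t) + ρ * (((-1 : ℝ) : ℂ) * I) : ℂ) = -(I * ((ρ + t : ℝ) : ℂ)) := by
    push_cast; ring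
  rw [f1, f2]
  simp only [ofReal_one, ofReal_neg]
  ring

theorem contDiffAt_waveMain (κ b : ℝ) {y : ℂ} {ρ : ℝ} (hy : 0 ≤ y.re) (hρ : 0 < ρ)
    (h1 : y.im + ρ ≠ 0) (h2 : y.im - ρ ≠ 0) :
    ContDiffAt ℝ ∞ (fun ρ ↦ waveMain κ b y ρ) ρ := by
  have hleg : ∀ e : ℝ, y.im + ρ * e ≠ 0 → ContDiffAt ℝ ∞ (fun ρ ↦ legMain κ b e y ρ) ρ := by
    intro e he
    have hs : y + ρ * (e * I) ∈ slitPlane := by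
      simpa using leg_mem_slitPlane hy hρ le_rfl he
    have ha : AnalyticAt ℂ (fun z : ℂ ↦ (y + z * (e * I)) ^ (-(b : ℂ))) (ρ : ℂ) :=
      AnalyticAt.cpow (by fun_prop) analyticAt_const hs
    have hc : ContDiffAt ℂ ∞ (fun z : ℂ ↦ (y + z * (e * I)) ^ (-(b : ℂ))) (ρ : ℂ) := ha.contDiffAt
    have hc' : ContDiffAt ℝ ∞ (fun ρ : ℝ ↦ (y + ρ * (e * I)) ^ (-(b : ℂ))) ρ :=
      (hc.restrict_scalars ℝ).comp ρ ofRealCLM.contDiff.contDiffAt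
    have hr : ContDiffAt ℝ ∞ (fun ρ : ℝ ↦ ((ρ ^ (-(κ + 1)) : ℝ) : ℂ)) ρ :=
      ofRealCLM.contDiff.contDiffAt.comp ρ (Real.contDiffAt_rpow_const_of_ne hρ.ne')
    exact contDiffAt_const.mul ((contDiffAt_const.mul hr).mul hc')
  exact (contDiffAt_const.mul (hleg 1 (by simpa using h1))).sub
    (contDiffAt_const.mul (hleg (-1) (by simpa [sub_eq_add_neg] using h2)))

/-- The kernel minus its explicit singular part. -/
noncomputable def waveRem (m : ℕ) (lam : ℝ) (h : ℝ → ℝ) (t : ℝ)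
    (x : EuclideanSpace ℝ (Fin (m + 1))) : ℂ :=
  waveFun m (m + 1 - lam) h t x -
    mainTerm (m + 1) (waveConst m (-1)) (waveConst m 1) lam t ‖x‖

theorem contDiffAt_waveRem (hm : 1 ≤ m) (hlam : lam < m + 1) (hh : IsCutoffProfile h) {t : ℝ}
    {x : EuclideanSpace ℝ (Fin (m + 1))} (hx : |t| < ‖x‖) : ContDiffAt ℝ ∞ (waveRem m lam h t) x := by
  have hm1 : (1 : ℝ) ≤ m := by exact_mod_cast hm
  have hx0 : 0 < ‖x‖ := (abs_nonneg t).trans_lt hx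
  have hne : ∀ r : ℝ, |t| < r → t + r ≠ 0 ∧ t - r ≠ 0 := fun r hr ↦
    ⟨by linarith [neg_abs_le t], by linarith [le_abs_self t] |> fun h : t - r < 0 ↦ h.ne⟩
  have hre : (0 : ℝ) ≤ (-(I * t) : ℂ).re := by simp
  have him : (-(I * t) : ℂ).im = -t := by simp
  have h1 : (-(I * t) : ℂ).im + ‖x‖ ≠ 0 := by
    rw [him]; intro h0; exact (hne _ hx).2 (by linarith)
  have h2 : (-(I * t) : ℂ).im - ‖x‖ ≠ 0 := by
    rw [him]; intro h0; exact (hne _ hx).1 (by linarith)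
  have hK := contDiffAt_waveKernel (κ := ((m : ℝ) - 2) / 2) (p := m + 1 - lam) (by linarith)
    (by linarith) hh hre hx0 h1 h2
  have hM := contDiffAt_waveMain (((m : ℝ) - 2) / 2)
    ((m + 1 - lam) - ((m : ℝ) - 2) / 2 - 1) hre hx0 h1 h2
  have hnorm : ContDiffAt ℝ ∞ (fun x : EuclideanSpace ℝ (Fin (m + 1)) ↦ ‖x‖) x :=
    contDiffAt_norm ℝ (norm_pos_iff.1 hx0)
  have hc := ((contDiffAt_const (c := (sliceConst m : ℂ))).mul (hK.sub hM)).comp x hnorm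
  refine hc.congr_of_eventuallyEq ?_
  filter_upwards [continuous_norm.continuousAt.eventually (Ioi_mem_nhds hx)] with z hz
  rw [waveRem, mainTerm_eq rfl (hne _ hz).1 (hne _ hz).2, waveFun]
  simp only [Function.comp_apply]
  ring

/-- Below the critical order the remainder is one power of `|x|` worse than the main term. -/
theorem exists_bound_waveRem (hm : 1 ≤ m) (hlam : (m : ℝ) / 2 < lam) (hlam' : lam < m / 2 + 1)
    (hh : IsCutoffProfile h) {R : ℝ} (t : ℝ) :
    ∃ C : ℝ, 0 ≤ C ∧ ∀ x : EuclideanSpace ℝ (Fin (m + 1)), 0 < ‖x‖ → ‖x‖ ≤ R → t + ‖x‖ ≠ 0 →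
      t - ‖x‖ ≠ 0 → ‖waveRem m lam h t x‖ ≤ C * ‖x‖ ^ (-((m : ℝ) / 2 + 1)) := by
  have hm1 : (1 : ℝ) ≤ m := by exact_mod_cast hm
  have hS := sliceConst_pos hm
  set p : ℝ := m + 1 - lam with hp
  obtain ⟨C, hC0, hC⟩ := exists_norm_waveKernel_sub_waveMain_le (κ := ((m : ℝ) - 2) / 2) (p := p)
    (by linarith) (by linarith) (by linarith) hh
  set s : ℝ := (m : ℝ) / 2 + 1 with hs
  refine ⟨sliceConst m * (C * (|R| ^ (s - p) + |R| ^ (s - 0))), by positivity,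
    fun x hx hxR h1 h2 ↦ ?_⟩
  have hre : (0 : ℝ) ≤ (-(I * t) : ℂ).re := by simp
  have him : (-(I * t) : ℂ).im = -t := by simp
  have hxR' := hxR.trans (le_abs_self R)
  have e : waveRem m lam h t x = sliceConst m * (waveKernel (((m : ℝ) - 2) / 2) p h (-(I * t)) ‖x‖ -
      waveMain (((m : ℝ) - 2) / 2) (p - ((m : ℝ) - 2) / 2 - 1) (-(I * t)) ‖x‖) := by
    rw [waveRem, mainTerm_eq rfl h1 h2, waveFun]
    ring
  rw [e, norm_mul, norm_real, Real.norm_of_nonneg hS.le, mul_assoc]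
  refine mul_le_mul_of_nonneg_left ?_ hS.le
  refine (hC _ _ hre hx ?_ ?_).trans ?_
  · rw [him]; intro h0; exact h2 (by linarith)
  · rw [him]; intro h0; exact h1 (by linarith)
  · rw [mul_assoc]
    refine mul_le_mul_of_nonneg_left ?_ hC0
    have k1 := rpow_neg_le_of_le (q := p) (s := s) hx hxR' (by linarith)
    have k2 := rpow_neg_le_of_le (q := 0) (s := s) hx hxR' (by linarith)
    rw [neg_zero, Real.rpow_zero] at k2
    linarith

/-- Above the critical order both the kernel and its main term are bounded across the cone. -/
theorem exists_bound_waveRem_of_gt (hm : 1 ≤ m) (hlam : (m : ℝ) / 2 + 1 < lam) (hlam' : lam < m + 1)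
    (hh : IsCutoffProfile h) {R : ℝ} (t : ℝ) :
    ∃ C : ℝ, 0 ≤ C ∧ ∀ x : EuclideanSpace ℝ (Fin (m + 1)), 0 < ‖x‖ → ‖x‖ ≤ R → t + ‖x‖ ≠ 0 →
      t - ‖x‖ ≠ 0 → ‖waveRem m lam h t x‖ ≤ C * ‖x‖ ^ (-((m : ℝ) / 2)) := by
  have hm1 : (1 : ℝ) ≤ m := by exact_mod_cast hm
  have hS := sliceConst_pos hm
  set p : ℝ := m + 1 - lam with hp
  obtain ⟨C, hC0, hC⟩ := exists_bound_waveKernel_of_lt (κ := ((m : ℝ) - 2) / 2) (p := p) (h := h)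
    (by linarith) (by linarith) hh
  set s : ℝ := (m : ℝ) / 2 with hs
  set b : ℝ := (((m + 1 : ℕ) : ℝ) + 1) / 2 - lam with hb
  have hb0 : b < 0 := by rw [hb]; push_cast; linarith
  set Γc : ℂ := (Real.Gamma ((((m + 1 : ℕ) : ℝ) - 1) / 2 - lam + 1) : ℂ) with hΓ
  set P : ℝ := (|R| + |t|) ^ (-b) with hP
  have hP0 : 0 ≤ P := by positivity
  refine ⟨sliceConst m * (C * (|R| ^ (s - p) + |R| ^ (s - 0))) +
    ‖Γc‖ * (‖waveConst m (-1)‖ * P + ‖waveConst m 1‖ * P), by positivity, fun x hx hxR h1 h2 ↦ ?_⟩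
  have hre : (0 : ℝ) ≤ (-(I * t) : ℂ).re := by simp
  have hxR' := hxR.trans (le_abs_self R)
  rw [waveRem]
  refine (norm_sub_le _ _).trans ?_
  rw [add_mul]
  refine add_le_add ?_ ?_
  · rw [waveFun, norm_mul, norm_real, Real.norm_of_nonneg hS.le, mul_assoc]
    refine mul_le_mul_of_nonneg_left ((hC _ _ hre hx).trans ?_) hS.le
    rw [mul_assoc]
    refine mul_le_mul_of_nonneg_left ?_ hC0
    have k1 := rpow_neg_le_of_le (q := p) (s := s) hx hxR' (by linarith)
    have k2 := rpow_neg_le_of_le (q := 0) (s := s) hx hxR' (by linarith)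
    rw [neg_zero, Real.rpow_zero] at k2
    linarith
  · have hcone : ∀ r : ℝ, r ≠ 0 → |r| ≤ |R| + |t| → ‖conePow b r‖ ≤ P := fun r hr hle ↦ by
      rw [norm_conePow b hr]
      exact Real.rpow_le_rpow (abs_nonneg r) hle (by linarith)
    have c1 := hcone (‖x‖ + t) (by rwa [add_comm])
      ((abs_add_le _ _).trans (by rw [abs_norm]; linarith))
    have c2 := hcone (-‖x‖ + t) (by rwa [neg_add_eq_sub])
      ((abs_add_le _ _).trans (by rw [abs_neg, abs_norm]; linarith))
    have es : (((m + 1 : ℕ) : ℝ) - 1) / 2 = s := by rw [hs]; push_cast; ring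
    rw [mainTerm, norm_mul, norm_mul, norm_real (_ ^ _), es,
      Real.norm_of_nonneg (Real.rpow_nonneg hx.le _), ← es, mul_right_comm]
    refine mul_le_mul_of_nonneg_right (mul_le_mul_of_nonneg_left ?_ (norm_nonneg _))
      (Real.rpow_nonneg hx.le _)
    refine (norm_add_le _ _).trans (add_le_add ?_ ?_)
    · rw [norm_mul]; gcongr
    · rw [norm_mul]; gcongr

/-- Cutting the remainder off outside a ball that contains the light cone in its interior separates
the singular part from a smooth function. -/
theorem exists_decomposition (hm : 1 ≤ m) (hlam : (m : ℝ) / 2 < lam) (hlam' : lam < m + 1)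
    (hne : lam ≠ m / 2 + 1) (hh : IsCutoffProfile h) {t : ℝ} (ht : t ≠ 0) :
    ∃ c D : EuclideanSpace ℝ (Fin (m + 1)) → ℂ,
      (∀ᵐ x : EuclideanSpace ℝ (Fin (m + 1)), waveFun m (m + 1 - lam) h t x =
        mainTerm (m + 1) (waveConst m (-1)) (waveConst m 1) lam t ‖x‖ + c x + D x) ∧
      ContDiff ℝ ∞ D ∧
      (∃ C : ℝ, ∀ x, x ≠ 0 → ‖c x‖ ≤ C * ‖x‖ ^ (-((m : ℝ) / 2 + 1))) ∧
      ((m : ℝ) / 2 + 1 < lam → ∃ C : ℝ, ∀ x, x ≠ 0 →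
        ‖c x‖ ≤ C * min (‖x‖ ^ (-((m : ℝ) / 2 + 1))) (‖x‖ ^ (-((m : ℝ) / 2)))) := by
  classical
  have ht0 : 0 < |t| := abs_pos.2 ht
  let χ : ContDiffBump (0 : EuclideanSpace ℝ (Fin (m + 1))) :=
    ⟨2 * |t|, 3 * |t|, by positivity, by linarith⟩
  -- on the light cone, a null set, `c` is set to `0` so that its bounds hold at every `x ≠ 0`
  set c : EuclideanSpace ℝ (Fin (m + 1)) → ℂ := fun x ↦
    if t + ‖x‖ = 0 ∨ t - ‖x‖ = 0 then 0 else (χ x : ℂ) * waveRem m lam h t x with hc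
  have hcle : ∀ (C : ℝ) (f : ℝ → ℝ), (∀ r, 0 < r → 0 ≤ C * f r) →
      (∀ x : EuclideanSpace ℝ (Fin (m + 1)), 0 < ‖x‖ → ‖x‖ ≤ 3 * |t| → t + ‖x‖ ≠ 0 →
        t - ‖x‖ ≠ 0 → ‖waveRem m lam h t x‖ ≤ C * f ‖x‖) →
      ∀ x, x ≠ 0 → ‖c x‖ ≤ C * f ‖x‖ := by
    intro C f hf hC x hx
    have hx0 : 0 < ‖x‖ := norm_pos_iff.2 hx
    simp only [hc]
    split_ifs with hcone
    · rw [norm_zero]; exact hf _ hx0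
    · rw [not_or] at hcone
      rcases le_or_gt ‖x‖ (3 * |t|) with hle | hgt
      · rw [norm_mul, norm_real, Real.norm_of_nonneg χ.nonneg]
        exact (mul_le_of_le_one_left (norm_nonneg _) χ.le_one).trans
          (hC x hx0 hle hcone.1 hcone.2)
      · rw [χ.zero_of_le_dist (by rw [dist_zero_right]; exact hgt.le), ofReal_zero, zero_mul,
          norm_zero]
        exact hf _ hx0
  have hmin : (m : ℝ) / 2 + 1 < lam → ∃ C : ℝ, ∀ x, x ≠ 0 →
      ‖c x‖ ≤ C * min (‖x‖ ^ (-((m : ℝ) / 2 + 1))) (‖x‖ ^ (-((m : ℝ) / 2))) := by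
    intro hgt
    obtain ⟨C, hC0, hC⟩ := exists_bound_waveRem_of_gt hm hgt hlam' hh (R := 3 * |t|) t
    refine ⟨C * (3 * |t| + 1), hcle _ (fun r ↦ min (r ^ (-((m : ℝ) / 2 + 1)))
      (r ^ (-((m : ℝ) / 2)))) (fun r hr ↦ ?_) fun x hx hxR h1 h2 ↦ ?_⟩
    · exact mul_nonneg (by positivity) (le_min (by positivity) (by positivity))
    · refine (hC x hx hxR h1 h2).trans ?_
      rw [mul_assoc]
      refine mul_le_mul_of_nonneg_left ?_ hC0
      have hpos : 0 ≤ ‖x‖ ^ (-((m : ℝ) / 2)) := by positivity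
      have hpos' : 0 ≤ ‖x‖ ^ (-((m : ℝ) / 2 + 1)) := by positivity
      have k := rpow_neg_le_of_le (q := (m : ℝ) / 2) (s := (m : ℝ) / 2 + 1) hx hxR (by linarith)
      rw [add_sub_cancel_left, Real.rpow_one] at k
      rcases min_choice (‖x‖ ^ (-((m : ℝ) / 2 + 1))) (‖x‖ ^ (-((m : ℝ) / 2))) with h0 | h0 <;>
        rw [h0] <;> nlinarith
  refine ⟨c, fun x ↦ (1 - (χ x : ℂ)) * waveRem m lam h t x, ?_, ?_, ?_, hmin⟩
  · filter_upwards [ae_norm_ne t] with x hx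
    simp only [hc, hx.2.1, hx.2.2, or_self, if_false]
    rw [waveRem]
    ring
  · refine contDiff_iff_contDiffAt.2 fun x ↦ ?_
    rcases lt_or_ge ‖x‖ (2 * |t|) with hx | hx
    · refine (contDiffAt_const (c := (0 : ℂ))).congr_of_eventuallyEq ?_
      filter_upwards [continuous_norm.continuousAt.eventually (Iio_mem_nhds hx)] with z hz
      have hz' : z ∈ closedBall (0 : EuclideanSpace ℝ (Fin (m + 1))) χ.rIn :=
        mem_closedBall_zero_iff.2 (le_of_lt hz)
      rw [χ.one_of_mem_closedBall hz', ofReal_one, sub_self, zero_mul]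
    · have hχ : ContDiffAt ℝ ∞ (fun x ↦ (χ x : ℂ)) x :=
        (ofRealCLM.contDiff.comp χ.contDiff).contDiffAt
      exact (contDiffAt_const.sub hχ).mul (contDiffAt_waveRem hm hlam' hh (by linarith))
  · rcases lt_or_gt_of_ne hne with hlt | hgt
    · obtain ⟨C, hC0, hC⟩ := exists_bound_waveRem hm hlam hlt hh (R := 3 * |t|) t
      exact ⟨C, hcle C (fun r ↦ r ^ (-((m : ℝ) / 2 + 1)))
        (fun r hr ↦ mul_nonneg hC0 (Real.rpow_nonneg hr.le _)) hC⟩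
    · obtain ⟨C, hC⟩ := hmin hgt
      refine ⟨|C|, fun x hx ↦ (hC x hx).trans ?_⟩
      have hx0 : 0 < ‖x‖ := norm_pos_iff.2 hx
      refine mul_le_mul (le_abs_self C) (min_le_left _ _) (le_min ?_ ?_) (abs_nonneg C) <;>
        positivity

end

end WaveData

theorem mainTheorem4 (d : ℕ) (hd : 1 < d) :
    ∃ cp cm : ℂ, cp ≠ 0 ∧ cm ≠ 0 ∧
      ∀ ψ : EuclideanSpace ℝ (Fin d) → ℝ, WaveData.IsRadialMollifier ψ →
      ∀ lam : ℝ, ((d : ℝ) - 1) / 2 < lam → lam < d →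
        (∀ n : ℕ, ((d : ℝ) - 1) / 2 - lam ≠ -(n : ℝ)) →
      ∃ u : ℝ → EuclideanSpace ℝ (Fin d) → ℂ,
        (∀ t : ℝ, t ≠ 0 → ∀ σ : ℝ, 1 ≤ σ →
          WaveData.IsGivenBy
            (WaveData.bracketD (σ - 1) (WaveData.halfWave t (WaveData.FLam ψ σ lam))) (u t)) ∧
        (∀ t : ℝ, t ≠ 0 →
          ∃ c D : EuclideanSpace ℝ (Fin d) → ℂ,
            (∀ᵐ x : EuclideanSpace ℝ (Fin d),
              u t x = WaveData.mainTerm d cp cm lam t ‖x‖ + c x + D x) ∧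
            ContDiff ℝ ∞ D ∧
            (∃ C : ℝ, ∀ x, x ≠ 0 → ‖c x‖ ≤ C * ‖x‖ ^ (-(((d : ℝ) + 1) / 2))) ∧
            (((d : ℝ) + 1) / 2 < lam →
              ∃ C : ℝ, ∀ x, x ≠ 0 →
                ‖c x‖ ≤ C * min (‖x‖ ^ (-(((d : ℝ) + 1) / 2))) (‖x‖ ^ (-(((d : ℝ) - 1) / 2))))) ∧
        (∀ A : ℝ, 1 < A → ∀ N : ℝ, (d : ℝ) - lam < N →
          ∃ C : ℝ, ∀ t : ℝ, t ≠ 0 → ∀ x : EuclideanSpace ℝ (Fin d), A * |t| ≤ ‖x‖ →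
            ‖u t x‖ ≤ C * ‖x‖ ^ (-N)) := by
  obtain ⟨m, rfl⟩ : ∃ m, d = m + 1 := ⟨d - 1, by omega⟩
  have hm : 1 ≤ m := by omega
  have hm1 : (1 : ℝ) ≤ m := by exact_mod_cast hm
  refine ⟨WaveData.waveConst m (-1), WaveData.waveConst m 1,
    WaveData.waveConst_ne_zero hm (by norm_num), WaveData.waveConst_ne_zero hm one_ne_zero,
    fun ψ hψ lam hlam hlamd hn ↦ ?_⟩
  obtain ⟨h, hh, hcut⟩ := WaveData.exists_cutoffProfile hψ
  have e1 : (((m + 1 : ℕ) : ℝ) - 1) / 2 = m / 2 := by push_cast; ring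
  have e2 : (((m + 1 : ℕ) : ℝ) + 1) / 2 = m / 2 + 1 := by push_cast; ring
  have e3 : ((m + 1 : ℕ) : ℝ) = m + 1 := by push_cast; ring
  rw [e1] at hlam
  -- of the excluded values only `λ = (d + 1) / 2`, where `b = 0`, matters
  have hn1 := hn 1
  rw [e1] at hn1
  rw [e3] at hlamd
  refine ⟨WaveData.waveFun m (m + 1 - lam) h, fun t ht σ hσ ↦ ?_, fun t ht ↦ ?_,
    fun A hA N hN ↦ ?_⟩
  · exact WaveData.isGivenBy_waveFun hm (by linarith) (by linarith) rfl (by linarith) hψ hh hcut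
      ht hσ
  · rw [e1, e2]
    refine WaveData.exists_decomposition hm hlam hlamd (fun h0 ↦ hn1 ?_) hh ht
    rw [h0]; push_cast; ring
  · rw [e3] at hN
    obtain ⟨C, hC⟩ := WaveData.exists_decay_waveKernel (κ := ((m : ℝ) - 2) / 2)
      (p := m + 1 - lam) (by linarith) (by linarith) hh hA hN
    refine ⟨WaveData.sliceConst m * C, fun t ht x hx ↦ ?_⟩
    have hx0 : 0 < ‖x‖ := lt_of_lt_of_le (mul_pos (by linarith) (abs_pos.2 ht)) hx
    rw [WaveData.waveFun, norm_mul, Complex.norm_real,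
      Real.norm_of_nonneg (WaveData.sliceConst_pos hm).le, mul_assoc]
    refine mul_le_mul_of_nonneg_left ?_ (WaveData.sliceConst_pos hm).le
    exact hC _ _ (by simp) hx0 (by simpa using hx)
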